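/- Let $d\ge 1$, $\alpha\in(1,2]$, $T>0$, and let $\nu$ be a finite, non-zero, symmetric measure on the unit sphere $S\subset\mathbb{R}^d$ such that the linear span of its support is $\mathbb{R}^d$. Put $\psi(z)=\int_S|\langle z,\xi\rangle|^\alpha\,\nu(d\xi)$, and let $\mathcal{L}$ be the operator with Fourier symbol $\psi$ (with $\mathcal{F}\varphi(y)=\int\varphi(x)e^{-2\pi i\langle x,y\rangle}dx$). Let $(P_t)_{t\ge0}$ be the semigroup generated by $-\mathcal{L}$, that is $P_0=\mathrm{Id}$ and $P_t\varphi=\rho_t*\varphi$ with $\rho_t=\mathcal{F}^{-1}e^{-t\psi}$ for $t>0$ and $\varphi\in C_b^\infty$, extended continuously to the spaces $\mathscr{C}^\gamma$ below. Let $(p_j)_{j\ge-1}\subset C_c^\infty(\mathbb{R}^d)$ be a smooth dyadic partition of unity ($p_{-1},p_0\ge0$ radial, $p_{-1}$ supported in a ball and $p_0$ in an annulus, $p_j=p_0(2^{-j}\cdot)$ for $j\ge0$, $\sum_{j\ge-1}p_j=1$, and $\operatorname{supp}p_i\cap\operatorname{supp}p_j=\emptyset$ for $|i-j|>1$), let $\Delta_ju=\mathcal{F}^{-1}(p_j\mathcal{F}u)$,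 and for $\gamma\in\mathbb{R}$ let $$\|u\|_\gamma=\sup_{j\ge-1}2^{j\gamma}\|\Delta_ju\|_{L^\infty},\qquad \mathscr{C}^\gamma=\Big\{u\in\mathcal{S}'(\mathbb{R}^d):\ \|u\|_\gamma<\infty,\ \lim_{j\to\infty}2^{j\gamma}\|\Delta_ju\|_{L^\infty}=0\Big\}.$$ Write $C_TX=C([0,T],X)$ with the supremum norm and $C^\rho_TX$ for the $\rho$-Hölder continuous functions $[0,T]\to X$ with the norm $\sup_{s<t}\|u(t)-u(s)\|_X/(t-s)^{\rho}+\sup_t\|u(t)\|_X$. Products of distributions are defined through Bony's decomposition $uv=\sum_{j}\sum_{i<j-1}(\Delta_iu\,\Delta_jv+\Delta_iv\,\Delta_ju)+\sum_{|i-j|\le1}\Delta_iu\,\Delta_jv$. Let $\beta\in(\frac{1-\alpha}{2},0)$ and $\theta\in(1-\beta,\beta+\alpha)$. Then for all $V\in C_T(\mathscr{C}^\beta)^d$, $f\in C_T\mathscr{C}^\beta$ and $u^T\in\mathscr{C}^\theta$ the equation $$\partial_tu=\mathcal{L}u-V\cdot\nabla u+f,\qquad u(T,\cdot)=u^T,$$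 has a unique mild solution $u\in C_T\mathscr{C}^\theta\cap C_T^{\theta/\alpha}L^\infty$, that is a unique $u$ in this space with $$u_t=P_{T-t}u^T+\int_t^TP_{s-t}(V_s\cdot\nabla u_s-f_s)\,ds,\qquad t\in[0,T];$$ if $u^T$, $f$ and $V$ are real-valued, then so is $u$. Moreover, the solution map $$\mathscr{C}^\theta\times C_T\mathscr{C}^\beta\times C_T(\mathscr{C}^\beta)^d\ni(u^T,f,V)\mapsto u\in C_T\mathscr{C}^\theta\cap C_T^{\theta/\alpha}L^\infty$$ is continuous. -/

import Mathlib

open MeasureTheory Filter Set Topology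
open scoped SchwartzMap FourierTransform LineDeriv ENNReal ContDiff

noncomputable section

namespace Kolmogorov

/-- The Euclidean space `ℝ^d`. -/
abbrev Rd (d : ℕ) : Type := EuclideanSpace ℝ (Fin d)

/-- The tempered (complex-valued) distributions on `ℝ^d`. -/
abbrev Distr (d : ℕ) : Type := 𝓢'(Rd d, ℂ)

/-- A smooth dyadic partition of unity `(p_j)_{j ≥ -1}` on `ℝ^d`. The index is shifted by one:
`p n` stands for `p_{n-1}`, so that `p 0` is `p_{-1}` and `p 1` is `p_0`. -/
structure IsDyadicPartition {d : ℕ} (p : ℕ → Rd d → ℝ) : Prop where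
  smooth : ∀ n, ContDiff ℝ ∞ (p n)
  compact_support : ∀ n, HasCompactSupport (p n)
  nonneg : ∀ x, 0 ≤ p 0 x ∧ 0 ≤ p 1 x
  radial : ∀ x y, ‖x‖ = ‖y‖ → p 0 x = p 0 y ∧ p 1 x = p 1 y
  support_ball : ∃ R : ℝ, tsupport (p 0) ⊆ Metric.closedBall 0 R
  support_annulus : ∃ a b : ℝ, 0 < a ∧ tsupport (p 1) ⊆ {x | a ≤ ‖x‖ ∧ ‖x‖ ≤ b}
  scaling : ∀ (n : ℕ) (x : Rd d), p (n + 1) x = p 1 (((2 : ℝ) ^ n)⁻¹ • x)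
  sum_eq_one : ∀ x, HasSum (fun n => p n x) 1
  disjoint : ∀ m n : ℕ, m + 1 < n → Disjoint (tsupport (p m)) (tsupport (p n))

variable {d : ℕ}

/-- The distribution given by a bounded measurable function (and `0` for other functions). -/
def ofBounded (g : Rd d → ℂ) : Distr d :=
  open Classical in
  if h : MemLp g ∞ volume then Lp.toTemperedDistribution (h.toLp g) else 0

/-- The `L^∞` norm of a distribution: the norm of the (unique) `L^∞` function that represents it,
and `∞` if there is none. -/
def linftyNorm (u : Distr d) : ℝ≥0∞ :=
  ⨅ (g : Lp ℂ ∞ (volume : Measure (Rd d))) (_ : Lp.toTemperedDistribution g = u), ‖g‖ₑ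

/-- An `L^∞` function that represents the distribution `u` (and `0` if there is none). -/
def linftyFun (u : Distr d) : Rd d → ℂ :=
  open Classical in
  if h : ∃ g : Lp ℂ ∞ (volume : Measure (Rd d)), Lp.toTemperedDistribution g = u
  then h.choose else 0

/-- The Littlewood-Paley block `Δ_{n-1} u = 𝓕⁻¹ (p_{n-1} 𝓕 u)`. -/
def block (p : ℕ → Rd d → ℝ) (n : ℕ) (u : Distr d) : Distr d :=
  𝓕⁻ (TemperedDistribution.smulLeftCLM ℂ (fun z => (p n z : ℂ)) (𝓕 u))

/-- The weighted size `2^{j θ} ‖Δ_j u‖_∞` of the block with `j = n - 1`. -/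
def blockSize (p : ℕ → Rd d → ℝ) (θ : ℝ) (u : Distr d) (n : ℕ) : ℝ≥0∞ :=
  ENNReal.ofReal ((2 : ℝ) ^ (((n : ℝ) - 1) * θ)) * linftyNorm (block p n u)

/-- The norm of `B^θ_{∞,∞}`, with value `∞` outside of that space. -/
def besovNorm (p : ℕ → Rd d → ℝ) (θ : ℝ) (u : Distr d) : ℝ≥0∞ :=
  ⨆ n, blockSize p θ u n

/-- Membership in `𝒞^θ`: finite `B^θ_{∞,∞}` norm and `2^{j θ} ‖Δ_j u‖_∞ → 0`. -/
def MemC (p : ℕ → Rd d → ℝ) (θ : ℝ) (u : Distr d) : Prop :=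
  besovNorm p θ u < ⊤ ∧ Tendsto (blockSize p θ u) atTop (𝓝 0)

/-- Membership in `C([0,T], 𝒞^θ)`; only the values on `[0,T]` matter. -/
def MemCT (p : ℕ → Rd d → ℝ) (T θ : ℝ) (u : ℝ → Distr d) : Prop :=
  (∀ t ∈ Icc 0 T, MemC p θ (u t)) ∧
    ∀ t ∈ Icc 0 T, Tendsto (fun s => besovNorm p θ (u s - u t)) (𝓝[Icc 0 T] t) (𝓝 0)

/-- The norm of `C([0,T], 𝒞^θ)`. -/
def ctNorm (p : ℕ → Rd d → ℝ) (T θ : ℝ) (u : ℝ → Distr d) : ℝ≥0∞ :=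
  ⨆ t ∈ Icc 0 T, besovNorm p θ (u t)

/-- The norm of `C^ρ([0,T], L^∞)`, with value `∞` outside of that space. -/
def holderNorm (T ρ : ℝ) (u : ℝ → Distr d) : ℝ≥0∞ :=
  (⨆ s ∈ Icc 0 T, ⨆ t ∈ Icc 0 T, ⨆ _ : s < t,
      linftyNorm (u t - u s) / ENNReal.ofReal ((t - s) ^ ρ)) +
    ⨆ t ∈ Icc 0 T, linftyNorm (u t)

/-- The paraproduct of `u` (low frequencies) and `v` (high frequencies),
`∑_j ∑_{i < j - 1} Δ_i u Δ_j v`, as a series in the space of distributions. -/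
def para (p : ℕ → Rd d → ℝ) (u v : Distr d) : Distr d :=
  ∑' n : ℕ, ∑ m ∈ Finset.range (n - 1),
    ofBounded (fun x => linftyFun (block p m u) x * linftyFun (block p n v) x)

/-- The resonant product `∑_{|i - j| ≤ 1} Δ_i u Δ_j v`, as a series of distributions. -/
def reso (p : ℕ → Rd d → ℝ) (u v : Distr d) : Distr d :=
  ∑' n : ℕ, ∑ m ∈ Finset.Icc (n - 1) (n + 1),
    ofBounded (fun x => linftyFun (block p m u) x * linftyFun (block p n v) x)

/-- The product of distributions through Bony's decomposition. -/
def prod (p : ℕ → Rd d → ℝ) (u v : Distr d) : Distr d :=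
  para p u v + para p v u + reso p u v

/-- `V · ∇u = ∑ᵢ Vⁱ ∂ᵢ u`. -/
def dotGrad (p : ℕ → Rd d → ℝ) (V : Fin d → Distr d) (u : Distr d) : Distr d :=
  ∑ i, prod p (V i) (∂_{(EuclideanSpace.single i (1 : ℝ) : Rd d)} u)

/-- The symbol `ψ(z) = ∫_S |⟨z, ξ⟩|^α ν(dξ)`. -/
def symb (α : ℝ) (ν : Measure (Metric.sphere (0 : Rd d) 1)) (z : Rd d) : ℝ :=
  ∫ ξ, |inner ℝ z (ξ : Rd d)| ^ α ∂ν

/-- The density `ρ_t = 𝓕⁻¹ (exp (-t ψ))`, for `t > 0`. -/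
def density (α : ℝ) (ν : Measure (Metric.sphere (0 : Rd d) 1)) (t : ℝ) : Rd d → ℂ :=
  𝓕⁻ (fun z : Rd d => ((Real.exp (-t * symb α ν z) : ℝ) : ℂ))

/-- The semigroup `P_t`. On bounded functions it is the convolution with `ρ_t`. Its continuous
extension to `𝒞^β` is the limit of `ρ_t * (∑_{j ≤ N} Δ_j u)` as `N → ∞`, since the smooth bounded
functions `∑_{j ≤ N} Δ_j u` converge to `u` in `𝒞^β`. -/
def semigroup (p : ℕ → Rd d → ℝ) (α : ℝ) (ν : Measure (Metric.sphere (0 : Rd d) 1)) (t : ℝ)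
    (u : Distr d) : Distr d :=
  open Classical in
  if t = 0 then u else
    ∑' n : ℕ, ofBounded (fun x => ∫ y, density α ν t y * linftyFun (block p n u) (x - y))

/-- Mild solutions of `∂_t u = 𝓛u - V·∇u + f`, `u(T) = u^T` on `[0,T]`:
`u_t = P_{T-t} u^T + ∫_t^T P_{s-t} (V_s·∇u_s - f_s) ds`, where the integral is taken in the
space of distributions (tested against Schwartz functions). -/
def IsMildSolution (p : ℕ → Rd d → ℝ) (α : ℝ) (ν : Measure (Metric.sphere (0 : Rd d) 1)) (T : ℝ)
    (uT : Distr d) (f : ℝ → Distr d) (V : ℝ → Fin d → Distr d) (u : ℝ → Distr d) : Prop :=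
  ∀ t ∈ Icc 0 T, ∀ φ : 𝓢(Rd d, ℂ),
    IntervalIntegrable
      (fun s => semigroup p α ν (s - t) (dotGrad p (V s) (u s) - f s) φ) volume t T ∧
    u t φ = semigroup p α ν (T - t) uT φ +
      ∫ s in t..T, semigroup p α ν (s - t) (dotGrad p (V s) (u s) - f s) φ

/-- Mild solutions in the space `C([0,T], 𝒞^θ) ∩ C^{θ/α}([0,T], L^∞)`. -/
def IsRegularMildSolution (p : ℕ → Rd d → ℝ) (α : ℝ)
    (ν : Measure (Metric.sphere (0 : Rd d) 1)) (T θ : ℝ)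
    (uT : Distr d) (f : ℝ → Distr d) (V : ℝ → Fin d → Distr d) (u : ℝ → Distr d) : Prop :=
  MemCT p T θ u ∧ holderNorm T (θ / α) u < ⊤ ∧ IsMildSolution p α ν T uT f V u

/-- The data space `𝒞^θ × C([0,T], 𝒞^β) × C([0,T], (𝒞^β)^d)`. -/
def IsData (p : ℕ → Rd d → ℝ) (T β θ : ℝ)
    (uT : Distr d) (f : ℝ → Distr d) (V : ℝ → Fin d → Distr d) : Prop :=
  MemC p θ uT ∧ MemCT p T β f ∧ ∀ i, MemCT p T β (fun t => V t i)

/-- A distribution is real if it takes real values on real test functions. -/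
def IsReal (u : Distr d) : Prop :=
  ∀ φ : 𝓢(Rd d, ℂ), (∀ x, (φ x).im = 0) → (u φ).im = 0

end Kolmogorov

end

open MeasureTheory Filter Set Topology
open scoped SchwartzMap FourierTransform LineDeriv ENNReal ContDiff

noncomputable section

namespace Kolmogorov

variable {d : ℕ}

/-! The equation is solved by a fixed point of the mild formula, and three quantitative facts carry
the argument. The first is the product estimate: for `u` of regularity `θ` the gradient has
regularity `θ - 1`, and `θ > 1 - β` says that `β + (θ - 1) > 0`, so Bony's series for `V · ∇u`
converges and defines an element of regularity `β` (`besovNorm_prod_le`, `besovNorm_dotGrad_le`).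
The second is smoothing: `P_t` raises regularity by `α κ` at the price `t ^ (-κ)`, for `0 ≤ κ ≤ 1`
(`norm_bl_comp_U`, `besovNorm_src_le`). With `κ = (θ - β) / α` one returns from `β` to `θ`, and `θ <
β + α` makes the singularity integrable. The condition `β > (1 - α) / 2` is exactly what leaves room
for such a `θ`. The third is time regularity: `P_h - 1` is of size `h ^ (θ / α)` from regularity `θ`
to the uniform norm (`norm_comp_U_sub_one`).

Existence follows from Picard iteration in the norm `sup_t e^{-l(T-t)} ‖u_t‖_θ`: for large `l` the
singular kernel has norm at most `1/2` (`exists_weight`, `exists_weighted_bound`,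
`exists_picard_limit`). The same weighted bound gives an a priori estimate for linear mild equations
(`exists_apriori_bound`). Applied to the difference of two solutions, it yields local Lipschitz
dependence on the data, hence both continuity of the solution map and uniqueness
(`exists_stability_bound`). Hölder regularity in time comes from restarting the formula at a later
time (`mild_flow`, `norm_mild_sub_le`). For real data every Picard iterate is real, and so is the
limit.

Bounded functions are handled as functionals on `L^1` (type `XD`, embedded in the distributions by
`emb`). A Fourier multiplier on `L^∞` is then composition with a bounded operator on `L^1` having
the given symbol (`HasSymbol`, `IsMul`, `op`). The basic source of such operators is averaging of
translations, with bounds that do not change under dilation of the symbol (`isMul_fourier`); this is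
why all dyadic estimates have constants independent of the scale.

The symbol `ψ` need not be smooth, so `e^{-tψ}` need not be a Schwartz function. As for a Lévy
process, small jumps are separated from large ones: `ψ = q + b`, with `q` smooth of temperate growth
and `b` an `L^1` multiplier (`symb_decomposition`). Then `e^{-tψ} = e^{-tb} e^{-tq}` is a multiplier
times a Schwartz function, which makes the kernel integrable; homogeneity of `ψ` reduces all times
to time one. -/

/-- The space `L^1(ℝ^d)`. -/
abbrev L1 (d : ℕ) : Type := Lp ℂ 1 (volume : Measure (Rd d))

/-- The space `L^∞(ℝ^d)`. -/
abbrev LI (d : ℕ) : Type := Lp ℂ ∞ (volume : Measure (Rd d))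

/-! ### Bounded functions as the dual of `L^1` -/

/-- The dual of `L^1(ℝ^d)`, a model for `L^∞(ℝ^d)`. -/
abbrev XD (d : ℕ) : Type := L1 d →L[ℂ] ℂ

/-- The pairing of `L^∞` with `L^1`. -/
def pairL : LI d →L[ℂ] XD d := (ContinuousLinearMap.mul ℂ ℂ).lpPairing volume ∞ 1

lemma pairL_apply (g : LI d) (f : L1 d) : pairL g f = ∫ x, g x * f x :=
  ContinuousLinearMap.lpPairing_eq_integral _ g f

/-- The Schwartz functions in `L^1`. -/
abbrev toL1 (φ : 𝓢(Rd d, ℂ)) : L1 d := φ.toLp 1 volume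

lemma denseRange_toL1 : DenseRange (toL1 : 𝓢(Rd d, ℂ) → L1 d) :=
  SchwartzMap.denseRange_toLpCLM (F := ℂ) (p := 1) (μ := (volume : Measure (Rd d))) (by simp)

/-- The distribution given by an element of the dual of `L^1`. -/
def emb : XD d →ₗ[ℂ] Distr d where
  toFun x := ContinuousLinearMap.toPointwiseConvergenceCLM _ _ _ _
    (x ∘L SchwartzMap.toLpCLM ℂ ℂ 1 volume)
  map_add' x y := by ext; rfl
  map_smul' c x := by ext; rfl

@[simp] lemma emb_apply (x : XD d) (φ : 𝓢(Rd d, ℂ)) : emb x φ = x (toL1 φ) := rfl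

lemma emb_injective : Function.Injective (emb : XD d → Distr d) := by
  intro x y h
  ext f
  refine congrFun (denseRange_toL1.equalizer x.continuous y.continuous ?_) f
  funext φ
  simpa using congrArg (fun u : Distr d => u φ) h

lemma emb_pairL (g : LI d) : emb (pairL g) = Lp.toTemperedDistribution g := by
  ext φ
  rw [emb_apply, pairL_apply, Lp.toTemperedDistribution_apply]
  refine integral_congr_ae ?_
  filter_upwards [φ.coeFn_toLp 1 volume] with x hx
  rw [hx, smul_eq_mul, mul_comm]

lemma pairL_injective : Function.Injective (pairL : LI d → XD d) := by
  intro g h e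
  have h1 : Lp.toTemperedDistribution g = Lp.toTemperedDistribution h := by
    rw [← emb_pairL, ← emb_pairL, e]
  have := Lp.ker_toTemperedDistributionCLM_eq_bot (F := ℂ) (μ := (volume : Measure (Rd d)))
    (p := ∞)
  exact LinearMap.ker_eq_bot.1 this h1

lemma norm_pairL_le (g : LI d) : ‖pairL g‖ ≤ ‖g‖ := by
  refine ContinuousLinearMap.opNorm_le_bound _ (norm_nonneg _) fun f => ?_
  have h1 : pairL g f = L1.integral ((ContinuousLinearMap.mul ℂ ℂ).holder 1 g f) := by
    rw [pairL_apply, L1.integral_eq_integral]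
    exact (integral_congr_ae ((ContinuousLinearMap.mul ℂ ℂ).coeFn_holder g f)).symm
  rw [h1]
  refine (L1.norm_integral_le _).trans ?_
  refine (ContinuousLinearMap.norm_holder_apply_apply_le _ g f).trans ?_
  have := ContinuousLinearMap.opNorm_mul_le ℂ ℂ
  gcongr
  nlinarith [norm_nonneg g]

/-- A weight that is square integrable and decays polynomially. -/
def wt (x : Rd d) : ℝ := (1 + ‖x‖) ^ (-((d : ℝ) + 1))

lemma wt_pos (x : Rd d) : 0 < wt x := Real.rpow_pos_of_pos (by positivity) _

lemma wt_continuous : Continuous (wt : Rd d → ℝ) := by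
  refine Continuous.rpow_const (by fun_prop) fun x => Or.inl ?_
  positivity

lemma wt_integrable : Integrable (wt : Rd d → ℝ) :=
  integrable_one_add_norm (by simp)

lemma wt_le_one (x : Rd d) : wt x ≤ 1 :=
  Real.rpow_le_one_of_one_le_of_nonpos (by linarith [norm_nonneg x]) (by linarith [d.cast_nonneg (α := ℝ)])

lemma wt_memLp_two : MemLp (fun x : Rd d => (wt x : ℂ)) 2 volume := by
  rw [memLp_two_iff_integrable_sq_norm]
  · refine wt_integrable.mono' ?_ (ae_of_all _ fun x => ?_)
    · exact ((Complex.continuous_ofReal.comp wt_continuous).norm.pow 2).aestronglyMeasurable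
    · have := wt_pos x
      have := wt_le_one x
      simp only [Complex.norm_real, Real.norm_eq_abs, abs_of_pos (wt_pos x), norm_pow]
      nlinarith
  · exact (Complex.continuous_ofReal.comp wt_continuous).aestronglyMeasurable

/-- The map `f ↦ w f` from `L^2` to `L^1`. -/
def wtMul : Lp ℂ 2 (volume : Measure (Rd d)) →L[ℂ] L1 d :=
  (ContinuousLinearMap.mul ℂ ℂ).holderL volume 2 2 1 (wt_memLp_two.toLp _)

lemma wtMul_coe (f : Lp ℂ 2 (volume : Measure (Rd d))) :
    wtMul f =ᵐ[volume] fun x => (wt x : ℂ) * f x := by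
  have h1 := (ContinuousLinearMap.mul ℂ ℂ).coeFn_holder (r := 1)
    ((wt_memLp_two (d := d)).toLp _) f
  filter_upwards [h1, (wt_memLp_two (d := d)).coeFn_toLp] with x hx hy
  rw [← hy]; exact hx

/-- Hence the range of `wtMul` is dense in `L^1`, and a functional on `L^1` is determined by its
pullback to `L^2`, where Riesz representation applies. -/
lemma exists_wtMul_eq (φ : 𝓢(Rd d, ℂ)) :
    ∃ f : Lp ℂ 2 (volume : Measure (Rd d)), wtMul f = toL1 φ := by
  -- One factor `(1 + ‖x‖) ^ (d + 1)` undoes the weight; the other leaves a bound by a multiple of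
  -- `wt`, which is in `L^2`.
  obtain ⟨C, hC⟩ : ∃ C, ∀ x : Rd d, (1 + ‖x‖) ^ (2 * (d + 1)) * ‖φ x‖ ≤ C := by
    refine ⟨2 ^ (2 * (d + 1)) * ((Finset.Iic ((2 * (d + 1), 0) : ℕ × ℕ)).sup fun m =>
      SchwartzMap.seminorm ℝ m.1 m.2) φ, fun x => ?_⟩
    have := SchwartzMap.one_add_le_sup_seminorm_apply (𝕜 := ℝ) (m := (2 * (d + 1), 0))
      (k := 2 * (d + 1)) (n := 0) le_rfl le_rfl φ x
    rw [norm_iteratedFDeriv_zero] at this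
    exact this
  have hwinv : ∀ x : Rd d, wt x * (1 + ‖x‖) ^ (d + 1) = 1 := fun x => by
    have h0 : 0 < 1 + ‖x‖ := by positivity
    rw [wt, ← Real.rpow_natCast, ← Real.rpow_add h0]; simp
  have hm : MemLp (fun x : Rd d => ((1 + ‖x‖ : ℝ) : ℂ) ^ (d + 1) * φ x) 2 volume := by
    refine (wt_memLp_two.const_mul (C : ℂ)).mono ?_ (ae_of_all _ fun x => ?_)
    · exact Continuous.aestronglyMeasurable
        (((Complex.continuous_ofReal.comp (by fun_prop)).pow _).mul φ.continuous)
    · have h0 : 0 < 1 + ‖x‖ := by positivity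
      have hC0 : 0 ≤ C := le_trans (by positivity) (hC x)
      have hw := wt_pos x
      rw [norm_mul, norm_pow, norm_mul, Complex.norm_real, Complex.norm_real, Complex.norm_real,
        Real.norm_of_nonneg hC0, Real.norm_of_nonneg hw.le, Real.norm_of_nonneg h0.le]
      have := mul_le_mul_of_nonneg_right (hC x) hw.le
      refine le_trans (le_of_eq ?_) this
      have e := hwinv x
      calc (1 + ‖x‖) ^ (d + 1) * ‖φ x‖ = (wt x * (1 + ‖x‖) ^ (d + 1)) *
            ((1 + ‖x‖) ^ (d + 1) * ‖φ x‖) := by rw [e, one_mul]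
        _ = _ := by ring
  refine ⟨hm.toLp _, Lp.ext ?_⟩
  filter_upwards [wtMul_coe (hm.toLp _), hm.coeFn_toLp, φ.coeFn_toLp 1 volume] with x h1 h2 h3
  rw [h1, h2, h3, ← mul_assoc, ← Complex.ofReal_pow, ← Complex.ofReal_mul, hwinv]
  simp

/-- Testing with the phase of `h` on `s` turns the pairing into `∫_s |h|`, while the weighted test
function has `L^1` norm at most `∫_s wt`. Since `s` is arbitrary of finite measure, this localizes
to `|h| ≤ ‖x‖ wt` almost everywhere. -/
lemma lintegral_enorm_le_of_dual (x : XD d) (h : Lp ℂ 2 (volume : Measure (Rd d)))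
    (hin : ∀ f, inner ℂ h f = x (wtMul f)) {s : Set (Rd d)} (hs : MeasurableSet s)
    (hsf : volume s < ⊤) :
    ∫⁻ y in s, ‖h y‖ₑ ≤ ∫⁻ y in s, ENNReal.ofReal (‖x‖ * wt y) := by
  have hhm : AEStronglyMeasurable h volume := (Lp.memLp h).1
  -- Where `h y = 0` the quotient is `0` by convention, which is harmless for the bound `‖k‖ ≤ 1`.
  set k : Rd d → ℂ := s.indicator fun y => h y / (‖h y‖ : ℂ) with hk
  have hkm : AEStronglyMeasurable k volume :=
    ((hhm.aemeasurable.div (Complex.measurable_ofReal.comp_aemeasurable hhm.norm.aemeasurable)).indicator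
      hs).aestronglyMeasurable
  have hkb : ∀ y, ‖k y‖ ≤ s.indicator (fun _ => (1 : ℝ)) y := by
    intro y
    by_cases hy : y ∈ s
    · simp only [hk, indicator_of_mem hy, norm_div, Complex.norm_real, norm_norm]
      exact div_self_le_one _
    · simp [hk, indicator_of_notMem hy]
  have hkL : MemLp k 2 volume := by
    refine MemLp.mono (g := s.indicator fun _ => (1 : ℝ))
      (memLp_indicator_const 2 hs 1 (Or.inr hsf.ne)) hkm (ae_of_all _ fun y => ?_)
    exact (hkb y).trans (le_abs_self _)
  have h1 : inner ℂ h (hkL.toLp k) = ((∫ y in s, ‖h y‖ : ℝ) : ℂ) := by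
    rw [L2.inner_def, ← integral_complex_ofReal, ← integral_indicator hs]
    refine integral_congr_ae ?_
    filter_upwards [hkL.coeFn_toLp] with y hy
    rw [hy]
    by_cases hys : y ∈ s
    · simp only [hk, indicator_of_mem hys, RCLike.inner_apply]
      by_cases h0 : h y = 0
      · simp [h0]
      · have : (‖h y‖ : ℂ) ≠ 0 := by simpa using h0
        rw [div_mul_eq_mul_div, Complex.mul_conj, Complex.normSq_eq_norm_sq]
        push_cast
        field_simp
    · simp [hk, indicator_of_notMem hys]
  have h2 : ‖wtMul (hkL.toLp k)‖ ≤ ∫ y in s, wt y := by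
    rw [L1.norm_eq_integral_norm, ← integral_indicator hs]
    refine integral_mono_ae (L1.integrable_coeFn _).norm (wt_integrable.indicator hs) ?_
    filter_upwards [hkL.coeFn_toLp, wtMul_coe (hkL.toLp k)] with y hy hy2
    rw [hy2, hy, norm_mul, Complex.norm_real, Real.norm_of_nonneg (wt_pos y).le]
    by_cases hys : y ∈ s
    · have := hkb y
      simp only [indicator_of_mem hys] at this ⊢
      nlinarith [wt_pos y]
    · simp [hk, indicator_of_notMem hys]
  have h3 : ∫ y in s, ‖h y‖ ≤ ‖x‖ * ∫ y in s, wt y := by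
    have := x.le_opNorm (wtMul (hkL.toLp k))
    rw [← hin, h1, Complex.norm_real] at this
    exact (le_abs_self _).trans (this.trans (by gcongr))
  have : IsFiniteMeasure (volume.restrict s) := ⟨by simpa using hsf⟩
  have hint : IntegrableOn (fun y => ‖h y‖) s :=
    (((Lp.memLp h).restrict s).integrable (by norm_num)).norm
  rw [← ofReal_integral_norm_eq_lintegral_enorm, ← ofReal_integral_eq_lintegral_ofReal,
    integral_const_mul]
  · exact ENNReal.ofReal_le_ofReal h3
  · exact (wt_integrable.integrableOn).const_mul _
  · exact ae_of_all _ fun y => mul_nonneg (norm_nonneg _) (wt_pos y).le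
  · exact ((Lp.memLp h).restrict s).integrable (by norm_num)

/-- Every functional on `L^1` is given by a bounded function. -/
lemma exists_pairL_eq (x : XD d) : ∃ g : LI d, pairL g = x ∧ ‖g‖ ≤ ‖x‖ := by
  set h := (InnerProductSpace.toDual ℂ (Lp ℂ 2 (volume : Measure (Rd d)))).symm (x ∘L wtMul) with hh
  have hin : ∀ f, inner ℂ h f = x (wtMul f) := fun f => by
    rw [hh, InnerProductSpace.toDual_symm_apply]; rfl
  have hhm : AEStronglyMeasurable h volume := (Lp.memLp h).1
  have key : ∀ s, MeasurableSet s → volume s < ⊤ →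
      ∫⁻ y in s, ‖h y‖ₑ ≤ ∫⁻ y in s, ENNReal.ofReal (‖x‖ * wt y) :=
    fun s hs hsf => lintegral_enorm_le_of_dual x h hin hs hsf
  have hae : ∀ᵐ y, ‖h y‖ ≤ ‖x‖ * wt y := by
    have := ae_le_of_forall_setLIntegral_le_of_sigmaFinite₀ (μ := (volume : Measure (Rd d)))
      hhm.enorm key
    filter_upwards [this] with y hy
    rw [← ofReal_norm] at hy
    exact (ENNReal.ofReal_le_ofReal_iff (mul_nonneg (norm_nonneg _) (wt_pos y).le)).1 hy
  -- Forced by `x (wt f) = ⟨h, f⟩ = ∫ conj h · f = ∫ g · (wt f)`.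
  set g : Rd d → ℂ := fun y => (starRingEnd ℂ) (h y) / (wt y : ℂ) with hg
  have hgm : AEStronglyMeasurable g volume :=
    ((Complex.continuous_conj.measurable.comp_aemeasurable hhm.aemeasurable).div
      (Complex.measurable_ofReal.comp wt_continuous.measurable).aemeasurable).aestronglyMeasurable
  have hgb : ∀ᵐ y, ‖g y‖ ≤ ‖x‖ := by
    filter_upwards [hae] with y hy
    rw [hg, norm_div, RCLike.norm_conj, Complex.norm_real, Real.norm_of_nonneg (wt_pos y).le,
      div_le_iff₀ (wt_pos y)]
    exact hy
  have hgL : MemLp g ∞ volume := memLp_top_of_bound hgm _ hgb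
  refine ⟨hgL.toLp g, ?_, ?_⟩
  · ext f
    refine congrFun (denseRange_toL1.equalizer (pairL _).continuous x.continuous ?_) f
    funext φ
    obtain ⟨f, hf⟩ := exists_wtMul_eq φ
    simp only [Function.comp_apply]
    rw [← hf, ← hin, pairL_apply, L2.inner_def]
    refine integral_congr_ae ?_
    filter_upwards [wtMul_coe f, hgL.coeFn_toLp] with y h1 h2
    rw [h1, h2]
    have : (wt y : ℂ) ≠ 0 := by exact_mod_cast (wt_pos y).ne'
    simp only [hg, RCLike.inner_apply]
    field_simp
  · rw [Lp.norm_toLp]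
    refine ENNReal.toReal_le_of_le_ofReal (norm_nonneg _) ?_
    exact eLpNormEssSup_le_of_ae_bound hgb

lemma norm_pairL (g : LI d) : ‖pairL g‖ = ‖g‖ := by
  obtain ⟨g', h1, h2⟩ := exists_pairL_eq (pairL g)
  rw [pairL_injective h1] at h2
  exact le_antisymm (norm_pairL_le g) h2

/-- The duality between `L^1` and `L^∞`. -/
def dualEquiv : LI d ≃ₗᵢ[ℂ] XD d :=
  LinearIsometryEquiv.ofSurjective ⟨pairL.toLinearMap, norm_pairL⟩
    fun x => (exists_pairL_eq x).imp fun _ h => h.1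

/-- The bounded function that represents a functional. -/
def fn (x : XD d) : LI d := dualEquiv.symm x

lemma pairL_fn (x : XD d) : pairL (fn x) = x := dualEquiv.apply_symm_apply x

lemma fn_pairL (g : LI d) : fn (pairL g) = g := dualEquiv.symm_apply_apply g

lemma norm_fn (x : XD d) : ‖fn x‖ = ‖x‖ := dualEquiv.symm.norm_map x

lemma toTD_fn (x : XD d) : Lp.toTemperedDistribution (fn x) = emb x := by
  rw [← emb_pairL, pairL_fn]

lemma toTD_eq_emb_iff (g : LI d) (x : XD d) :
    Lp.toTemperedDistribution g = emb x ↔ g = fn x := by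
  constructor
  · intro h
    rw [← emb_pairL] at h
    rw [← emb_injective h, fn_pairL]
  · rintro rfl
    exact toTD_fn x

lemma linftyNorm_emb (x : XD d) : linftyNorm (emb x) = ‖x‖ₑ := by
  have : ‖x‖ₑ = ‖fn x‖ₑ := by rw [enorm_eq_iff_norm_eq, norm_fn]
  rw [this, linftyNorm]
  refine le_antisymm (iInf₂_le (fn x) (toTD_fn x)) (le_iInf₂ fun g hg => ?_)
  rw [(toTD_eq_emb_iff g x).1 hg]

lemma exists_emb_of_linftyNorm_lt {u : Distr d} (h : linftyNorm u < ⊤) : ∃ x, emb x = u := by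
  simp only [linftyNorm, iInf_lt_iff] at h
  obtain ⟨g, hg, -⟩ := h
  exact ⟨pairL g, by rw [emb_pairL, hg]⟩

lemma linftyFun_emb (x : XD d) : linftyFun (emb x) = fn x := by
  have h : ∃ g : LI d, Lp.toTemperedDistribution g = emb x := ⟨_, toTD_fn x⟩
  rw [linftyFun, dif_pos h, (toTD_eq_emb_iff _ x).1 h.choose_spec]

lemma ofBounded_eq {g : Rd d → ℂ} (h : MemLp g ∞ volume) :
    ofBounded g = emb (pairL (h.toLp g)) := by
  rw [ofBounded, dif_pos h, emb_pairL]

/-! ### Fourier multipliers on `L^1` -/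

/-- The character `x ↦ exp (2 π i ⟨x, z⟩)`. -/
def chrF (z x : Rd d) : ℂ := (Real.fourierChar (inner ℝ x z) : ℂ)

lemma chrF_continuous (z : Rd d) : Continuous (chrF z) := by
  unfold chrF
  exact continuous_subtype_val.comp (Real.continuous_fourierChar.comp (by fun_prop))

lemma norm_chrF (z x : Rd d) : ‖chrF z x‖ = 1 := Circle.norm_coe _

lemma chrF_add (z x y : Rd d) : chrF z (x + y) = chrF z x * chrF z y := by
  simp [chrF, inner_add_left, AddChar.map_add_eq_mul]

lemma chrF_add_left (z w x : Rd d) : chrF (z + w) x = chrF z x * chrF w x := by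
  simp [chrF, inner_add_right, AddChar.map_add_eq_mul]

lemma chrF_neg (z x : Rd d) : chrF z (-x) = chrF (-z) x := by
  simp [chrF]

lemma chrF_zero (z : Rd d) : chrF z 0 = 1 := by simp [chrF]

lemma chrF_memLp (z : Rd d) : MemLp (chrF z) ∞ volume :=
  memLp_top_of_bound (chrF_continuous z).aestronglyMeasurable 1
    (ae_of_all _ fun x => (norm_chrF z x).le)

/-- The character as a bounded function. -/
def chr (z : Rd d) : LI d := (chrF_memLp z).toLp _

lemma coeFn_chr (z : Rd d) : chr z =ᵐ[volume] chrF z := MemLp.coeFn_toLp _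

/-- The inverse Fourier transform of an integrable function, at the point `z`. -/
def fi (z : Rd d) : XD d := pairL (chr z)

lemma fi_apply (z : Rd d) (f : L1 d) : fi z f = ∫ x, chrF z x * f x := by
  rw [fi, pairL_apply]
  refine integral_congr_ae ?_
  filter_upwards [coeFn_chr z] with x hx
  rw [hx]

lemma fi_eq_fourierInv (z : Rd d) (f : L1 d) : fi z f = 𝓕⁻ (f : Rd d → ℂ) z := by
  rw [fi_apply, Real.fourierInv_eq]; rfl

lemma fi_toL1 (z : Rd d) (φ : 𝓢(Rd d, ℂ)) : fi z (toL1 φ) = 𝓕⁻ φ z := by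
  rw [fi_eq_fourierInv, Real.fourierInv_congr_ae (φ.coeFn_toLp 1 volume), SchwartzMap.fourierInv_coe]

/-- Every Schwartz function is some `𝓕 φ`, and moving the Fourier transform across the pairing
expresses `∫ f 𝓕 φ` through the values `fi z f`. Consequently operators on `L^1` with the same
symbol coincide, and identities between them are checked on symbols. -/
lemma L1_ext {f g : L1 d} (h : ∀ z, fi z f = fi z g) : f = g := by
  have hker := Lp.ker_toTemperedDistributionCLM_eq_bot (F := ℂ) (μ := (volume : Measure (Rd d)))
    (p := 1)
  refine LinearMap.ker_eq_bot.1 hker ?_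
  change Lp.toTemperedDistribution f = Lp.toTemperedDistribution g
  have key : ∀ (f : L1 d) (φ : 𝓢(Rd d, ℂ)),
      Lp.toTemperedDistribution f (𝓕 φ) = ∫ z, fi z f * φ (-z) := by
    intro f φ
    rw [Lp.toTemperedDistribution_apply]
    have h1 := VectorFourier.integral_fourierIntegral_smul_eq_flip (μ := volume) (ν := volume)
      (L := innerₗ (Rd d)) (f := (φ : Rd d → ℂ)) (g := (f : Rd d → ℂ)) Real.continuous_fourierChar
      (innerSL ℝ).continuous₂ φ.integrable (L1.integrable_coeFn f)
    rw [flip_innerₗ] at h1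
    refine Eq.trans h1 ?_
    rw [← integral_neg_eq_self]
    refine integral_congr_ae (ae_of_all _ fun z => ?_)
    simp only [smul_eq_mul, fi_eq_fourierInv, Real.fourierInv_eq_fourier_neg]
    rw [mul_comm]
    rfl
  ext φ
  have h2 : φ = 𝓕 (𝓕⁻ φ) := (FourierTransform.fourier_fourierInv_eq φ).symm
  rw [h2, key, key]
  simp only [h]

/-- The operator `A` on `L^1` is the Fourier multiplier with symbol `m`. -/
def HasSymbol (A : L1 d →L[ℂ] L1 d) (m : Rd d → ℂ) : Prop :=
  ∀ f z, fi z (A f) = m z * fi z f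

namespace HasSymbol

variable {A B : L1 d →L[ℂ] L1 d} {m m' : Rd d → ℂ}

lemma unique (hA : HasSymbol A m) (hB : HasSymbol B m) : A = B := by
  ext1 f
  exact L1_ext fun z => by rw [hA, hB]

lemma one : HasSymbol (1 : L1 d →L[ℂ] L1 d) fun _ => 1 := fun f z => by simp

lemma comp (hA : HasSymbol A m) (hB : HasSymbol B m') :
    HasSymbol (A ∘L B) fun z => m z * m' z := fun f z => by
  rw [ContinuousLinearMap.comp_apply, hA, hB, mul_assoc]

lemma comp_comm (hA : HasSymbol A m) (hB : HasSymbol B m') : A ∘L B = B ∘L A :=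
  (hA.comp hB).unique fun f z => by rw [hB.comp hA f z]; ring

lemma add (hA : HasSymbol A m) (hB : HasSymbol B m') :
    HasSymbol (A + B) fun z => m z + m' z := fun f z => by
  rw [add_apply, map_add, hA, hB, add_mul]

lemma sub (hA : HasSymbol A m) (hB : HasSymbol B m') :
    HasSymbol (A - B) fun z => m z - m' z := fun f z => by
  rw [sub_apply, map_sub, hA, hB, sub_mul]

lemma smul (c : ℂ) (hA : HasSymbol A m) : HasSymbol (c • A) fun z => c * m z := fun f z => by
  rw [smul_apply, map_smul, hA, smul_eq_mul, mul_assoc]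

lemma congr (hA : HasSymbol A m) (h : ∀ z, m z = m' z) : HasSymbol A m' := fun f z => by
  rw [hA, h]

lemma exp (hA : HasSymbol A m) : HasSymbol (NormedSpace.exp A) fun z => Complex.exp (m z) := by
  intro f z
  have h1 := NormedSpace.exp_series_hasSum_exp' (𝕂 := ℂ) A
  have h2 := h1.mapL ((fi z) ∘L (ContinuousLinearMap.apply ℂ (L1 d) f))
  have h3 := (NormedSpace.exp_series_hasSum_exp' (𝕂 := ℂ) (m z)).mul_right (fi z f)
  have hp : ∀ n : ℕ, fi z ((A ^ n) f) = m z ^ n * fi z f := by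
    intro n
    induction n with
    | zero => simp
    | succ n ih => rw [pow_succ', mul_apply_eq_comp, hA, ih, pow_succ', mul_assoc]
  rw [← Complex.exp_eq_exp_ℂ] at h3
  refine h2.unique (h3.congr_fun ?_)
  intro n
  have := hp n
  simp only [ContinuousLinearMap.comp_apply, map_smul, ContinuousLinearMap.apply_apply,
    smul_eq_mul, this, mul_assoc]

end HasSymbol

/-- Translation `f ↦ f (w + ·)` on `L^1`. -/
def tr (w : Rd d) : L1 d →ₗᵢ[ℂ] L1 d :=
  Lp.compMeasurePreservingₗᵢ ℂ (fun x => w + x) (measurePreserving_add_left volume w)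

lemma coeFn_tr (w : Rd d) (f : L1 d) : tr w f =ᵐ[volume] fun x => f (w + x) :=
  Lp.coeFn_compMeasurePreserving f (measurePreserving_add_left volume w)

lemma tr_continuous (f : L1 d) : Continuous (fun w => tr w f) := by
  let g : C(Rd d, C(Rd d, Rd d)) := (ContinuousMap.mk (fun a : Rd d × Rd d => a.1 + a.2)
    continuous_add).curry
  exact Continuous.compMeasurePreservingLp (g := g) (continuous_const (y := f)) g.continuous
    (fun w => measurePreserving_add_left volume w) (by simp)

lemma fi_tr (z w : Rd d) (f : L1 d) : fi z (tr w f) = chrF (-z) w * fi z f := by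
  rw [fi_apply, fi_apply]
  have h1 : ∫ x, chrF z x * (tr w f) x = ∫ x, chrF z x * f (w + x) := by
    refine integral_congr_ae ?_
    filter_upwards [coeFn_tr w f] with x hx
    rw [hx]
  rw [h1, ← integral_add_left_eq_self (fun x => chrF z x * f x) w, ← integral_const_mul]
  refine integral_congr_ae (ae_of_all _ fun x => ?_)
  simp only []
  rw [chrF_add, ← mul_assoc, ← mul_assoc, ← chrF_neg, ← chrF_add z (-w) w]
  simp [chrF_zero]

section Average

variable {Ω : Type*} [MeasurableSpace Ω] (μ : Measure Ω)

lemma integrable_smul_tr {k : Ω → ℂ} (hk : Integrable k μ) {w : Ω → Rd d} (hw : Measurable w)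
    (f : L1 d) : Integrable (fun a => k a • tr (w a) f) μ := by
  refine (hk.norm.mul_const ‖f‖).mono' (hk.1.smul ?_) (ae_of_all _ fun a => ?_)
  · exact (tr_continuous f).comp_aestronglyMeasurable hw.aestronglyMeasurable
  · rw [norm_smul, LinearIsometry.norm_map]

/-- Averages of translations, `f ↦ ∫ k(a) f(w(a) + ·) μ(da)`. -/
def avg {k : Ω → ℂ} (hk : Integrable k μ) {w : Ω → Rd d} (hw : Measurable w) :
    L1 d →L[ℂ] L1 d :=
  LinearMap.mkContinuous
    { toFun := fun f => ∫ a, k a • tr (w a) f ∂μ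
      map_add' := fun f g => by
        rw [← integral_add (integrable_smul_tr μ hk hw f) (integrable_smul_tr μ hk hw g)]
        simp only [map_add, smul_add]
      map_smul' := fun c f => by
        rw [RingHom.id_apply, ← integral_smul]
        simp only [map_smul, smul_comm c] }
    (∫ a, ‖k a‖ ∂μ) fun f => by
      refine (norm_integral_le_integral_norm _).trans (le_of_eq ?_)
      rw [← integral_mul_const]
      simp only [norm_smul, LinearIsometry.norm_map]

lemma avg_apply {k : Ω → ℂ} (hk : Integrable k μ) {w : Ω → Rd d} (hw : Measurable w) (f : L1 d) :
    avg μ hk hw f = ∫ a, k a • tr (w a) f ∂μ := rfl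

lemma norm_avg_le {k : Ω → ℂ} (hk : Integrable k μ) {w : Ω → Rd d} (hw : Measurable w) :
    ‖avg μ hk hw‖ ≤ ∫ a, ‖k a‖ ∂μ :=
  LinearMap.mkContinuous_norm_le _ (integral_nonneg fun _ => norm_nonneg _) _

lemma hasSymbol_avg {k : Ω → ℂ} (hk : Integrable k μ) {w : Ω → Rd d} (hw : Measurable w) :
    HasSymbol (avg μ hk hw) fun z => ∫ a, k a * chrF (-z) (w a) ∂μ := by
  intro f z
  rw [avg_apply, ← ContinuousLinearMap.integral_comp_comm _ (integrable_smul_tr μ hk hw f),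
    ← integral_mul_const]
  refine integral_congr_ae (ae_of_all _ fun a => ?_)
  simp only [map_smul, fi_tr, smul_eq_mul, mul_assoc]

end Average

/-- `m` is the symbol of a Fourier multiplier on `L^1` of norm at most `C`. -/
def IsMul (m : Rd d → ℂ) (C : ℝ) : Prop := ∃ A, HasSymbol A m ∧ ‖A‖ ≤ C

/-- The Fourier multiplier on `L^1` with symbol `m` (and `0` if there is none). -/
def op (m : Rd d → ℂ) : L1 d →L[ℂ] L1 d :=
  open Classical in
  if h : ∃ A, HasSymbol A m then h.choose else 0

lemma HasSymbol.op_eq {A : L1 d →L[ℂ] L1 d} {m : Rd d → ℂ} (h : HasSymbol A m) : op m = A := by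
  have h' : ∃ A, HasSymbol A m := ⟨A, h⟩
  rw [op, dif_pos h']
  exact h'.choose_spec.unique h

namespace IsMul

variable {m m' : Rd d → ℂ} {C C' : ℝ}

lemma hasSymbol (h : IsMul m C) : HasSymbol (op m) m := by
  obtain ⟨A, hA, -⟩ := h
  rwa [hA.op_eq]

lemma norm_le (h : IsMul m C) : ‖op m‖ ≤ C := by
  obtain ⟨A, hA, h⟩ := h
  rwa [hA.op_eq]

lemma nonneg (h : IsMul m C) : 0 ≤ C := (norm_nonneg _).trans h.norm_le

lemma of_hasSymbol {A : L1 d →L[ℂ] L1 d} (h : HasSymbol A m) : IsMul m ‖A‖ := ⟨A, h, le_rfl⟩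

lemma mul (h : IsMul m C) (h' : IsMul m' C') : IsMul (fun z => m z * m' z) (C * C') := by
  refine ⟨op m ∘L op m', h.hasSymbol.comp h'.hasSymbol, ?_⟩
  exact (ContinuousLinearMap.opNorm_comp_le _ _).trans
    (mul_le_mul h.norm_le h'.norm_le (norm_nonneg _) h.nonneg)

lemma add (h : IsMul m C) (h' : IsMul m' C') : IsMul (fun z => m z + m' z) (C + C') :=
  ⟨op m + op m', h.hasSymbol.add h'.hasSymbol,
    (norm_add_le _ _).trans (add_le_add h.norm_le h'.norm_le)⟩

lemma sub (h : IsMul m C) (h' : IsMul m' C') : IsMul (fun z => m z - m' z) (C + C') :=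
  ⟨op m - op m', h.hasSymbol.sub h'.hasSymbol,
    (norm_sub_le _ _).trans (add_le_add h.norm_le h'.norm_le)⟩

lemma const_mul (c : ℂ) (h : IsMul m C) : IsMul (fun z => c * m z) (‖c‖ * C) :=
  ⟨c • op m, h.hasSymbol.smul c, (norm_smul_le _ _).trans
    (mul_le_mul_of_nonneg_left h.norm_le (norm_nonneg _))⟩

lemma one : IsMul (fun _ : Rd d => 1) 1 :=
  ⟨1, HasSymbol.one, ContinuousLinearMap.norm_id_le⟩

lemma mono (h : IsMul m C) (hC : C ≤ C') : IsMul m C' := by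
  obtain ⟨A, hA, h⟩ := h
  exact ⟨A, hA, h.trans hC⟩

lemma congr (h : IsMul m C) (e : ∀ z, m z = m' z) : IsMul m' C := by
  obtain ⟨A, hA, h⟩ := h
  exact ⟨A, hA.congr e, h⟩

lemma op_mul (h : IsMul m C) (h' : IsMul m' C') :
    op (fun z => m z * m' z) = op m ∘L op m' := (h.hasSymbol.comp h'.hasSymbol).op_eq

lemma op_comm (h : IsMul m C) (h' : IsMul m' C') : op m ∘L op m' = op m' ∘L op m :=
  h.hasSymbol.comp_comm h'.hasSymbol

/-- The exponential series without its constant term is dominated termwise by that of `C`. The bound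
vanishes with `C`, which gives the rate of `P_t - 1` for small times. -/
lemma exp_sub_one (h : IsMul m C) : IsMul (fun z => Complex.exp (m z) - 1) (Real.exp C - 1) := by
  refine ⟨NormedSpace.exp (op m) - 1, h.hasSymbol.exp.sub HasSymbol.one, ?_⟩
  have h1 := (NormedSpace.exp_series_hasSum_exp' (𝕂 := ℂ) (op m))
  have h2 := (hasSum_nat_add_iff' 1).2 h1
  have h3 := (NormedSpace.exp_series_hasSum_exp' (𝕂 := ℝ) C)
  rw [← Real.exp_eq_exp_ℝ] at h3
  have h4 := (hasSum_nat_add_iff' 1).2 h3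
  simp only [Finset.range_one, Finset.sum_singleton, Nat.factorial_zero, Nat.cast_one, inv_one,
    pow_zero, one_smul] at h2 h4
  refine h2.norm_le_of_bounded h4 fun n => ?_
  rw [norm_smul, norm_inv, smul_eq_mul]
  simp only [RCLike.norm_natCast]
  gcongr
  exact (norm_pow_le' _ n.succ_pos).trans (pow_le_pow_left₀ (norm_nonneg _) h.norm_le _)

lemma exp (h : IsMul m C) : IsMul (fun z => Complex.exp (m z)) (Real.exp C) := by
  refine ((h.exp_sub_one.add one).congr fun z => ?_).mono (by simp)
  simp

end IsMul

/-- The operator averages the translations by `r • y` with weight `K y`; each translation is an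
isometry of `L^1`, so the bound does not see `r`. -/
lemma isMul_fourier {K : Rd d → ℂ} (hK : Integrable K) (r : ℝ) :
    IsMul (fun z => 𝓕 K (r • z)) (∫ y, ‖K y‖) := by
  refine ⟨avg volume hK (w := fun y => r • y) (by fun_prop), ?_, norm_avg_le _ _ _⟩
  refine (hasSymbol_avg volume hK (w := fun y => r • y) (by fun_prop)).congr fun z => ?_
  rw [Real.fourier_eq]
  refine integral_congr_ae (ae_of_all _ fun y => ?_)
  simp only [chrF, Circle.smul_def, smul_eq_mul, inner_neg_right, real_inner_smul_left,
    real_inner_smul_right]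
  rw [mul_comm]

lemma isMul_schwartz (m : 𝓢(Rd d, ℂ)) : ∃ C, ∀ r : ℝ, IsMul (fun z => m (r • z)) C := by
  refine ⟨∫ y, ‖(𝓕⁻ m) y‖, fun r => ?_⟩
  refine (isMul_fourier (𝓕⁻ m).integrable r).congr fun z => ?_
  rw [← SchwartzMap.fourier_coe, FourierTransform.fourier_fourierInv_eq]

lemma isMul_of_contDiff {m : Rd d → ℂ} (h1 : HasCompactSupport m) (h2 : ContDiff ℝ ∞ m) :
    ∃ C, ∀ r : ℝ, IsMul (fun z => m (r • z)) C :=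
  isMul_schwartz (h1.toSchwartzMap h2)

lemma op_toL1 {m : Rd d → ℂ} {C : ℝ} (h : IsMul m C) (hm : m.HasTemperateGrowth)
    (φ : 𝓢(Rd d, ℂ)) : op m (toL1 φ) = toL1 (𝓕 (SchwartzMap.smulLeftCLM ℂ m (𝓕⁻ φ))) := by
  refine L1_ext fun z => ?_
  rw [h.hasSymbol, fi_toL1, fi_toL1, FourierTransform.fourierInv_fourier_eq,
    SchwartzMap.smulLeftCLM_apply_apply hm]
  rfl

/-! ### Smoothness of the small-jump part of the symbol -/

section TemperateGrowth

variable {Ω : Type*} [MeasurableSpace Ω]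

/-- The Fourier transform of a finite measure carried by the unit ball has bounded derivatives of
every order, because all moments are finite. -/
lemma hasTemperateGrowth_integral_chrF (μ : Measure Ω) [IsFiniteMeasure μ] {w : Ω → Rd d}
    (hw : Measurable w) (hwb : ∀ a, ‖w a‖ ≤ 1) {g : Ω → ℂ} (hg : Measurable g)
    (hgb : ∀ a, ‖g a‖ ≤ 1) :
    (fun z => ∫ a, g a * chrF z (w a) ∂μ).HasTemperateGrowth := by
  -- The density `g` is kept as an extra coordinate, so that after pushing `μ` forward it becomes
  -- the continuous function `Prod.snd`; the phase only involves the first coordinate.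
  set π : Ω → Rd d × ℂ := fun a => (w a, g a) with hπ
  have hπm : Measurable π := hw.prodMk hg
  set L : (Rd d × ℂ) →L[ℝ] Rd d →L[ℝ] ℝ := -((innerSL ℝ) ∘L ContinuousLinearMap.fst ℝ (Rd d) ℂ)
    with hL
  set f : Rd d × ℂ → ℂ := Prod.snd with hf
  have hfm : Continuous f := continuous_snd
  have hnorm : ∀ a, ‖π a‖ ≤ 1 := fun a => max_le (hwb a) (hgb a)
  have hint : ∀ n : ℕ, Integrable (fun v => ‖v‖ ^ n * ‖f v‖) (μ.map π) := by
    intro n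
    rw [integrable_map_measure (by fun_prop) hπm.aemeasurable]
    refine (integrable_const (1 : ℝ)).mono' ?_ (ae_of_all _ fun a => ?_)
    · exact (Measurable.aestronglyMeasurable (Continuous.measurable (by fun_prop))).comp_measurable hπm
    · simp only [Function.comp_apply, norm_mul, norm_pow, norm_norm]
      exact mul_le_one₀ (pow_le_one₀ (norm_nonneg _) (hnorm a)) (norm_nonneg _) (hgb a)
  have heq : (fun z => ∫ a, g a * chrF z (w a) ∂μ) =
      VectorFourier.fourierIntegral Real.fourierChar (μ.map π) L.toLinearMap₁₂ f := by
    funext z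
    rw [VectorFourier.fourierIntegral, integral_map hπm.aemeasurable]
    · refine integral_congr_ae (ae_of_all _ fun a => ?_)
      simp [hL, hπ, hf, chrF, Circle.smul_def, mul_comm]
      exact Or.inl rfl
    · refine Continuous.aestronglyMeasurable ?_
      refine Continuous.smul ?_ hfm
      have h1 : Continuous fun v => -(L v z) := by fun_prop
      exact continuous_subtype_val.comp (Real.continuous_fourierChar.comp h1)
  rw [heq]
  refine ⟨VectorFourier.contDiff_fourierIntegral (N := ⊤) L fun n _ => hint n, fun n => ?_⟩
  refine ⟨0, ∫ v, ‖VectorFourier.fourierPowSMulRight L f v n‖ ∂(μ.map π), fun z => ?_⟩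
  rw [VectorFourier.iteratedFDeriv_fourierIntegral (N := ⊤) L (fun n _ => hint n)
    hfm.aestronglyMeasurable le_top, pow_zero, mul_one]
  exact VectorFourier.norm_fourierIntegral_le_integral_norm _ _ _ _ _

/-- Expanding the square in coordinates gives quadratic monomials in `z` times real parts of Fourier
transforms of compactly supported finite measures. -/
lemma hasTemperateGrowth_quad (μ : Measure Ω) [IsFiniteMeasure μ] {ξ : Ω → Rd d}
    (hξ : Measurable ξ) (hξb : ∀ a, ‖ξ a‖ ≤ 1) {r : Ω → ℝ} (hr : Measurable r)
    (hrb : ∀ a, |r a| ≤ 1) :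
    (fun z => ∫ a, inner ℝ z (ξ a) ^ 2 * Real.cos (r a * inner ℝ z (ξ a)) ∂μ).HasTemperateGrowth := by
  -- The characters are `exp (2 π i ⟨·, ·⟩)`, so the frequency of the cosine is divided by `2 π`.
  set w : Ω → Rd d := fun a => (r a / (2 * Real.pi)) • ξ a with hw
  have hpi : (1 : ℝ) ≤ 2 * Real.pi := by linarith [Real.pi_gt_three]
  have hpi0 : (0 : ℝ) < 2 * Real.pi := by linarith
  have hwm : Measurable w := (hr.div_const _).smul hξ
  have hwb : ∀ a, ‖w a‖ ≤ 1 := fun a => by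
    rw [hw, norm_smul, norm_div, Real.norm_eq_abs, Real.norm_of_nonneg hpi0.le]
    refine mul_le_one₀ ?_ (norm_nonneg _) (hξb a)
    rw [div_le_one hpi0]
    exact (hrb a).trans hpi
  have hcomp : ∀ a i, |ξ a i| ≤ 1 := fun a i => by
    have := PiLp.norm_apply_le (ξ a) i
    exact this.trans (hξb a)
  have hmi : ∀ i, Measurable fun a => ξ a i := fun i =>
    (Continuous.measurable (by fun_prop : Continuous fun x : Rd d => x i)).comp hξ
  have key : ∀ i j, (fun z => ∫ a, ((ξ a i * ξ a j : ℝ) : ℂ) * chrF z (w a) ∂μ).HasTemperateGrowth := by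
    intro i j
    refine hasTemperateGrowth_integral_chrF μ hwm hwb ?_ ?_
    · exact Complex.measurable_ofReal.comp ((hmi i).mul (hmi j))
    · intro a
      rw [Complex.norm_real, norm_mul]
      exact mul_le_one₀ (hcomp a i) (norm_nonneg _) (hcomp a j)
  have hre : ∀ i j, (fun z => (∫ a, ((ξ a i * ξ a j : ℝ) : ℂ) * chrF z (w a) ∂μ).re).HasTemperateGrowth :=
    fun i j => Complex.reCLM.hasTemperateGrowth.comp (key i j)
  have hcoord : ∀ i, (fun z : Rd d => z i).HasTemperateGrowth := fun i =>
    (EuclideanSpace.proj i : Rd d →L[ℝ] ℝ).hasTemperateGrowth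
  have htot : (fun z : Rd d => ∑ i, ∑ j, z i * z j *
      (∫ a, ((ξ a i * ξ a j : ℝ) : ℂ) * chrF z (w a) ∂μ).re).HasTemperateGrowth := by
    refine Function.HasTemperateGrowth.sum fun i _ => Function.HasTemperateGrowth.sum fun j _ => ?_
    exact ((hcoord i).mul (hcoord j)).mul (hre i j)
  convert htot using 2 with z
  have hcos : ∀ a, Real.cos (r a * inner ℝ z (ξ a)) = (chrF z (w a)).re := by
    intro a
    rw [chrF, Real.fourierChar_apply, Complex.exp_ofReal_mul_I_re, hw, real_inner_smul_left,
      real_inner_comm]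
    congr 1
    field_simp
  have hI : ∀ i j, Integrable (fun a => ((ξ a i * ξ a j : ℝ) : ℂ) * chrF z (w a)) μ := by
    intro i j
    refine (integrable_const (1 : ℝ)).mono' ?_ (ae_of_all _ fun a => ?_)
    · exact ((Complex.measurable_ofReal.comp ((hmi i).mul (hmi j))).mul
        ((chrF_continuous z).measurable.comp hwm)).aestronglyMeasurable
    · rw [norm_mul, norm_chrF, mul_one, Complex.norm_real, norm_mul]
      exact mul_le_one₀ (hcomp a i) (norm_nonneg _) (hcomp a j)
  have hIre : ∀ i j, Integrable (fun a => ξ a i * ξ a j * (chrF z (w a)).re) μ := by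
    intro i j
    refine (hI i j).re.congr (ae_of_all _ fun a => ?_)
    simp only [RCLike.re_eq_complex_re, Complex.re_ofReal_mul]
  have hint : ∀ i j, (∫ a, ((ξ a i * ξ a j : ℝ) : ℂ) * chrF z (w a) ∂μ).re =
      ∫ a, ξ a i * ξ a j * (chrF z (w a)).re ∂μ := by
    intro i j
    have := integral_re (hI i j)
    simp only [RCLike.re_eq_complex_re, Complex.re_ofReal_mul] at this
    exact this.symm
  simp only [hint, hcos, ← integral_const_mul]
  have hsum : ∀ a, inner ℝ z (ξ a) ^ 2 * (chrF z (w a)).re =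
      ∑ i, ∑ j, z i * z j * (ξ a i * ξ a j * (chrF z (w a)).re) := by
    intro a
    have h1 : inner ℝ z (ξ a) = ∑ i, z i * ξ a i := by
      rw [PiLp.inner_apply]
      exact Finset.sum_congr rfl fun i _ => by simp [mul_comm]
    rw [h1, sq, Finset.sum_mul_sum, Finset.sum_mul]
    refine Finset.sum_congr rfl fun i _ => ?_
    rw [Finset.sum_mul]
    exact Finset.sum_congr rfl fun j _ => by ring
  simp only [hsum]
  rw [integral_finsetSum _ fun i _ => integrable_finsetSum _ fun j _ => (hIre i j).const_mul _]
  refine Finset.sum_congr rfl fun i _ => ?_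
  rw [integral_finsetSum _ fun j _ => (hIre i j).const_mul _]

end TemperateGrowth

/-- By the Faà di Bruno bound a derivative of `exp (-q)` costs a polynomial factor, and `exp (-c
‖z‖)` beats every polynomial. -/
lemma exp_neg_isSchwartz {q : Rd d → ℝ} (hq : q.HasTemperateGrowth) {c C : ℝ} (hc : 0 < c)
    (hlow : ∀ z, c * ‖z‖ - C ≤ q z) :
    ∃ φ : 𝓢(Rd d, ℂ), ∀ z, φ z = ((Real.exp (-q z) : ℝ) : ℂ) := by
  have hsm : ContDiff ℝ ∞ fun z => Real.exp (-q z) := hq.1.neg.exp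
  refine ⟨⟨fun z => ((Real.exp (-q z) : ℝ) : ℂ), Complex.ofRealCLM.contDiff.comp hsm, ?_⟩,
    fun z => rfl⟩
  intro k n
  obtain ⟨l, D, hD0, hD⟩ := hq.norm_iteratedFDeriv_le_uniform n
  -- The power `k` comes from the Schwartz weight and `l * n` from the growth of `n` derivatives of
  -- `q`.
  set N := k + l * n with hN
  have hmain : ∀ x : Rd d, ‖iteratedFDeriv ℝ n (fun z => ((Real.exp (-q z) : ℝ) : ℂ)) x‖ ≤
      n.factorial * Real.exp (-q x) * ((D + 1) * (1 + ‖x‖) ^ l) ^ n := by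
    intro x
    have e1 : ‖iteratedFDeriv ℝ n (fun z => ((Real.exp (-q z) : ℝ) : ℂ)) x‖ =
        ‖iteratedFDeriv ℝ n (fun z => Real.exp (-q z)) x‖ :=
      Complex.ofRealLI.norm_iteratedFDeriv_comp_left (f := fun z => Real.exp (-q z))
        hsm.contDiffAt (mod_cast le_top)
    rw [e1]
    refine norm_iteratedFDeriv_comp_le (g := Real.exp) (f := fun z => -q z) (N := ∞)
      Real.contDiff_exp hq.1.neg (mod_cast le_top) x ?_ ?_
    · intro i _
      rw [norm_iteratedFDeriv_eq_norm_iteratedDeriv, iteratedDeriv_eq_iterate, Real.iter_deriv_exp,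
        Real.norm_of_nonneg (Real.exp_pos _).le]
    · intro i hi hin
      have e2 : ‖iteratedFDeriv ℝ i (fun z => -q z) x‖ = ‖iteratedFDeriv ℝ i q x‖ := by
        have : iteratedFDeriv ℝ i (fun z => -q z) x = - iteratedFDeriv ℝ i q x :=
          iteratedFDeriv_neg_apply
        rw [this, norm_neg]
      rw [e2]
      have h1 : (1 : ℝ) ≤ (1 + ‖x‖) ^ l := one_le_pow₀ (by linarith [norm_nonneg x])
      -- With `D + 1` the base is at least `1` and is dominated by its `i`-th power, as the
      -- composition bound requires.
      have h2 : D * (1 + ‖x‖) ^ l ≤ (D + 1) * (1 + ‖x‖) ^ l := by nlinarith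
      refine ((hD i hin x).trans h2).trans (le_self_pow₀ ?_ (by omega))
      nlinarith
  refine ⟨n.factorial * (D + 1) ^ n * (Real.exp (C + c) * (N.factorial / c ^ N)), fun x => ?_⟩
  have hx := norm_nonneg x
  have h3 : (1 + ‖x‖) ^ N * Real.exp (-q x) ≤ Real.exp (C + c) * (N.factorial / c ^ N) := by
    have h4 : (c * (1 + ‖x‖)) ^ N / N.factorial ≤ Real.exp (c * (1 + ‖x‖)) :=
      Real.pow_div_factorial_le_exp _ (by positivity) N
    have h5 : Real.exp (-q x) ≤ Real.exp (C + c) * Real.exp (-(c * (1 + ‖x‖))) := by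
      rw [← Real.exp_add]
      exact Real.exp_le_exp.2 (by linarith [hlow x])
    have hf : (0 : ℝ) < N.factorial := by exact_mod_cast N.factorial_pos
    have h6 : (1 + ‖x‖) ^ N ≤ Real.exp (c * (1 + ‖x‖)) * (N.factorial / c ^ N) := by
      rw [mul_pow, div_le_iff₀ hf] at h4
      rw [mul_div_assoc', le_div_iff₀ (by positivity)]
      linarith
    calc (1 + ‖x‖) ^ N * Real.exp (-q x)
        ≤ (Real.exp (c * (1 + ‖x‖)) * (N.factorial / c ^ N)) *
          (Real.exp (C + c) * Real.exp (-(c * (1 + ‖x‖)))) := by gcongr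
      _ = (Real.exp (c * (1 + ‖x‖)) * Real.exp (-(c * (1 + ‖x‖)))) *
          (Real.exp (C + c) * (N.factorial / c ^ N)) := by ring
      _ = _ := by rw [← Real.exp_add]; simp
  calc ‖x‖ ^ k * ‖iteratedFDeriv ℝ n (fun z => ((Real.exp (-q z) : ℝ) : ℂ)) x‖
      ≤ (1 + ‖x‖) ^ k * (n.factorial * Real.exp (-q x) * ((D + 1) * (1 + ‖x‖) ^ l) ^ n) := by
        gcongr
        · linarith
        · exact hmain x
    _ = n.factorial * (D + 1) ^ n * ((1 + ‖x‖) ^ N * Real.exp (-q x)) := by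
        rw [hN, pow_add, pow_mul, mul_pow]; ring
    _ ≤ _ := by gcongr

/-- Taylor's formula with integral remainder for the cosine. It trades the singular weight `y ^ (-1
- α)` of small jumps for the integrable `y ^ (1 - α)`. -/
lemma sq_mul_integral_cos (u : ℝ) :
    u ^ 2 * ∫ s in Ioc (0 : ℝ) 1, (1 - s) * Real.cos (s * u) = 1 - Real.cos u := by
  rw [← intervalIntegral.integral_of_le zero_le_one, ← intervalIntegral.integral_const_mul]
  have hd : ∀ s ∈ Set.uIcc (0 : ℝ) 1, HasDerivAt
      (fun s => (1 - s) * (u * Real.sin (s * u)) - Real.cos (s * u))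
      (u ^ 2 * ((1 - s) * Real.cos (s * u))) s := by
    intro s _
    have h1 : HasDerivAt (fun s : ℝ => s * u) u s := by simpa using (hasDerivAt_id s).mul_const u
    have h2 := ((hasDerivAt_id s).const_sub 1).mul (h1.sin.const_mul u)
    have h3 := h2.sub h1.cos
    refine h3.congr_deriv ?_
    simp only [id]
    ring
  rw [intervalIntegral.integral_eq_sub_of_hasDerivAt hd]
  · simp
    ring
  · exact Continuous.intervalIntegrable (by fun_prop) _ _

/-- Near zero `1 - cos (y x) ≤ (y x)² / 2` and `α < 2` suffices; at infinity the bound `2` and `α >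
0` suffice. -/
lemma integrableOn_one_sub_cos {α : ℝ} (hα : α ∈ Ioo (0 : ℝ) 2) (x : ℝ) :
    IntegrableOn (fun y => (1 - Real.cos (y * x)) * y ^ (-1 - α)) (Ioc 0 1) ∧
    IntegrableOn (fun y => (1 - Real.cos (y * x)) * y ^ (-1 - α)) (Ioi 1) := by
  have hm : Measurable fun y : ℝ => (1 - Real.cos (y * x)) * y ^ (-1 - α) := by fun_prop
  constructor
  · have h1 : IntegrableOn (fun y : ℝ => x ^ 2 / 2 * y ^ (1 - α)) (Ioc 0 1) := by
      have := intervalIntegral.intervalIntegrable_rpow' (a := 0) (b := 1) (r := 1 - α)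
        (by linarith [hα.2])
      rw [intervalIntegrable_iff_integrableOn_Ioc_of_le zero_le_one] at this
      exact this.const_mul _
    refine h1.mono' hm.aestronglyMeasurable ?_
    refine (ae_restrict_iff' measurableSet_Ioc).2 (ae_of_all _ fun y hy => ?_)
    have h2 : 0 ≤ 1 - Real.cos (y * x) := by linarith [Real.cos_le_one (y * x)]
    have h3 := Real.one_sub_sq_div_two_le_cos (x := y * x)
    have h4 : 0 < y ^ (-1 - α) := Real.rpow_pos_of_pos hy.1 _
    rw [Real.norm_of_nonneg (by positivity)]
    have h5 : y ^ (1 - α) = y ^ (-1 - α) * y ^ 2 := by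
      rw [← Real.rpow_natCast, ← Real.rpow_add hy.1]; congr 1; push_cast; ring
    rw [h5]
    have h6 : 1 - Real.cos (y * x) ≤ x ^ 2 / 2 * y ^ 2 := by nlinarith
    nlinarith
  · have h1 : IntegrableOn (fun y : ℝ => 2 * y ^ (-1 - α)) (Ioi 1) :=
      (integrableOn_Ioi_rpow_of_lt (by linarith [hα.1]) one_pos).const_mul _
    refine h1.mono' hm.aestronglyMeasurable ?_
    refine (ae_restrict_iff' measurableSet_Ioi).2 (ae_of_all _ fun y hy => ?_)
    have hy0 : (0 : ℝ) < y := one_pos.trans hy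
    have h2 : 0 ≤ 1 - Real.cos (y * x) := by linarith [Real.cos_le_one (y * x)]
    have h3 := Real.neg_one_le_cos (y * x)
    have h4 : 0 < y ^ (-1 - α) := Real.rpow_pos_of_pos hy0 _
    rw [Real.norm_of_nonneg (by positivity)]
    nlinarith

/-- `|x|^α` as a superposition of the functions `1 - cos(y x)`. -/
lemma exists_abs_rpow_eq {α : ℝ} (hα : α ∈ Ioo (0 : ℝ) 2) : ∃ c : ℝ, 0 < c ∧ ∀ x : ℝ,
    |x| ^ α = c * (∫ y in Ioc (0 : ℝ) 1, (1 - Real.cos (y * x)) * y ^ (-1 - α)) +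
      c * ∫ y in Ioi (1 : ℝ), (1 - Real.cos (y * x)) * y ^ (-1 - α) := by
  set I : ℝ := ∫ y in Ioi (0 : ℝ), (1 - Real.cos y) * y ^ (-1 - α) with hI
  have hun : Ioc (0 : ℝ) 1 ∪ Ioi 1 = Ioi 0 := Ioc_union_Ioi_eq_Ioi zero_le_one
  have hint : ∀ x : ℝ, IntegrableOn (fun y => (1 - Real.cos (y * x)) * y ^ (-1 - α)) (Ioi 0) := by
    intro x
    rw [← hun]
    exact (integrableOn_one_sub_cos hα x).1.union (integrableOn_one_sub_cos hα x).2
  have hsplit : ∀ x : ℝ, ∫ y in Ioi (0 : ℝ), (1 - Real.cos (y * x)) * y ^ (-1 - α) =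
      (∫ y in Ioc (0 : ℝ) 1, (1 - Real.cos (y * x)) * y ^ (-1 - α)) +
      ∫ y in Ioi (1 : ℝ), (1 - Real.cos (y * x)) * y ^ (-1 - α) := by
    intro x
    rw [← hun]
    exact setIntegral_union (Ioc_disjoint_Ioi le_rfl) measurableSet_Ioi
      (integrableOn_one_sub_cos hα x).1 (integrableOn_one_sub_cos hα x).2
  have hIpos : 0 < I := by
    rw [hI, setIntegral_pos_iff_support_of_nonneg_ae]
    · refine lt_of_lt_of_le (b := volume (Ioo (0 : ℝ) 1)) (by simp) (measure_mono ?_)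
      intro y hy
      refine ⟨?_, hy.1⟩
      have h1 : Real.cos y < 1 := by
        have := Real.cos_lt_cos_of_nonneg_of_le_pi_div_two le_rfl
          (by linarith [hy.2, Real.pi_gt_three] : y ≤ Real.pi / 2) hy.1
        simpa using this
      exact mul_ne_zero (by linarith) (Real.rpow_pos_of_pos hy.1 _).ne'
    · refine (ae_restrict_iff' measurableSet_Ioi).2 (ae_of_all _ fun y hy => ?_)
      exact mul_nonneg (by linarith [Real.cos_le_one y]) (Real.rpow_pos_of_pos hy _).le
    · simpa using hint 1
  -- Substituting `y ↦ |x| y` shows that the integral over all jumps equals `I |x| ^ α`.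
  refine ⟨I⁻¹, inv_pos.2 hIpos, fun x => ?_⟩
  rw [← mul_add, ← hsplit, eq_inv_mul_iff_mul_eq₀ hIpos.ne']
  rcases eq_or_ne x 0 with rfl | hx
  · simp [Real.zero_rpow hα.1.ne']
  have hb : 0 < |x| := abs_pos.2 hx
  have h1 := integral_comp_mul_left_Ioi (fun y => (1 - Real.cos y) * y ^ (-1 - α)) 0 hb
  rw [mul_zero, ← hI, smul_eq_mul] at h1
  have h2 : ∫ y in Ioi (0 : ℝ), (1 - Real.cos (|x| * y)) * (|x| * y) ^ (-1 - α) =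
      |x| ^ (-1 - α) * ∫ y in Ioi (0 : ℝ), (1 - Real.cos (y * x)) * y ^ (-1 - α) := by
    rw [← integral_const_mul]
    refine setIntegral_congr_fun measurableSet_Ioi fun y hy => ?_
    rw [Real.mul_rpow hb.le (le_of_lt hy)]
    have : Real.cos (|x| * y) = Real.cos (y * x) := by
      rcases abs_choice x with h | h <;> rw [h]
      · rw [mul_comm]
      · rw [neg_mul, Real.cos_neg, mul_comm]
    rw [this]; ring
  rw [h2] at h1
  have h3 : |x| ^ (-1 - α) * |x| ^ (1 + α) = 1 := by
    rw [← Real.rpow_add hb]; simp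
  have h4 : |x| ^ (1 + α) = |x| * |x| ^ α := by rw [Real.rpow_add hb, Real.rpow_one]
  calc I * |x| ^ α = |x| ^ (1 + α) * (|x|⁻¹ * I) := by rw [h4]; field_simp
    _ = |x| ^ (1 + α) * (|x| ^ (-1 - α) * ∫ y in Ioi (0 : ℝ), (1 - Real.cos (y * x)) * y ^ (-1 - α)) := by
        rw [h1]
    _ = (|x| ^ (-1 - α) * |x| ^ (1 + α)) * ∫ y in Ioi (0 : ℝ), (1 - Real.cos (y * x)) * y ^ (-1 - α) := by
        ring
    _ = _ := by rw [h3, one_mul]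

variable (ν : Measure (Metric.sphere (0 : Rd d) 1)) [IsFiniteMeasure ν]

/-- By Taylor's formula the integrand becomes `⟨z, ξ⟩² cos (s y ⟨z, ξ⟩)` integrated against the
finite measure `y ^ (1 - α) (1 - s) dy ds ν(dξ)`, which is the setting of `hasTemperateGrowth_quad`.
-/
lemma hasTemperateGrowth_smallJumps {α : ℝ} (hα : α ∈ Ioo (0 : ℝ) 2) :
    (fun z : Rd d => ∫ ξ, (∫ y in Ioc (0 : ℝ) 1,
      (1 - Real.cos (y * inner ℝ z (ξ : Rd d))) * y ^ (-1 - α)) ∂ν).HasTemperateGrowth := by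
  set J : Measure ℝ := volume.restrict (Ioc (0 : ℝ) 1) with hJ
  set kk : ℝ × ℝ → ℝ := fun a => |a.1 ^ (1 - α)| * |1 - a.2| with hkk
  have hkki : Integrable kk (J.prod J) := by
    have h1 : Integrable (fun y : ℝ => y ^ (1 - α)) J := by
      have := intervalIntegral.intervalIntegrable_rpow' (a := 0) (b := 1) (r := 1 - α)
        (by linarith [hα.2])
      rwa [intervalIntegrable_iff_integrableOn_Ioc_of_le zero_le_one] at this
    have h2 : Integrable (fun s : ℝ => |1 - s|) J :=
      (Continuous.integrableOn_Ioc (by fun_prop))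
    exact h1.abs.mul_prod h2
  set μ₀ := ν.prod (J.prod J) with hμ₀
  set k : Metric.sphere (0 : Rd d) 1 × ℝ × ℝ → ℝ := fun a => kk a.2 with hk
  have hk0 : ∀ a, 0 ≤ k a := fun a => by positivity
  have hkm : Measurable k := by fun_prop
  have hki : Integrable k μ₀ := by
    have h3 := (integrable_const (1 : ℝ) (μ := ν)).mul_prod hkki
    simpa using h3
  set μ := μ₀.withDensity fun a => ENNReal.ofReal (k a) with hμ
  have hfin : IsFiniteMeasure μ := isFiniteMeasure_withDensity_ofReal hki.2
  -- Clipping makes `|rr| ≤ 1` hold everywhere; on the unit square, where the measure lives, `rr` is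
  -- the product `s y`.
  set rr : ℝ × ℝ → ℝ := fun a => max 0 (min (a.2 * a.1) 1) with hrr
  have hrrm : Measurable rr := by fun_prop
  have hrb : ∀ a, |rr a| ≤ 1 := fun a => by
    rw [abs_of_nonneg (le_max_left _ _)]
    exact max_le zero_le_one (min_le_right _ _)
  have hq := hasTemperateGrowth_quad μ (ξ := fun a => (a.1 : Rd d)) (by fun_prop)
    (fun a => by simp) (r := fun a => rr a.2) (by fun_prop) (fun a => hrb a.2)
  convert hq using 2 with z
  have hb : ∀ (u : ℝ) (a : ℝ × ℝ), ‖kk a * (u ^ 2 * Real.cos (rr a * u))‖ ≤ kk a * u ^ 2 := by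
    intro u a
    have h1 := Real.abs_cos_le_one (rr a * u)
    have h2 : 0 ≤ kk a := by positivity
    rw [norm_mul (kk a), norm_mul (u ^ 2), Real.norm_of_nonneg h2,
      Real.norm_of_nonneg (sq_nonneg u), Real.norm_eq_abs]
    have : u ^ 2 * |Real.cos (rr a * u)| ≤ u ^ 2 := by nlinarith [sq_nonneg u]
    gcongr
  have hH : Integrable (fun a : Metric.sphere (0 : Rd d) 1 × ℝ × ℝ =>
      k a * (inner ℝ z (a.1 : Rd d) ^ 2 * Real.cos (rr a.2 * inner ℝ z (a.1 : Rd d)))) μ₀ := by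
    refine (hki.mul_const (‖z‖ ^ 2)).mono' (Measurable.aestronglyMeasurable (by fun_prop))
      (ae_of_all _ fun a => ?_)
    refine (hb _ a.2).trans ?_
    have h1 : |inner ℝ z (a.1 : Rd d)| ≤ ‖z‖ := by
      simpa using abs_real_inner_le_norm z (a.1 : Rd d)
    refine mul_le_mul_of_nonneg_left ?_ (hk0 a)
    exact sq_le_sq' (by linarith [neg_abs_le (inner ℝ z (a.1 : Rd d))])
      ((le_abs_self _).trans h1)
  have hconv : ∫ a, inner ℝ z (a.1 : Rd d) ^ 2 * Real.cos (rr a.2 * inner ℝ z (a.1 : Rd d)) ∂μ =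
      ∫ a, k a * (inner ℝ z (a.1 : Rd d) ^ 2 * Real.cos (rr a.2 * inner ℝ z (a.1 : Rd d))) ∂μ₀ := by
    rw [hμ, integral_withDensity_eq_integral_toReal_smul (by fun_prop)
      (ae_of_all _ fun _ => ENNReal.ofReal_lt_top)]
    refine integral_congr_ae (ae_of_all _ fun a => ?_)
    simp only [ENNReal.toReal_ofReal (hk0 a), smul_eq_mul]
  rw [hconv, hμ₀, integral_prod _ hH]
  refine integral_congr_ae (ae_of_all _ fun ξ => ?_)
  simp only []
  set u : ℝ := inner ℝ z (ξ : Rd d)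
  have hG : Integrable (fun a : ℝ × ℝ => kk a * (u ^ 2 * Real.cos (rr a * u))) (J.prod J) :=
    (hkki.mul_const (u ^ 2)).mono' (Measurable.aestronglyMeasurable (by fun_prop))
      (ae_of_all _ fun a => hb u a)
  rw [integral_prod _ hG]
  refine setIntegral_congr_fun measurableSet_Ioc fun y hy => ?_
  have hin : ∫ s in Ioc (0 : ℝ) 1, kk (y, s) * (u ^ 2 * Real.cos (rr (y, s) * u)) =
      ∫ s in Ioc (0 : ℝ) 1, (y ^ (1 - α) * u ^ 2) * ((1 - s) * Real.cos (s * (y * u))) := by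
    refine setIntegral_congr_fun measurableSet_Ioc fun s hs => ?_
    have h1 : rr (y, s) = s * y := by
      have : s * y ≤ 1 := mul_le_one₀ hs.2 hy.1.le hy.2
      simp only [hrr]
      rw [min_eq_left this, max_eq_right (mul_nonneg hs.1.le hy.1.le)]
    have h2 : kk (y, s) = y ^ (1 - α) * (1 - s) := by
      simp only [hkk]
      rw [abs_of_nonneg (Real.rpow_nonneg hy.1.le _), abs_of_nonneg (by linarith [hs.2])]
    simp only [h1, h2]
    rw [mul_assoc s y u]
    ring
  refine Eq.trans ?_ hin.symm
  rw [integral_const_mul]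
  have h5 := sq_mul_integral_cos (y * u)
  rw [← h5]
  have h6 : y ^ (1 - α) = y ^ 2 * y ^ (-1 - α) := by
    rw [← Real.rpow_natCast, ← Real.rpow_add hy.1]; congr 1; push_cast; ring
  rw [h6]
  ring

lemma integrable_abs_inner_rpow {α : ℝ} (hα : 0 ≤ α) (z : Rd d) :
    Integrable (fun ξ : Metric.sphere (0 : Rd d) 1 => |inner ℝ z (ξ : Rd d)| ^ α) ν := by
  refine (integrable_const (‖z‖ ^ α)).mono' ?_ (ae_of_all _ fun ξ => ?_)
  · exact Measurable.aestronglyMeasurable (by fun_prop)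
  · rw [Real.norm_of_nonneg (by positivity)]
    have h1 : |inner ℝ z (ξ : Rd d)| ≤ ‖z‖ := by
      simpa using abs_real_inner_le_norm z (ξ : Rd d)
    gcongr

/-- Large jumps have finite total mass, as in a compound Poisson process: the symbol is that mass
minus a symmetrized average of characters, so the operator is a scalar minus an average of
translations. -/
lemma isMul_largeJumps {α : ℝ} (hα : α ∈ Ioo (0 : ℝ) 2) : ∃ C, IsMul (fun z : Rd d =>
      ((∫ ξ, (∫ y in Ioi (1 : ℝ), (1 - Real.cos (y * inner ℝ z (ξ : Rd d))) * y ^ (-1 - α)) ∂ν : ℝ) : ℂ))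
      C ∧ ∀ z : Rd d, Integrable (fun ξ : Metric.sphere (0 : Rd d) 1 => ∫ y in Ioi (1 : ℝ),
        (1 - Real.cos (y * inner ℝ z (ξ : Rd d))) * y ^ (-1 - α)) ν ∧
      ∫ ξ, (∫ y in Ioi (1 : ℝ), (1 - Real.cos (y * inner ℝ z (ξ : Rd d))) * y ^ (-1 - α)) ∂ν ≤ C := by
  set J : Measure ℝ := volume.restrict (Ioi (1 : ℝ)) with hJ
  have hki : Integrable (fun y : ℝ => y ^ (-1 - α)) J :=
    integrableOn_Ioi_rpow_of_lt (by linarith [hα.1]) one_pos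
  set μ := ν.prod J with hμ
  set k : Metric.sphere (0 : Rd d) 1 × ℝ → ℂ := fun a => ((a.2 ^ (-1 - α) : ℝ) : ℂ) with hk
  have hkI : Integrable k μ := by
    have h3 := (integrable_const (1 : ℝ) (μ := ν)).mul_prod hki
    simp only [one_mul] at h3
    exact h3.ofReal
  set w : Metric.sphere (0 : Rd d) 1 × ℝ → Rd d := fun a => (a.2 / (2 * Real.pi)) • (a.1 : Rd d) with hw
  have hwm : Measurable w := by fun_prop
  have h3 := (integrable_const (1 : ℝ) (μ := ν)).mul_prod hki
  simp only [one_mul] at h3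
  have hbd : ∀ (z : Rd d) (a : Metric.sphere (0 : Rd d) 1 × ℝ),
      ‖(1 - Real.cos (a.2 * inner ℝ z (a.1 : Rd d))) * a.2 ^ (-1 - α)‖ ≤ 2 * ‖a.2 ^ (-1 - α)‖ := by
    intro z a
    rw [norm_mul]
    gcongr
    rw [Real.norm_eq_abs, abs_le]
    constructor <;> linarith [Real.cos_le_one (a.2 * inner ℝ z (a.1 : Rd d)),
      Real.neg_one_le_cos (a.2 * inner ℝ z (a.1 : Rd d))]
  have hG : ∀ z : Rd d, Integrable (fun a : Metric.sphere (0 : Rd d) 1 × ℝ =>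
      (1 - Real.cos (a.2 * inner ℝ z (a.1 : Rd d))) * a.2 ^ (-1 - α)) μ := fun z =>
    (h3.norm.const_mul 2).mono' (Measurable.aestronglyMeasurable (by fun_prop))
      (ae_of_all _ fun a => hbd z a)
  have hA := hasSymbol_avg μ hkI hwm
  have hB := hasSymbol_avg μ hkI hwm.neg
  have hS := ((HasSymbol.one (d := d)).smul (∫ a, k a ∂μ)).sub ((hA.add hB).smul (1 / 2))
  -- One constant has to bound both the operator norm and the values of the symbol.
  refine ⟨max _ (∫ a, 2 * ‖a.2 ^ (-1 - α)‖ ∂μ), ((IsMul.of_hasSymbol hS).mono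
    (le_max_left _ _)).congr fun z => ?_, fun z => ⟨(hG z).integral_prod_left, ?_⟩⟩
  rotate_left
  · rw [← integral_prod _ (hG z)]
    refine le_max_of_le_right (integral_mono (hG z) (h3.norm.const_mul 2) fun a => ?_)
    exact (le_abs_self _).trans (hbd z a)
  have hI : ∀ v : Metric.sphere (0 : Rd d) 1 × ℝ → Rd d, Measurable v →
      Integrable (fun a => k a * chrF (-z) (v a)) μ := fun v hv => by
    refine hkI.norm.mono' (hkI.1.mul ?_) (ae_of_all _ fun a => ?_)
    · exact ((chrF_continuous _).measurable.comp hv).aestronglyMeasurable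
    · rw [norm_mul, norm_chrF, mul_one]
  have hpt : ∀ a : Metric.sphere (0 : Rd d) 1 × ℝ,
      (((1 - Real.cos (a.2 * inner ℝ z (a.1 : Rd d))) * a.2 ^ (-1 - α) : ℝ) : ℂ) =
      k a - 1 / 2 * (k a * chrF (-z) (w a) + k a * chrF (-z) (-w a)) := by
    intro a
    have hc : (Real.cos (a.2 * inner ℝ z (a.1 : Rd d)) : ℂ) =
        1 / 2 * (chrF (-z) (w a) + chrF (-z) (-w a)) := by
      have hpi : (2 * Real.pi) ≠ 0 := by positivity
      have e1 : 2 * Real.pi * inner ℝ (w a) z = a.2 * inner ℝ z (a.1 : Rd d) := by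
        simp only [hw]
        rw [real_inner_smul_left, real_inner_comm]; field_simp
      rw [chrF_neg, neg_neg, ← chrF_neg z (w a), Complex.ofReal_cos, Complex.cos, chrF, chrF,
        Real.fourierChar_apply, Real.fourierChar_apply, inner_neg_left, mul_neg, e1]
      push_cast
      ring
    rw [Complex.ofReal_mul, Complex.ofReal_sub, hc]
    simp only [hk]
    push_cast
    ring
  have e2 := integral_prod _ (hG z)
  rw [← e2, ← integral_complex_ofReal]
  simp only [hpt]
  have hI1 := hI w hwm
  have hI2 : Integrable (fun a => k a * chrF (-z) (-w a)) μ := hI _ hwm.neg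
  have hI3 : Integrable (fun a => 1 / 2 * (k a * chrF (-z) (w a) + k a * chrF (-z) (-w a))) μ :=
    (hI1.add hI2).const_mul _
  rw [integral_sub hkI hI3, integral_const_mul, integral_add hI1 hI2, mul_one]
  rfl

/-- The symbol is the sum of a smooth function and a multiplier. -/
lemma symb_decomposition {α : ℝ} (hα : α ∈ Ioc (1 : ℝ) 2) : ∃ (q b : Rd d → ℝ) (C : ℝ),
    (∀ z, symb α ν z = q z + b z) ∧ q.HasTemperateGrowth ∧ (∀ z, 0 ≤ b z ∧ b z ≤ C) ∧
    IsMul (fun z => (b z : ℂ)) C := by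
  -- For `α = 2` the jump integral diverges at zero, but the symbol is already a quadratic form, so
  -- `q = ψ` and `b = 0`.
  rcases eq_or_lt_of_le hα.2 with h2 | h2
  · refine ⟨symb α ν, fun _ => 0, 0, fun z => by simp, ?_, fun z => ⟨le_rfl, le_rfl⟩, ?_⟩
    · have := hasTemperateGrowth_quad ν (ξ := fun a => (a : Rd d)) (by fun_prop)
        (fun a => by simp) (r := fun _ => 0) (by fun_prop) (by simp)
      convert this using 2 with z
      rw [symb, h2]
      refine integral_congr_ae (ae_of_all _ fun ξ => ?_)
      simp
    · exact ⟨0, fun f z => by simp, by simp⟩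
  · have hα' : α ∈ Ioo (0 : ℝ) 2 := ⟨by linarith [hα.1], h2⟩
    obtain ⟨c, hc, hcx⟩ := exists_abs_rpow_eq hα'
    obtain ⟨C, hC, hb⟩ := isMul_largeJumps ν hα'
    set S : Rd d → Metric.sphere (0 : Rd d) 1 → ℝ := fun z ξ =>
      ∫ y in Ioc (0 : ℝ) 1, (1 - Real.cos (y * inner ℝ z (ξ : Rd d))) * y ^ (-1 - α) with hS
    set B : Rd d → Metric.sphere (0 : Rd d) 1 → ℝ := fun z ξ =>
      ∫ y in Ioi (1 : ℝ), (1 - Real.cos (y * inner ℝ z (ξ : Rd d))) * y ^ (-1 - α) with hB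
    have hsum : ∀ z (ξ : Metric.sphere (0 : Rd d) 1),
        |inner ℝ z (ξ : Rd d)| ^ α = c * S z ξ + c * B z ξ := fun z ξ => hcx _
    have hSI : ∀ z, Integrable (fun ξ => c * S z ξ) ν := by
      intro z
      have h1 := (integrable_abs_inner_rpow ν hα'.1.le z).sub ((hb z).1.const_mul c)
      refine h1.congr (ae_of_all _ fun ξ => ?_)
      have := hsum z ξ
      simp only [Pi.sub_apply]
      linarith
    refine ⟨fun z => c * ∫ ξ, S z ξ ∂ν, fun z => c * ∫ ξ, B z ξ ∂ν, c * C, fun z => ?_, ?_,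
      fun z => ⟨mul_nonneg hc.le (integral_nonneg fun ξ => setIntegral_nonneg measurableSet_Ioi
        fun y hy => mul_nonneg (by linarith [Real.cos_le_one (y * inner ℝ z (ξ : Rd d))])
          (Real.rpow_nonneg (zero_le_one.trans (le_of_lt hy)) _)),
        mul_le_mul_of_nonneg_left (hb z).2 hc.le⟩, ?_⟩
    · beta_reduce
      rw [symb, ← integral_const_mul, ← integral_const_mul,
        ← integral_add (hSI z) ((hb z).1.const_mul c)]
      exact integral_congr_ae (ae_of_all _ fun ξ => hsum z ξ)
    · exact (Function.HasTemperateGrowth.const c).mul (hasTemperateGrowth_smallJumps ν hα')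
    · refine ((hC.const_mul (c : ℂ)).congr fun z => by push_cast; rfl).mono ?_
      simp [abs_of_pos hc]

/-! ### Homogeneity and growth of the symbol -/

section Symbol

variable (ν : Measure (Metric.sphere (0 : Rd d) 1))

lemma symb_nonneg (α : ℝ) (z : Rd d) : 0 ≤ symb α ν z :=
  integral_nonneg fun _ => by positivity

lemma symb_smul (α : ℝ) {r : ℝ} (hr : 0 ≤ r) (z : Rd d) :
    symb α ν (r • z) = r ^ α * symb α ν z := by
  rw [symb, symb, ← integral_const_mul]
  refine integral_congr_ae (ae_of_all _ fun ξ => ?_)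
  simp only [real_inner_smul_left, abs_mul, abs_of_nonneg hr]
  rw [Real.mul_rpow hr (abs_nonneg _)]

lemma symb_neg (α : ℝ) (z : Rd d) : symb α ν (-z) = symb α ν z := by
  simp [symb]

lemma symb_continuous [IsFiniteMeasure ν] {α : ℝ} (hα : 0 ≤ α) :
    Continuous (symb α ν : Rd d → ℝ) := by
  have : Continuous (fun q : Rd d × Metric.sphere (0 : Rd d) 1 =>
      |inner ℝ q.1 (q.2 : Rd d)| ^ α) :=
    Continuous.rpow_const (by fun_prop) fun _ => Or.inr hα
  have h := continuous_parametric_integral_of_continuous (μ := ν) (s := univ)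
    (f := fun (z : Rd d) ξ => |inner ℝ z (ξ : Rd d)| ^ α) this isCompact_univ
  rw [Measure.restrict_univ] at h
  exact h

/-- If the integral vanished, the support of `ν` would lie in the hyperplane orthogonal to `z`,
which cannot span the space. -/
lemma symb_pos [IsFiniteMeasure ν] (hspan : Submodule.span ℝ
      ((fun ξ : Metric.sphere (0 : Rd d) 1 => (ξ : Rd d)) '' ν.support) = ⊤)
    {α : ℝ} (hα : 0 < α) {z : Rd d} (hz : z ≠ 0) : 0 < symb α ν z := by
  refine lt_of_le_of_ne (symb_nonneg ν α z) fun h0 => hz ?_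
  have h1 := (integral_eq_zero_iff_of_nonneg (fun _ => by positivity)
    (integrable_abs_inner_rpow ν hα.le z)).1 h0.symm
  set s : Set (Metric.sphere (0 : Rd d) 1) := {ξ | inner ℝ z (ξ : Rd d) = 0} with hs
  have hsc : IsClosed s := isClosed_eq (by fun_prop) continuous_const
  have hae : s ∈ ae ν := by
    filter_upwards [h1] with ξ hξ
    have := (Real.rpow_eq_zero (abs_nonneg _) hα.ne').1 hξ
    simpa [hs] using this
  have hsub : ν.support ⊆ s := Measure.support_subset_of_isClosed hsc hae
  have htop : (⊤ : Submodule ℝ (Rd d)) ≤ LinearMap.ker (innerₗ (Rd d) z) := by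
    rw [← hspan, Submodule.span_le]
    rintro _ ⟨ξ, hξ, rfl⟩
    exact hsub hξ
  have : inner ℝ z z = 0 := htop (Submodule.mem_top (x := z))
  exact inner_self_eq_zero.1 this

/-- The symbol has a positive minimum on the compact sphere; homogeneity and `‖z‖ ≤ ‖z‖ ^ α` outside
the unit ball do the rest. Linear growth is enough for `exp (-ψ)` to decay faster than any power. -/
lemma symb_lower [IsFiniteMeasure ν] (hspan : Submodule.span ℝ
      ((fun ξ : Metric.sphere (0 : Rd d) 1 => (ξ : Rd d)) '' ν.support) = ⊤)
    {α : ℝ} (hα : 1 ≤ α) : ∃ c : ℝ, 0 < c ∧ ∀ z, c * ‖z‖ - c ≤ symb α ν z := by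
  have hα0 : 0 < α := by linarith
  obtain ⟨c, hc, hcs⟩ : ∃ c : ℝ, 0 < c ∧ ∀ z ∈ Metric.sphere (0 : Rd d) 1, c ≤ symb α ν z := by
    -- The sphere is empty when `d = 0`.
    rcases (Metric.sphere (0 : Rd d) 1).eq_empty_or_nonempty with h | h
    · exact ⟨1, one_pos, by simp [h]⟩
    · obtain ⟨w, hw, hmin⟩ := (isCompact_sphere (0 : Rd d) 1).exists_isMinOn h
        (symb_continuous ν hα0.le).continuousOn
      refine ⟨symb α ν w, symb_pos ν hspan hα0 ?_, fun z hz => hmin hz⟩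
      rintro rfl
      simp at hw
  refine ⟨c, hc, fun z => ?_⟩
  rcases le_or_gt ‖z‖ 1 with h | h
  · exact le_trans (by nlinarith) (symb_nonneg ν α z)
  · have hz : 0 < ‖z‖ := by linarith
    have h1 : z = ‖z‖ • (‖z‖⁻¹ • z) := by rw [smul_smul, mul_inv_cancel₀ hz.ne', one_smul]
    have h2 := hcs (‖z‖⁻¹ • z) (by simp [norm_smul, hz.ne'])
    rw [h1, symb_smul ν α hz.le, ← h1]
    have h3 : ‖z‖ ≤ ‖z‖ ^ α := by
      simpa using Real.rpow_le_rpow_of_exponent_le h.le hα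
    nlinarith

end Symbol

/-! ### Integrability of the semigroup kernel -/

/-- `m` is the inverse Fourier transform of an integrable function. -/
def IsFI (m : Rd d → ℂ) : Prop := ∃ k : L1 d, ∀ z, fi z k = m z

namespace IsFI

variable {m m' : Rd d → ℂ}

lemma schwartz (φ : 𝓢(Rd d, ℂ)) : IsFI φ :=
  ⟨toL1 (𝓕 φ), fun z => by rw [fi_toL1, FourierTransform.fourierInv_fourier_eq]⟩

lemma congr (h : IsFI m) (e : ∀ z, m z = m' z) : IsFI m' := by
  obtain ⟨k, hk⟩ := h
  exact ⟨k, fun z => by rw [hk, e]⟩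

lemma add (h : IsFI m) (h' : IsFI m') : IsFI fun z => m z + m' z := by
  obtain ⟨k, hk⟩ := h
  obtain ⟨k', hk'⟩ := h'
  exact ⟨k + k', fun z => by rw [map_add, hk, hk']⟩

lemma mul_isMul {C : ℝ} (h : IsMul m C) (h' : IsFI m') : IsFI fun z => m z * m' z := by
  obtain ⟨k, hk⟩ := h'
  exact ⟨op m k, fun z => by rw [h.hasSymbol, hk]⟩

lemma exists_fourier (h : IsFI m) : ∃ K : Rd d → ℂ, Integrable K ∧ ∀ z, 𝓕 K z = m z := by
  obtain ⟨k, hk⟩ := h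
  refine ⟨fun x => k (-x), (L1.integrable_coeFn k).comp_neg, fun z => ?_⟩
  rw [← hk, fi_apply, Real.fourier_eq, ← integral_neg_eq_self]
  refine integral_congr_ae (ae_of_all _ fun x => ?_)
  simp [chrF, Circle.smul_def]

lemma isMul (h : IsFI m) : ∃ C, ∀ r : ℝ, IsMul (fun z => m (r • z)) C := by
  obtain ⟨K, hK, hm⟩ := h.exists_fourier
  exact ⟨_, fun r => (isMul_fourier hK r).congr fun z => hm _⟩

end IsFI

section Kernels

variable (ν : Measure (Metric.sphere (0 : Rd d) 1)) [IsFiniteMeasure ν]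
  (hspan : Submodule.span ℝ
      ((fun ξ : Metric.sphere (0 : Rd d) 1 => (ξ : Rd d)) '' ν.support) = ⊤)
  {α : ℝ} (hα : α ∈ Ioc (1 : ℝ) 2)

-- The factor `b` here is the exponential of the large-jump multiplier, and `φ` is the exponential
-- of the smooth part, which still grows at least linearly because the large-jump part is bounded.
include hspan hα in
lemma exp_symb_factor {t : ℝ} (ht : 0 < t) : ∃ (φ : 𝓢(Rd d, ℂ)) (b : Rd d → ℂ) (C : ℝ),
    IsMul b C ∧ (∀ z, ‖b z‖ ≤ 1) ∧ Continuous b ∧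
      ∀ z, ((Real.exp (-t * symb α ν z) : ℝ) : ℂ) = b z * φ z := by
  obtain ⟨q, b, C, hsum, hq, hb, hbm⟩ := symb_decomposition ν hα
  obtain ⟨c, hc, hlow⟩ := symb_lower ν hspan hα.1.le
  obtain ⟨φ, hφ⟩ := exp_neg_isSchwartz (q := fun z => t * q z) (c := t * c) (C := t * (c + C))
    ((Function.HasTemperateGrowth.const t).mul hq) (by positivity) fun z => by
      have h1 := hlow z
      have h2 := hsum z
      have h3 := (hb z).2
      have : c * ‖z‖ - (c + C) ≤ q z := by linarith
      nlinarith
  refine ⟨φ, fun z => Complex.exp ((-t : ℂ) * b z), _, (hbm.const_mul (-t : ℂ)).exp,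
    fun z => ?_, ?_, fun z => ?_⟩
  · rw [Complex.norm_exp, Real.exp_le_one_iff]
    have : ((-t : ℂ) * b z).re = -(t * b z) := by simp
    rw [this]
    have := (hb z).1
    nlinarith [mul_nonneg ht.le this]
  · have hbc : Continuous b := by
      have : b = fun z => symb α ν z - q z := by
        funext z
        rw [hsum z]
        ring
      rw [this]
      exact (symb_continuous ν (by linarith [hα.1])).sub hq.1.continuous
    exact Complex.continuous_exp.comp (continuous_const.mul (Complex.continuous_ofReal.comp hbc))
  · rw [hφ, hsum, Complex.ofReal_exp, Complex.ofReal_exp, ← Complex.exp_add]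
    congr 1
    push_cast
    ring

include hspan hα in
lemma isFI_mul_exp {m : Rd d → ℂ} (hm : m.HasTemperateGrowth) {t : ℝ} (ht : 0 < t) :
    IsFI fun z => m z * ((Real.exp (-t * symb α ν z) : ℝ) : ℂ) := by
  obtain ⟨φ, b, C, hb, -, -, he⟩ := exp_symb_factor ν hspan hα ht
  refine (IsFI.mul_isMul hb (IsFI.schwartz (SchwartzMap.smulLeftCLM ℂ m φ))).congr fun z => ?_
  rw [SchwartzMap.smulLeftCLM_apply_apply hm, he, smul_eq_mul]
  ring

include hspan hα in
lemma integrable_exp_symb {t : ℝ} (ht : 0 < t) :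
    Integrable fun z : Rd d => ((Real.exp (-t * symb α ν z) : ℝ) : ℂ) := by
  obtain ⟨φ, b, C, hb, hb1, hbc, he⟩ := exp_symb_factor ν hspan hα ht
  simp only [he]
  exact φ.integrable.bdd_mul (c := 1) hbc.aestronglyMeasurable (ae_of_all _ hb1)

-- Although the symbol is not smooth, its product with a cutoff is a Schwartz function (from the
-- smooth part) plus a multiplier times a Schwartz function.
include hα in
lemma isFI_symb_mul {m : Rd d → ℂ} (h1 : HasCompactSupport m) (h2 : ContDiff ℝ ∞ m) :
    IsFI fun z => (symb α ν z : ℂ) * m z := by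
  obtain ⟨q, b, C, hsum, hq, -, hbm⟩ := symb_decomposition ν hα
  set φ := h1.toSchwartzMap h2 with hφ
  have hq' : (fun z => (q z : ℂ)).HasTemperateGrowth := by
    fun_prop
  refine ((IsFI.schwartz (SchwartzMap.smulLeftCLM ℂ (fun z => (q z : ℂ)) φ)).add
    (IsFI.mul_isMul hbm (IsFI.schwartz φ))).congr fun z => ?_
  rw [SchwartzMap.smulLeftCLM_apply_apply hq', hsum, smul_eq_mul]
  push_cast
  have : φ z = m z := rfl
  rw [this]
  ring

-- `density` is a pointwise inverse Fourier integral, whose integrability in space is not visible.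
-- It is identified with an integrable kernel having the same transform by testing against smooth
-- compactly supported functions and moving the Fourier transform onto them.
include hspan hα in
lemma density_ae_eq {t : ℝ} (ht : 0 < t) : ∃ K : Rd d → ℂ, Integrable K ∧
    (∀ z, 𝓕 K z = ((Real.exp (-t * symb α ν z) : ℝ) : ℂ)) ∧ density α ν t =ᵐ[volume] K := by
  obtain ⟨K, hK, hKF⟩ := (isFI_mul_exp ν hspan hα (Function.HasTemperateGrowth.const (1 : ℂ))
    ht).exists_fourier
  simp only [one_mul] at hKF
  refine ⟨K, hK, hKF, ?_⟩
  have hI := integrable_exp_symb ν hspan hα ht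
  set E : Rd d → ℂ := fun z => ((Real.exp (-t * symb α ν z) : ℝ) : ℂ) with hE
  have hEn : ∀ z, E (-z) = E z := fun z => by simp [hE, symb_neg]
  have hdens : density α ν t = 𝓕 E := by
    funext x
    rw [density, Real.fourierInv_eq_fourier_comp_neg]
    simp only [symb_neg]
    rfl
  have hcont : Continuous (𝓕 E) :=
    VectorFourier.fourierIntegral_continuous Real.continuous_fourierChar
      (by exact (innerSL ℝ).continuous₂) hI
  have hFK : 𝓕 K = E := funext hKF
  rw [hdens]
  refine ae_eq_of_integral_contDiff_smul_eq hcont.locallyIntegrable hK.locallyIntegrable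
    fun g hg hgc => ?_
  set φ : 𝓢(Rd d, ℂ) := (hgc.comp_left (g := Complex.ofReal) (by simp)).toSchwartzMap
    (Complex.ofRealCLM.contDiff.comp hg) with hφ
  have hφg : ∀ x, φ x = (g x : ℂ) := fun x => rfl
  have flip : ∀ {f h : Rd d → ℂ}, Integrable f → Integrable h →
      ∫ x, 𝓕 f x • h x = ∫ x, f x • 𝓕 h x := by
    intro f h hf hh
    have h1 := VectorFourier.integral_fourierIntegral_smul_eq_flip (μ := volume) (ν := volume)
      (L := innerₗ (Rd d)) (f := f) (g := h) Real.continuous_fourierChar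
      (innerSL ℝ).continuous₂ hf hh
    rw [flip_innerₗ] at h1
    exact h1
  have e1 : ∫ x, g x • 𝓕 E x = ∫ x, 𝓕 E x • φ x := by
    refine integral_congr_ae (ae_of_all _ fun x => ?_)
    simp [hφg, mul_comm]
  have e2 : ∫ x, g x • K x = ∫ x, K x • 𝓕 (𝓕⁻ φ : 𝓢(Rd d, ℂ)) x := by
    refine integral_congr_ae (ae_of_all _ fun x => ?_)
    simp [hφg, mul_comm]
  rw [e1, e2, flip hI φ.integrable, ← SchwartzMap.fourier_coe]
  rw [SchwartzMap.fourier_coe, SchwartzMap.fourier_coe,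
    ← flip hK (𝓕⁻ φ : 𝓢(Rd d, ℂ)).integrable, hFK, ← integral_neg_eq_self]
  refine integral_congr_ae (ae_of_all _ fun x => ?_)
  simp only [hEn, SchwartzMap.fourierInv_coe, Real.fourierInv_eq_fourier_neg]

end Kernels

lemma ae_norm_fn_le (x : XD d) : ∀ᵐ y, ‖(fn x : Rd d → ℂ) y‖ ≤ ‖x‖ := by
  have h := ae_le_eLpNormEssSup (f := (fn x : Rd d → ℂ)) (μ := volume)
  filter_upwards [h] with y hy
  rw [← norm_fn, Lp.norm_def, eLpNorm_exponent_top]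
  have hfin : eLpNormEssSup (fn x : Rd d → ℂ) volume ≠ ⊤ := by
    rw [← eLpNorm_exponent_top]
    exact Lp.eLpNorm_ne_top _
  rw [← toReal_enorm]
  exact ENNReal.toReal_mono hfin hy

/-- Convolution with an integrable function as the adjoint of an average of translations. -/
lemma ofBounded_convolution {K : Rd d → ℂ} (hK : Integrable K) (x : XD d) :
    ofBounded (fun a => ∫ y, K y * (fn x : Rd d → ℂ) (a - y)) =
      emb (x ∘L avg volume hK measurable_id) := by
  set g : Rd d → ℂ := (fn x : Rd d → ℂ) with hg
  have hgm : StronglyMeasurable g := Lp.stronglyMeasurable _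
  have hgb : ∀ᵐ y, ‖g y‖ ≤ ‖x‖ := ae_norm_fn_le x
  have hm : AEStronglyMeasurable (fun q : Rd d × Rd d => K q.2 * g (q.1 - q.2))
      (volume.prod volume) :=
    (hK.1.comp_snd).mul (hgm.comp_measurable (by fun_prop)).aestronglyMeasurable
  have hb : ∀ a, ‖∫ y, K y * g (a - y)‖ ≤ (∫ y, ‖K y‖) * ‖x‖ := fun a => by
    rw [← integral_mul_const]
    refine norm_integral_le_of_norm_le (hK.norm.mul_const _) ?_
    have := (Measure.measurePreserving_sub_left (volume : Measure (Rd d)) a).quasiMeasurePreserving.ae hgb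
    filter_upwards [this] with y hy
    rw [norm_mul]
    gcongr
  have hL : MemLp (fun a => ∫ y, K y * g (a - y)) ∞ volume :=
    memLp_top_of_bound hm.integral_prod_right' _ (ae_of_all _ hb)
  rw [ofBounded_eq hL]
  congr 1
  ext f
  have hfI := L1.integrable_coeFn f
  rw [pairL_apply, ContinuousLinearMap.comp_apply, avg_apply,
    ← ContinuousLinearMap.integral_comp_comm _ (integrable_smul_tr volume hK measurable_id f)]
  have e1 : ∫ a, (hL.toLp _ : LI d) a * f a = ∫ a, ∫ y, K y * g (a - y) * f a := by
    refine integral_congr_ae ?_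
    filter_upwards [hL.coeFn_toLp] with a ha
    rw [ha, integral_mul_const]
  have hprod : Integrable (fun q : Rd d × Rd d => K q.2 * g (q.1 - q.2) * f q.1)
      (volume.prod volume) := by
    have h1 : Integrable (fun q : Rd d × Rd d => f q.1 * K q.2) (volume.prod volume) :=
      hfI.mul_prod hK
    refine (h1.norm.mul_const ‖x‖).mono' (hm.mul hfI.1.comp_fst) ?_
    have hq : Measure.QuasiMeasurePreserving (fun q : Rd d × Rd d => q.1 - q.2)
        (volume.prod volume) volume := quasiMeasurePreserving_sub volume volume
    filter_upwards [hq.ae hgb] with q hq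
    rw [norm_mul, norm_mul, norm_mul]
    nlinarith [mul_nonneg (norm_nonneg (f q.1)) (norm_nonneg (K q.2))]
  rw [e1, integral_integral_swap hprod]
  refine integral_congr_ae (ae_of_all _ fun y => ?_)
  simp only [map_smul, smul_eq_mul, id, mul_assoc]
  rw [integral_const_mul]
  congr 1
  conv_rhs => rw [← pairL_fn x, pairL_apply]
  rw [← integral_add_left_eq_self _ y]
  refine integral_congr_ae ?_
  filter_upwards [coeFn_tr y f] with a ha
  rw [ha]
  simp [hg]

/-! ### Dyadic frequencies and the partition of unity -/

/-- The dyadic frequency `2^{n-1}` of the block with (shifted) index `n`. -/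
def lam (n : ℕ) : ℝ := (2 : ℝ) ^ ((n : ℝ) - 1)

lemma lam_pos (n : ℕ) : 0 < lam n := Real.rpow_pos_of_pos two_pos _

lemma lam_succ_eq (n : ℕ) : lam (n + 1) = 2 ^ n := by
  rw [lam]; push_cast; rw [add_sub_cancel_right, Real.rpow_natCast]

lemma lam_eq (n : ℕ) : lam n = 2 ^ n / 2 := by
  rw [lam, Real.rpow_sub two_pos, Real.rpow_natCast, Real.rpow_one]

lemma lam_succ (n : ℕ) : lam (n + 1) = 2 * lam n := by
  rw [lam_eq, lam_eq, pow_succ]; ring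

lemma lam_mono : Monotone lam := monotone_nat_of_le_succ fun n => by
  rw [lam_succ]; linarith [lam_pos n]

lemma lam_rpow (n : ℕ) (γ : ℝ) : lam n ^ γ = (2 : ℝ) ^ (((n : ℝ) - 1) * γ) :=
  (Real.rpow_mul two_pos.le _ _).symm

lemma lam_rpow_geom (n : ℕ) (γ : ℝ) : lam n ^ γ = (2 : ℝ) ^ (-γ) * ((2 : ℝ) ^ γ) ^ n := by
  rw [lam_rpow, ← Real.rpow_natCast, ← Real.rpow_mul two_pos.le, ← Real.rpow_add two_pos]
  congr 1; ring

lemma one_le_lam_mul (n : ℕ) : 1 ≤ 2 * lam n := by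
  rw [lam_eq]
  have : (1 : ℝ) ≤ 2 ^ n := one_le_pow₀ (by norm_num)
  linarith

lemma summable_lam {γ : ℝ} (hγ : γ < 0) : Summable fun n => lam n ^ γ := by
  simp only [lam_rpow_geom]
  exact (summable_geometric_of_lt_one (by positivity)
    (Real.rpow_lt_one_of_one_lt_of_neg one_lt_two hγ)).mul_left _

lemma lam_rpow_tendsto {γ : ℝ} (hγ : γ < 0) : Tendsto (fun n => lam n ^ γ) atTop (𝓝 0) :=
  (summable_lam hγ).tendsto_atTop_zero

lemma sum_lam_le {γ : ℝ} (hγ : 0 < γ) : ∃ C, 0 ≤ C ∧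
    ∀ n, ∑ m ∈ Finset.range (n + 1), lam m ^ γ ≤ C * lam n ^ γ := by
  set q : ℝ := (2 : ℝ) ^ γ with hq
  have hq1 : 1 < q := Real.one_lt_rpow one_lt_two hγ
  refine ⟨q / (q - 1), div_nonneg (by linarith) (by linarith), fun n => ?_⟩
  simp only [lam_rpow_geom, ← hq]
  rw [← Finset.mul_sum, geom_sum_eq hq1.ne', mul_left_comm]
  have h0 : (0 : ℝ) < 2 ^ (-γ) := by positivity
  refine mul_le_mul_of_nonneg_left ?_ h0.le
  rw [pow_succ, div_mul_eq_mul_div]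
  have : 0 < q - 1 := by linarith
  gcongr
  linarith

namespace IsDyadicPartition

variable {p : ℕ → Rd d → ℝ} (hp : IsDyadicPartition p)
include hp

lemma neg (n : ℕ) (z : Rd d) : p n (-z) = p n z := by
  cases n with
  | zero => exact (hp.radial (-z) z (by simp)).1
  | succ n =>
    rw [hp.scaling n, hp.scaling n, smul_neg]
    exact (hp.radial _ _ (norm_neg _)).2

lemma nonneg' (n : ℕ) (z : Rd d) : 0 ≤ p n z := by
  cases n with
  | zero => exact (hp.nonneg z).1
  | succ n => rw [hp.scaling]; exact (hp.nonneg _).2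

/-- By scaling, both sides equal one minus the sum of the pieces of index at least two at `z`. -/
lemma half (z : Rd d) : p 0 ((2 : ℝ)⁻¹ • z) = p 0 z + p 1 z := by
  have h1 := (hasSum_nat_add_iff' 1).2 (hp.sum_eq_one ((2 : ℝ)⁻¹ • z))
  have h2 := (hasSum_nat_add_iff' 2).2 (hp.sum_eq_one z)
  have e : ∀ n, p (n + 1) ((2 : ℝ)⁻¹ • z) = p (n + 2) z := fun n => by
    rw [hp.scaling, hp.scaling (n + 1), smul_smul, pow_succ, mul_inv]
  simp only [e] at h1
  have := h1.unique h2
  simp only [Finset.sum_range_succ, Finset.sum_range_zero] at this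
  linarith

/-- Frequency truncations are thus dilations of the single cutoff `p 0`, hence multipliers with a
bound independent of `N`. -/
lemma sum_range (N : ℕ) (z : Rd d) :
    ∑ m ∈ Finset.range (N + 1), p m z = p 0 (((2 : ℝ) ^ N)⁻¹ • z) := by
  induction N with
  | zero => rw [Finset.sum_range_one, pow_zero, inv_one, one_smul]
  | succ N ih =>
    rw [Finset.sum_range_succ, ih, hp.scaling, ← hp.half, smul_smul, pow_succ, mul_inv, mul_comm]

lemma mul_eq_zero' {m n : ℕ} (h : m + 1 < n) (z : Rd d) : p m z * p n z = 0 := by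
  by_contra hne
  have h1 : p m z ≠ 0 := left_ne_zero_of_mul hne
  have h2 : p n z ≠ 0 := right_ne_zero_of_mul hne
  exact Set.disjoint_left.1 (hp.disjoint m n h) (subset_tsupport _ h1) (subset_tsupport _ h2)

/-- Only the pieces of index at most `n + 1` meet the support of `p n`, and the truncation contains
all of them. -/
lemma mul_cut {n N : ℕ} (h : n + 1 ≤ N) (z : Rd d) :
    p n z * p 0 (((2 : ℝ) ^ N)⁻¹ • z) = p n z := by
  have h1 := (hp.sum_eq_one z).mul_left (p n z)
  rw [← hp.sum_range, Finset.mul_sum]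
  have h2 : HasSum (fun m => p n z * p m z) (∑ m ∈ Finset.range (N + 1), p n z * p m z) := by
    refine hasSum_sum_of_ne_finset_zero fun m hm => ?_
    exact hp.mul_eq_zero' (by simp at hm; omega) z
  rw [h2.unique h1, mul_one]

lemma eq_one_near : ∃ a : ℝ, 0 < a ∧ ∀ z, ‖z‖ < a → p 0 z = 1 := by
  obtain ⟨a, b, ha, hs⟩ := hp.support_annulus
  refine ⟨a, ha, fun z hz => ?_⟩
  have h1 : ∀ n ≠ 0, p n z = 0 := by
    intro n hn
    obtain ⟨k, rfl⟩ := Nat.exists_eq_succ_of_ne_zero hn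
    rw [Nat.succ_eq_add_one, hp.scaling]
    by_contra hne
    have := (hs (subset_tsupport _ hne)).1
    rw [norm_smul, norm_inv, norm_pow, Real.norm_ofNat] at this
    have h2 : ((2 : ℝ) ^ k)⁻¹ ≤ 1 := inv_le_one_of_one_le₀ (one_le_pow₀ (by norm_num))
    nlinarith [norm_nonneg z]
  exact (hasSum_single 0 h1).unique (hp.sum_eq_one z)

lemma eq_zero_far : ∃ R : ℝ, 0 < R ∧ ∀ z, R ≤ ‖z‖ → p 0 z = 0 ∧ p 1 z = 0 := by
  obtain ⟨R, hR⟩ := hp.support_ball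
  obtain ⟨a, b, ha, hs⟩ := hp.support_annulus
  refine ⟨max (max R b + 1) 1, by positivity, fun z hz => ⟨?_, ?_⟩⟩
  · by_contra hne
    have := hR (subset_tsupport _ hne)
    rw [mem_closedBall_zero_iff] at this
    linarith [le_max_left R b, le_max_left (max R b + 1) 1]
  · by_contra hne
    have := (hs (subset_tsupport _ hne)).2
    linarith [le_max_right R b, le_max_left (max R b + 1) 1]

lemma succ_eq (n : ℕ) (z : Rd d) : p (n + 1) z = p 1 ((lam (n + 1))⁻¹ • z) := by
  rw [hp.scaling, lam_succ_eq]

lemma contDiff_ofReal (n : ℕ) : ContDiff ℝ ∞ fun z => (p n z : ℂ) :=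
  Complex.ofRealCLM.contDiff.comp (hp.smooth n)

lemma hasCompactSupport_ofReal (n : ℕ) : HasCompactSupport fun z => (p n z : ℂ) :=
  (hp.compact_support n).comp_left (g := Complex.ofReal) (by simp)

lemma hasTemperateGrowth (n : ℕ) : (fun z => (p n z : ℂ)).HasTemperateGrowth :=
  (hp.hasCompactSupport_ofReal n).hasTemperateGrowth (hp.contDiff_ofReal n)

lemma hasTemperateGrowth_cut (r : ℝ) : (fun z => (p 0 (r • z) : ℂ)).HasTemperateGrowth := by
  have h1 := hp.hasTemperateGrowth 0
  have h2 : (fun z : Rd d => r • z).HasTemperateGrowth := by fun_prop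
  exact h1.comp h2

lemma isMul_cut : ∃ C, ∀ r : ℝ, IsMul (fun z => (p 0 (r • z) : ℂ)) C :=
  isMul_of_contDiff (hp.hasCompactSupport_ofReal 0) (hp.contDiff_ofReal 0)

lemma isMul_block : ∃ C, ∀ n, IsMul (fun z => (p n z : ℂ)) C := by
  obtain ⟨C0, h0⟩ := hp.isMul_cut
  obtain ⟨C1, h1⟩ := isMul_of_contDiff (hp.hasCompactSupport_ofReal 1) (hp.contDiff_ofReal 1)
  refine ⟨max C0 C1, fun n => ?_⟩
  cases n with
  | zero => exact ((h0 1).congr fun z => by simp).mono (le_max_left _ _)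
  | succ n =>
    exact ((h1 (lam (n + 1))⁻¹).congr fun z => by rw [← hp.succ_eq]).mono (le_max_right _ _)

/-- Provides an annular cutoff that is one on the first annulus and vanishes near the origin, where
negative powers of `‖w‖` have to be avoided. -/
lemma one_mul_annulus (w : Rd d) :
    p 1 w * (p 0 ((4 : ℝ)⁻¹ • w) - p 0 ((2 : ℝ) • w)) = p 1 w := by
  have h1 := hp.mul_cut (n := 1) (N := 2) (by norm_num) w
  have h2 : p 1 w * p 0 ((2 : ℝ) • w) = 0 := by
    have := hp.mul_eq_zero' (m := 0) (n := 2) (by norm_num) ((2 : ℝ) • w)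
    rw [hp.scaling 1, smul_smul] at this
    norm_num at this
    rcases this with h | h <;> simp [h]
  rw [mul_sub, h2, sub_zero]
  convert h1 using 4
  norm_num

end IsDyadicPartition

/-- Multiplication by a cutoff at scale `2^N` converges to the identity on Schwartz functions. -/
lemma tendsto_cut_smul {χ : Rd d → ℂ} (h1 : HasCompactSupport χ) (h2 : ContDiff ℝ ∞ χ)
    {a : ℝ} (ha : 0 < a) (hχ : ∀ z, ‖z‖ < a → χ z = 1) (φ : 𝓢(Rd d, ℂ)) :
    Tendsto (fun N : ℕ => SchwartzMap.smulLeftCLM ℂ (fun z => χ (((2 : ℝ) ^ N)⁻¹ • z)) φ) atTop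
      (𝓝 φ) := by
  have hχt : χ.HasTemperateGrowth := h1.hasTemperateGrowth h2
  have hχN : ∀ N : ℕ, (fun z => χ (((2 : ℝ) ^ N)⁻¹ • z)).HasTemperateGrowth := fun N =>
    hχt.comp (by fun_prop)
  set g : Rd d → ℂ := fun z => χ z - 1 with hg
  have hgs : ContDiff ℝ ∞ g := h2.sub contDiff_const
  have hB : ∀ i : ℕ, ∃ B, 0 ≤ B ∧ ∀ z, ‖iteratedFDeriv ℝ i g z‖ ≤ B := by
    intro i
    set ψ := h1.toSchwartzMap h2
    refine ⟨SchwartzMap.seminorm ℝ 0 i ψ + 1, by positivity, fun z => ?_⟩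
    have h3 := ψ.norm_iteratedFDeriv_le_seminorm ℝ i z
    have h4 : iteratedFDeriv ℝ i g z = iteratedFDeriv ℝ i χ z - iteratedFDeriv ℝ i (fun _ => (1 : ℂ)) z := by
      have := iteratedFDeriv_sub_apply (𝕜 := ℝ) (i := i) (x := z) (f := χ) (g := fun _ => (1 : ℂ))
        ((h2.of_le (by exact_mod_cast le_top)).contDiffAt) contDiffAt_const
      exact this
    rw [h4]
    refine (norm_sub_le _ _).trans (add_le_add h3 ?_)
    rcases Nat.eq_zero_or_pos i with rfl | hi
    · simp
    · rw [iteratedFDeriv_const_of_ne hi.ne']; simp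
  choose B hB0 hB using hB
  rw [(schwartz_withSeminorms ℝ (Rd d) ℂ).tendsto_nhds _ _]
  rintro ⟨k, n⟩ ε hε
  set M : ℝ := ∑ i ∈ Finset.range (n + 1), (n.choose i : ℝ) * B i *
    SchwartzMap.seminorm ℝ (k + 1) (n - i) φ with hM
  have hM0 : 0 ≤ M := Finset.sum_nonneg fun i _ =>
    mul_nonneg (mul_nonneg (by positivity) (hB0 i)) (apply_nonneg _ _)
  have key : ∀ N : ℕ, SchwartzMap.seminorm ℝ k n
      (SchwartzMap.smulLeftCLM ℂ (fun z => χ (((2 : ℝ) ^ N)⁻¹ • z)) φ - φ) ≤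
        M * (a⁻¹ * (2⁻¹ : ℝ) ^ N) := by
    intro N
    set r : ℝ := ((2 : ℝ) ^ N)⁻¹ with hr
    have hr0 : 0 < r := by positivity
    have hr1 : r ≤ 1 := inv_le_one_of_one_le₀ (one_le_pow₀ (by norm_num))
    have hrr : (2⁻¹ : ℝ) ^ N = r := by rw [hr, inv_pow]
    rw [hrr]
    refine SchwartzMap.seminorm_le_bound ℝ k n _ (by positivity) fun z => ?_
    have hfun : (⇑(SchwartzMap.smulLeftCLM ℂ (fun z => χ (r • z)) φ - φ) : Rd d → ℂ) =
        fun z => g (r • z) • φ z := by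
      funext z
      rw [sub_apply, SchwartzMap.smulLeftCLM_apply_apply (hχN N)]
      simp only [hg, sub_smul, one_smul, hr]
    rw [hfun]
    -- Where `r ‖z‖ < a` the factor `g (r • z)` vanishes identically; elsewhere `1 ≤ ‖z‖ r / a`, so
    -- one extra power of `‖z‖` buys the small factor `r`.
    rcases lt_or_ge ‖z‖ (a / r) with hz | hz
    · have hloc : (fun z => g (r • z) • φ z) =ᶠ[𝓝 z] fun _ => 0 := by
        have : {y : Rd d | ‖y‖ < a / r} ∈ 𝓝 z :=
          (isOpen_lt continuous_norm continuous_const).mem_nhds hz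
        filter_upwards [this] with y hy
        have : ‖r • y‖ < a := by
          rw [norm_smul, Real.norm_of_nonneg hr0.le]
          have hy : ‖y‖ < a / r := hy
          rw [lt_div_iff₀ hr0] at hy
          linarith
        simp [hg, hχ _ this]
      rw [(hloc.iteratedFDeriv ℝ n).eq_of_nhds]
      have : iteratedFDeriv ℝ n (fun _ : Rd d => (0 : ℂ)) z = 0 := by
        have := iteratedFDeriv_fun_zero (𝕜 := ℝ) (E := Rd d) (F := ℂ) (n := n)
        rw [this]; rfl
      rw [this]
      simp only [norm_zero, mul_zero]
      positivity
    · have hk : ‖z‖ ^ k ≤ ‖z‖ ^ (k + 1) * (a⁻¹ * r) := by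
        have : 1 ≤ ‖z‖ * (a⁻¹ * r) := by
          rw [div_le_iff₀ hr0] at hz
          rw [mul_left_comm, ← div_eq_inv_mul, le_div_iff₀ ha]
          linarith
        rw [pow_succ, mul_assoc]
        exact le_mul_of_one_le_right (by positivity) this
      have hcs : ContDiff ℝ ∞ fun z => g (r • z) := hgs.comp (contDiff_const_smul r)
      have hle := norm_iteratedFDeriv_smul_le (𝕜 := ℝ) hcs (φ.smooth ⊤) z
        (n := n) (by exact_mod_cast le_top)
      calc ‖z‖ ^ k * ‖iteratedFDeriv ℝ n (fun z => g (r • z) • φ z) z‖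
          ≤ (‖z‖ ^ (k + 1) * (a⁻¹ * r)) * ∑ i ∈ Finset.range (n + 1), (n.choose i : ℝ) *
            ‖iteratedFDeriv ℝ i (fun z => g (r • z)) z‖ * ‖iteratedFDeriv ℝ (n - i) φ z‖ := by
            gcongr
        _ = (∑ i ∈ Finset.range (n + 1), (n.choose i : ℝ) *
            ‖iteratedFDeriv ℝ i (fun z => g (r • z)) z‖ *
              (‖z‖ ^ (k + 1) * ‖iteratedFDeriv ℝ (n - i) φ z‖)) * (a⁻¹ * r) := by
            rw [Finset.mul_sum, Finset.sum_mul]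
            exact Finset.sum_congr rfl fun i _ => by ring
        _ ≤ M * (a⁻¹ * r) := by
            refine mul_le_mul_of_nonneg_right (Finset.sum_le_sum fun i _ => ?_) (by positivity)
            have hi : ‖iteratedFDeriv ℝ i (fun z => g (r • z)) z‖ ≤ B i := by
              have := iteratedFDeriv_comp_const_smul (𝕜 := ℝ) (i := i) r
                (hgs.of_le (by exact_mod_cast le_top) : ContDiff ℝ i g)
              rw [this]
              rw [norm_smul, norm_pow, Real.norm_of_nonneg hr0.le]
              exact (mul_le_of_le_one_left (norm_nonneg _) (pow_le_one₀ hr0.le hr1)).trans (hB i _)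
            gcongr
            · exact mul_nonneg (by positivity) (hB0 i)
            · exact SchwartzMap.le_seminorm ℝ (k + 1) (n - i) φ z
  have hlim : Tendsto (fun N : ℕ => M * (a⁻¹ * (2⁻¹ : ℝ) ^ N)) atTop (𝓝 0) := by
    have := (tendsto_pow_atTop_nhds_zero_of_lt_one (r := (2⁻¹ : ℝ)) (by norm_num)
      (by norm_num)).const_mul a⁻¹ |>.const_mul M
    simpa using this
  filter_upwards [hlim.eventually (gt_mem_nhds hε)] with N hN
  exact (key N).trans_lt hN

/-! ### Littlewood-Paley blocks as functionals on `L^1` -/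

lemma block_eq (p : ℕ → Rd d → ℝ) (n : ℕ) (u : Distr d) :
    block p n u = TemperedDistribution.fourierMultiplierCLM ℂ (fun z => (p n z : ℂ)) u := rfl

lemma block_add (p : ℕ → Rd d → ℝ) (n : ℕ) (u v : Distr d) :
    block p n (u + v) = block p n u + block p n v := by
  rw [block_eq, map_add]; rfl

lemma block_sub (p : ℕ → Rd d → ℝ) (n : ℕ) (u v : Distr d) :
    block p n (u - v) = block p n u - block p n v := by
  rw [block_eq, map_sub]; rfl

/-- Fourier multipliers on bounded functions are adjoint to those on `L^1`. -/
lemma fourierMultiplier_emb {m : Rd d → ℂ} {C : ℝ} (h : IsMul m C) (hm : m.HasTemperateGrowth)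
    (x : XD d) : TemperedDistribution.fourierMultiplierCLM ℂ m (emb x) = emb (x ∘L op m) := by
  ext φ
  rw [TemperedDistribution.fourierMultiplierCLM_apply_apply, emb_apply, emb_apply,
    ContinuousLinearMap.comp_apply, op_toL1 h hm]

lemma block_emb {p : ℕ → Rd d → ℝ} (hp : IsDyadicPartition p) (n : ℕ) (x : XD d) :
    block p n (emb x) = emb (x ∘L op fun z => (p n z : ℂ)) := by
  obtain ⟨C, hC⟩ := hp.isMul_block
  rw [block_eq, fourierMultiplier_emb (hC n) (hp.hasTemperateGrowth n)]

/-- All Littlewood-Paley blocks are bounded functions. -/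
def HasBlocks (p : ℕ → Rd d → ℝ) (u : Distr d) : Prop := ∀ n, ∃ x : XD d, emb x = block p n u

/-- The Littlewood-Paley block as a functional on `L^1` (and `0` if it is not bounded). -/
def bl (p : ℕ → Rd d → ℝ) (n : ℕ) (u : Distr d) : XD d :=
  open Classical in
  if h : ∃ x : XD d, emb x = block p n u then h.choose else 0

section Blocks

variable {p : ℕ → Rd d → ℝ} {u v : Distr d}

lemma bl_eq {n : ℕ} {x : XD d} (h : emb x = block p n u) : bl p n u = x := by
  have h' : ∃ x : XD d, emb x = block p n u := ⟨x, h⟩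
  rw [bl, dif_pos h']
  exact emb_injective (h'.choose_spec.trans h.symm)

lemma HasBlocks.emb_bl (h : HasBlocks p u) (n : ℕ) : emb (bl p n u) = block p n u := by
  obtain ⟨x, hx⟩ := h n
  rw [bl_eq hx, hx]

lemma HasBlocks.sub (hu : HasBlocks p u) (hv : HasBlocks p v) : HasBlocks p (u - v) := fun n =>
  ⟨bl p n u - bl p n v, by rw [map_sub, hu.emb_bl, hv.emb_bl, block_sub]⟩

lemma HasBlocks.bl_sub (hu : HasBlocks p u) (hv : HasBlocks p v) (n : ℕ) :
    bl p n (u - v) = bl p n u - bl p n v :=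
  bl_eq (by rw [map_sub, hu.emb_bl, hv.emb_bl, block_sub])

variable (hp : IsDyadicPartition p)
include hp

lemma hasBlocks_emb (x : XD d) : HasBlocks p (emb x) := fun n => ⟨_, (block_emb hp n x).symm⟩

lemma bl_emb (n : ℕ) (x : XD d) : bl p n (emb x) = x ∘L op fun z => (p n z : ℂ) :=
  bl_eq (block_emb hp n x).symm

lemma emb_bl_comp_op {m : Rd d → ℂ} {C : ℝ} (h : IsMul m C) (hm : m.HasTemperateGrowth)
    (hu : HasBlocks p u) (n : ℕ) : emb (bl p n u ∘L op m) =
      TemperedDistribution.fourierMultiplierCLM ℂ (fun z => m z * (p n z : ℂ)) u := by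
  rw [← fourierMultiplier_emb h hm, hu.emb_bl, block_eq,
    TemperedDistribution.fourierMultiplierCLM_fourierMultiplierCLM_apply
      (hp.hasTemperateGrowth n) hm]
  congr 2
  funext z
  simp [mul_comm]

/-- Allows a cutoff equal to one on the support of `p n` to be inserted before any other multiplier,
so that only the behaviour of that multiplier near the block matters. -/
lemma bl_comp_op {m : Rd d → ℂ} {C : ℝ} (h : IsMul m C) (hm : m.HasTemperateGrowth)
    (hu : HasBlocks p u) (n : ℕ) (e : ∀ z, m z * (p n z : ℂ) = p n z) :
    bl p n u ∘L op m = bl p n u := by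
  refine emb_injective ?_
  rw [emb_bl_comp_op hp h hm hu, hu.emb_bl, block_eq]
  simp only [e]

lemma bl_comp_op_eq_zero {m : Rd d → ℂ} {C : ℝ} (h : IsMul m C) (hm : m.HasTemperateGrowth)
    (hu : HasBlocks p u) (n : ℕ) (e : ∀ z, m z * (p n z : ℂ) = 0) :
    bl p n u ∘L op m = 0 := by
  refine emb_injective ?_
  rw [emb_bl_comp_op hp h hm hu, map_zero]
  simp only [e]
  rw [TemperedDistribution.fourierMultiplierCLM_const]
  simp

lemma bl_comp_block_eq_zero (hu : HasBlocks p u) {m n : ℕ} (h : m + 1 < n ∨ n + 1 < m) :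
    (bl p n u ∘L op fun z => (p m z : ℂ)) = 0 := by
  obtain ⟨C, hC⟩ := hp.isMul_block
  refine bl_comp_op_eq_zero hp (hC m) (hp.hasTemperateGrowth m) hu n fun z => ?_
  rw [← Complex.ofReal_mul]
  rcases h with h | h
  · rw [hp.mul_eq_zero' h, Complex.ofReal_zero]
  · rw [mul_comm, hp.mul_eq_zero' h, Complex.ofReal_zero]

lemma bl_comp_block_comm (hu : HasBlocks p u) (m n : ℕ) :
    (bl p n u ∘L op fun z => (p m z : ℂ)) = bl p m u ∘L op fun z => (p n z : ℂ) := by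
  obtain ⟨C, hC⟩ := hp.isMul_block
  refine emb_injective ?_
  rw [emb_bl_comp_op hp (hC m) (hp.hasTemperateGrowth m) hu,
    emb_bl_comp_op hp (hC n) (hp.hasTemperateGrowth n) hu]
  simp only [mul_comm]

/-- The partial sums of the Littlewood-Paley decomposition converge. -/
lemma hasSum_block (u : Distr d) (φ : 𝓢(Rd d, ℂ)) :
    Tendsto (fun N => ∑ n ∈ Finset.range (N + 1), block p n u φ) atTop (𝓝 (u φ)) := by
  obtain ⟨a, ha, h1⟩ := hp.eq_one_near
  have key := tendsto_cut_smul (hp.hasCompactSupport_ofReal 0) (hp.contDiff_ofReal 0) ha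
    (fun z hz => by rw [h1 z hz, Complex.ofReal_one]) (𝓕⁻ φ)
  have h2 : Continuous fun ψ : 𝓢(Rd d, ℂ) => u (𝓕 ψ) :=
    u.continuous.comp (FourierTransform.continuous_fourier)
  have h3 := (h2.tendsto _).comp key
  rw [FourierTransform.fourier_fourierInv_eq] at h3
  refine h3.congr fun N => ?_
  have hs : (fun z => ((p 0 (((2 : ℝ) ^ N)⁻¹ • z) : ℝ) : ℂ)) =
      fun z => ∑ n ∈ Finset.range (N + 1), (p n z : ℂ) := by
    funext z
    rw [← hp.sum_range]
    push_cast
    rfl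
  simp only [Function.comp_apply]
  rw [hs, SchwartzMap.smulLeftCLM_sum fun i _ => hp.hasTemperateGrowth i]
  rw [sum_apply, ← FourierTransform.fourierCLM_apply (R := ℂ), map_sum, map_sum]
  rfl

/-- Absolutely convergent Littlewood-Paley series. -/
lemma emb_tsum_bl (hu : HasBlocks p u) (hs : Summable fun n => bl p n u) :
    emb (∑' n, bl p n u) = u := by
  ext φ
  have h1 := hs.hasSum.mapL (ContinuousLinearMap.apply ℂ ℂ (toL1 φ))
  have h2 := (h1.tendsto_sum_nat).comp (tendsto_add_atTop_nat 1)
  refine tendsto_nhds_unique h2 ?_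
  refine (hasSum_block hp u φ).congr fun N => ?_
  refine Finset.sum_congr rfl fun n _ => ?_
  rw [← hu.emb_bl]
  rfl

end Blocks

lemma linftyNorm_add_le (u v : Distr d) : linftyNorm (u + v) ≤ linftyNorm u + linftyNorm v := by
  rcases eq_or_ne (linftyNorm u) ⊤ with hu | hu
  · simp [hu]
  rcases eq_or_ne (linftyNorm v) ⊤ with hv | hv
  · simp [hv]
  obtain ⟨x, rfl⟩ := exists_emb_of_linftyNorm_lt hu.lt_top
  obtain ⟨y, rfl⟩ := exists_emb_of_linftyNorm_lt hv.lt_top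
  rw [← map_add, linftyNorm_emb, linftyNorm_emb, linftyNorm_emb]
  exact enorm_add_le x y

lemma linftyNorm_neg (u : Distr d) : linftyNorm (-u) = linftyNorm u := by
  have key : ∀ u : Distr d, linftyNorm (-u) ≤ linftyNorm u := by
    intro u
    rcases eq_or_ne (linftyNorm u) ⊤ with hu | hu
    · simp [hu]
    obtain ⟨x, rfl⟩ := exists_emb_of_linftyNorm_lt hu.lt_top
    rw [← map_neg, linftyNorm_emb, linftyNorm_emb, enorm_neg]
  refine le_antisymm (key u) ?_
  simpa using key (-u)

/-! ### Besov norms of distributions -/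

section Besov

variable {p : ℕ → Rd d → ℝ} {u v : Distr d} {γ : ℝ}

lemma besovNorm_add_le (u v : Distr d) :
    besovNorm p γ (u + v) ≤ besovNorm p γ u + besovNorm p γ v := by
  refine iSup_le fun n => ?_
  calc blockSize p γ (u + v) n ≤ blockSize p γ u n + blockSize p γ v n := by
        rw [blockSize, blockSize, blockSize, ← mul_add, block_add]
        gcongr
        exact linftyNorm_add_le _ _
    _ ≤ _ := add_le_add (le_iSup (blockSize p γ u) n) (le_iSup (blockSize p γ v) n)

lemma besovNorm_neg (u : Distr d) : besovNorm p γ (-u) = besovNorm p γ u := by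
  have : ∀ n, block p n (-u) = -block p n u := fun n => by rw [block_eq, map_neg]; rfl
  simp only [besovNorm, blockSize, this, linftyNorm_neg]

lemma besovNorm_sub_le (u v : Distr d) :
    besovNorm p γ (u - v) ≤ besovNorm p γ u + besovNorm p γ v := by
  rw [sub_eq_add_neg, ← besovNorm_neg v]
  exact besovNorm_add_le u (-v)

lemma blockSize_eq {n : ℕ} {x : XD d} (h : emb x = block p n u) :
    blockSize p γ u n = ENNReal.ofReal (lam n ^ γ * ‖x‖) := by
  rw [blockSize, ← h, linftyNorm_emb, ENNReal.ofReal_mul (Real.rpow_nonneg (lam_pos n).le _),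
    lam_rpow, ofReal_norm]

lemma hasBlocks_of_besovNorm (h : besovNorm p γ u < ⊤) : HasBlocks p u := by
  intro n
  refine exists_emb_of_linftyNorm_lt ?_
  have h1 : blockSize p γ u n < ⊤ := (le_iSup (blockSize p γ u) n).trans_lt h
  rw [blockSize] at h1
  refine ENNReal.lt_top_of_mul_ne_top_right h1.ne ?_
  simp only [ne_eq, ENNReal.ofReal_eq_zero, not_le]
  positivity

/-- The norm of `B^γ_{∞,∞}` as a real number. -/
def bn (p : ℕ → Rd d → ℝ) (γ : ℝ) (u : Distr d) : ℝ := (besovNorm p γ u).toReal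

lemma bn_nonneg : 0 ≤ bn p γ u := ENNReal.toReal_nonneg

lemma ofReal_bn (h : besovNorm p γ u < ⊤) : ENNReal.ofReal (bn p γ u) = besovNorm p γ u :=
  ENNReal.ofReal_toReal h.ne

lemma norm_bl_le (h : besovNorm p γ u < ⊤) (n : ℕ) :
    ‖bl p n u‖ ≤ lam n ^ (-γ) * bn p γ u := by
  have h1 : blockSize p γ u n ≤ besovNorm p γ u := le_iSup (blockSize p γ u) n
  rw [blockSize_eq ((hasBlocks_of_besovNorm h).emb_bl n), ← ofReal_bn h,
    ENNReal.ofReal_le_ofReal_iff bn_nonneg] at h1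
  rw [Real.rpow_neg (lam_pos n).le, ← div_eq_inv_mul,
    le_div_iff₀ (Real.rpow_pos_of_pos (lam_pos n) _)]
  linarith

lemma besovNorm_le {C : ℝ} (h : ∀ n, ∃ x : XD d, emb x = block p n u ∧ ‖x‖ ≤ lam n ^ (-γ) * C) :
    besovNorm p γ u ≤ ENNReal.ofReal C := by
  refine iSup_le fun n => ?_
  obtain ⟨x, hx, hn⟩ := h n
  rw [blockSize_eq hx]
  refine ENNReal.ofReal_le_ofReal ?_
  rw [Real.rpow_neg (lam_pos n).le, ← div_eq_inv_mul,
    le_div_iff₀ (Real.rpow_pos_of_pos (lam_pos n) _)] at hn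
  linarith

lemma bn_le {C : ℝ} (hC : 0 ≤ C)
    (h : ∀ n, ∃ x : XD d, emb x = block p n u ∧ ‖x‖ ≤ lam n ^ (-γ) * C) : bn p γ u ≤ C :=
  ENNReal.toReal_le_of_le_ofReal hC (besovNorm_le h)

lemma memC_of_little {C : ℝ} {ε : ℕ → ℝ} (hε : Tendsto ε atTop (𝓝 0)) (hC : ∀ n, ε n ≤ C)
    (h : ∀ n, ∃ x : XD d, emb x = block p n u ∧ ‖x‖ ≤ lam n ^ (-γ) * ε n) : MemC p γ u := by
  refine ⟨(besovNorm_le (C := C) fun n => ?_).trans_lt ENNReal.ofReal_lt_top, ?_⟩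
  · obtain ⟨x, hx, hn⟩ := h n
    exact ⟨x, hx, hn.trans (mul_le_mul_of_nonneg_left (hC n) (Real.rpow_nonneg (lam_pos n).le _))⟩
  · refine tendsto_of_tendsto_of_tendsto_of_le_of_le (g := fun _ => 0)
      (h := fun n => ENNReal.ofReal (ε n)) tendsto_const_nhds ?_ (fun n => zero_le) fun n => ?_
    · simpa using ENNReal.tendsto_ofReal hε
    · obtain ⟨x, hx, hn⟩ := h n
      simp only
      rw [blockSize_eq hx]
      refine ENNReal.ofReal_le_ofReal ?_
      rw [Real.rpow_neg (lam_pos n).le, ← div_eq_inv_mul,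
        le_div_iff₀ (Real.rpow_pos_of_pos (lam_pos n) _)] at hn
      linarith

lemma MemC.tendsto_bl (h : MemC p γ u) :
    Tendsto (fun n => lam n ^ γ * ‖bl p n u‖) atTop (𝓝 0) := by
  have h1 := h.2
  have e : blockSize p γ u = fun n => ENNReal.ofReal (lam n ^ γ * ‖bl p n u‖) := funext fun n =>
    blockSize_eq ((hasBlocks_of_besovNorm h.1).emb_bl n)
  rw [e] at h1
  have h2 := (ENNReal.tendsto_toReal ENNReal.zero_ne_top).comp h1
  simp only [ENNReal.toReal_zero] at h2
  refine h2.congr fun n => ?_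
  exact ENNReal.toReal_ofReal (mul_nonneg (Real.rpow_nonneg (lam_pos n).le _) (norm_nonneg _))

lemma summable_bl (hγ : 0 < γ) (h : besovNorm p γ u < ⊤) : Summable fun n => bl p n u :=
  Summable.of_norm_bounded ((summable_lam (by linarith : -γ < 0)).mul_right _) (norm_bl_le h)

/-- The bounded function that represents an element of `B^γ_{∞,∞}` with `γ > 0`. -/
def rep (p : ℕ → Rd d → ℝ) (u : Distr d) : XD d := ∑' n, bl p n u

lemma norm_rep_le (hγ : 0 < γ) : ∃ C, 0 ≤ C ∧ ∀ u : Distr d, besovNorm p γ u < ⊤ →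
    ‖rep p u‖ ≤ C * bn p γ u := by
  refine ⟨∑' n, lam n ^ (-γ), tsum_nonneg fun n => Real.rpow_nonneg (lam_pos n).le _,
    fun u h => ?_⟩
  rw [← tsum_mul_right]
  exact tsum_of_norm_bounded ((summable_lam (by linarith : -γ < 0)).mul_right _).hasSum
    (norm_bl_le h)

variable (hp : IsDyadicPartition p)
include hp

lemma emb_rep (hγ : 0 < γ) (h : besovNorm p γ u < ⊤) : emb (rep p u) = u :=
  emb_tsum_bl hp (hasBlocks_of_besovNorm h) (summable_bl hγ h)

end Besov

lemma emb_continuous : Continuous (emb : XD d → Distr d) := by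
  refine PointwiseConvergenceCLM.continuous_of_continuous_eval fun φ => ?_
  exact (ContinuousLinearMap.apply ℂ ℂ (toL1 φ)).continuous

/-! ### The semigroup on single blocks -/

/-- The multiplier `exp (-t ψ)`. -/
def ex (α : ℝ) (ν : Measure (Metric.sphere (0 : Rd d) 1)) (t : ℝ) (z : Rd d) : ℂ :=
  ((Real.exp (-t * symb α ν z) : ℝ) : ℂ)

/-- The semigroup on `L^1`. -/
def U (α : ℝ) (ν : Measure (Metric.sphere (0 : Rd d) 1)) (t : ℝ) : L1 d →L[ℂ] L1 d :=
  op (ex α ν t)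

lemma U_zero (α : ℝ) (ν : Measure (Metric.sphere (0 : Rd d) 1)) : U α ν 0 = 1 := by
  refine HasSymbol.op_eq (HasSymbol.one.congr fun z => ?_)
  simp [ex]

/-- A geometric series that is uniformly bounded in the scale `y`. -/
lemma sum_min_rpow_le {a b : ℝ} (ha : 0 < a) (hb : 0 < b) : ∃ C, 0 ≤ C ∧ ∀ y : ℝ, 0 < y →
    ∀ M : ℕ, ∑ n ∈ Finset.range M, min ((y * lam n) ^ a) ((y * lam n) ^ (-b)) ≤ C := by
  have hqa : (2 : ℝ) ^ (-a) < 1 := Real.rpow_lt_one_of_one_lt_of_neg one_lt_two (by linarith)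
  have hqb : (2 : ℝ) ^ (-b) < 1 := Real.rpow_lt_one_of_one_lt_of_neg one_lt_two (by linarith)
  have hsa := summable_geometric_of_lt_one (by positivity) hqa
  have hsb := summable_geometric_of_lt_one (by positivity) hqb
  refine ⟨∑' n : ℕ, ((2 : ℝ) ^ (-a)) ^ n + ∑' n : ℕ, ((2 : ℝ) ^ (-b)) ^ n,
    add_nonneg (tsum_nonneg fun n => by positivity) (tsum_nonneg fun n => by positivity),
    fun y hy M => ?_⟩
  have hex : ∃ n, 1 ≤ y * lam n := by
    obtain ⟨n, hn⟩ := pow_unbounded_of_one_lt (2 / y) one_lt_two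
    refine ⟨n, ?_⟩
    rw [div_lt_iff₀ hy] at hn
    rw [lam_eq]
    linarith
  classical
  -- The first index with `y * lam N ≥ 1`: going down from it the first term of the minimum decays
  -- geometrically, going up the second does, both at rates independent of `y`.
  set N := Nat.find hex with hN
  have hN1 : 1 ≤ y * lam N := Nat.find_spec hex
  have hN2 : ∀ n < N, y * lam n < 1 := fun n hn => not_le.1 (Nat.find_min hex hn)
  have hyl : ∀ n, 0 < y * lam n := fun n => mul_pos hy (lam_pos n)
  have hlam : ∀ n k, lam (n + k) = lam n * 2 ^ k := fun n k => by
    rw [lam_eq, lam_eq, pow_add]; ring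
  have h2k : ∀ (k : ℕ) (c : ℝ), ((2 : ℝ) ^ k) ^ c = ((2 : ℝ) ^ c) ^ k := fun k c => by
    rw [← Real.rpow_natCast, ← Real.rpow_natCast, ← Real.rpow_mul two_pos.le,
      ← Real.rpow_mul two_pos.le, mul_comm]
  have hnn : ∀ n, 0 ≤ min ((y * lam n) ^ a) ((y * lam n) ^ (-b)) := fun n =>
    le_min (Real.rpow_nonneg (hyl n).le _) (Real.rpow_nonneg (hyl n).le _)
  have hle : ∑ n ∈ Finset.range M, min ((y * lam n) ^ a) ((y * lam n) ^ (-b)) ≤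
      ∑ n ∈ Finset.range (N + M), min ((y * lam n) ^ a) ((y * lam n) ^ (-b)) :=
    Finset.sum_le_sum_of_subset_of_nonneg
      (Finset.range_mono (Nat.le_add_left _ _)) fun n _ _ => hnn n
  refine hle.trans ?_
  rw [Finset.sum_range_add]
  refine add_le_add ?_ ?_
  · rw [← Finset.sum_range_reflect]
    refine le_trans (Finset.sum_le_sum (g := fun k => ((2 : ℝ) ^ (-a)) ^ k) fun k hk => ?_)
      (hsa.sum_le_tsum _ fun k _ => by positivity)
    have hk' : k < N := Finset.mem_range.1 hk
    refine (min_le_left _ _).trans ?_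
    have h1 : lam (N - 1) = lam (N - 1 - k) * 2 ^ k := by rw [← hlam]; congr 1; omega
    have h2 : y * lam (N - 1 - k) ≤ ((2 : ℝ) ^ k)⁻¹ := by
      have := (hN2 (N - 1) (by omega)).le
      rw [h1, ← mul_assoc] at this
      rwa [← one_div, le_div_iff₀ (by positivity)]
    calc (y * lam (N - 1 - k)) ^ a ≤ (((2 : ℝ) ^ k)⁻¹) ^ a :=
          Real.rpow_le_rpow (hyl _).le h2 ha.le
      _ = ((2 : ℝ) ^ (-a)) ^ k := by
          rw [Real.inv_rpow (by positivity), h2k, Real.rpow_neg two_pos.le, inv_pow]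
  · refine le_trans (Finset.sum_le_sum (g := fun k => ((2 : ℝ) ^ (-b)) ^ k) fun k _ => ?_)
      (hsb.sum_le_tsum _ fun k _ => by positivity)
    refine (min_le_right _ _).trans ?_
    rw [hlam, ← mul_assoc]
    calc (y * lam N * 2 ^ k) ^ (-b) ≤ ((2 : ℝ) ^ k) ^ (-b) := by
          refine Real.rpow_le_rpow_of_nonpos (by positivity) ?_ (by linarith)
          exact le_mul_of_one_le_left (by positivity) hN1
      _ = _ := h2k _ _

lemma min_one_le_rpow {x σ : ℝ} (hx : 0 ≤ x) (h0 : 0 ≤ σ) (h1 : σ ≤ 1) : min 1 x ≤ x ^ σ := by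
  rcases le_total x 1 with h | h
  · rcases hx.eq_or_lt with rfl | hx
    · rw [min_eq_right h]
      exact Real.rpow_nonneg le_rfl _
    · rw [min_eq_right h]
      simpa using Real.rpow_le_rpow_of_exponent_ge hx h h1
  · rw [min_eq_left h]
    exact Real.one_le_rpow h h0

section Semigroup

variable (ν : Measure (Metric.sphere (0 : Rd d) 1)) [IsFiniteMeasure ν]
  (hspan : Submodule.span ℝ
      ((fun ξ : Metric.sphere (0 : Rd d) 1 => (ξ : Rd d)) '' ν.support) = ⊤)
  {α : ℝ} (hα : α ∈ Ioc (1 : ℝ) 2)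

-- Self-similarity: time `t` is time one after the dilation by `t ^ (1 / α)`. Since multiplier
-- bounds are dilation invariant, estimates at time one hold uniformly in `t`.
omit [IsFiniteMeasure ν] in
include hα in
lemma ex_eq_scale {t : ℝ} (ht : 0 ≤ t) (z : Rd d) :
    ex α ν t z = ((Real.exp (-1 * symb α ν (t ^ α⁻¹ • z)) : ℝ) : ℂ) := by
  have hα0 : α ≠ 0 := by linarith [hα.1]
  rw [symb_smul ν α (Real.rpow_nonneg ht _), ← Real.rpow_mul ht, inv_mul_cancel₀ hα0,
    Real.rpow_one, ex]
  congr 2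
  ring

include hspan hα in
lemma isMul_ex : ∃ C, ∀ t : ℝ, 0 ≤ t → IsMul (ex α ν t) C := by
  obtain ⟨C, hC⟩ := (isFI_mul_exp ν hspan hα (Function.HasTemperateGrowth.const (1 : ℂ))
    one_pos).isMul
  exact ⟨C, fun t ht => (hC (t ^ α⁻¹)).congr fun z => by rw [one_mul, ex_eq_scale ν hα ht]⟩

include hspan hα in
lemma norm_U_le : ∃ C, 1 ≤ C ∧ ∀ t : ℝ, 0 ≤ t → ‖U α ν t‖ ≤ C := by
  obtain ⟨C, hC⟩ := isMul_ex ν hspan hα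
  exact ⟨max 1 C, le_max_left _ _, fun t ht => (hC t ht).norm_le.trans (le_max_right _ _)⟩

include hspan hα in
lemma U_add {s t : ℝ} (hs : 0 ≤ s) (ht : 0 ≤ t) : U α ν (s + t) = U α ν s ∘L U α ν t := by
  obtain ⟨C, hC⟩ := isMul_ex ν hspan hα
  refine HasSymbol.op_eq (((hC s hs).hasSymbol.comp (hC t ht).hasSymbol).congr fun z => ?_)
  rw [ex, ex, ex, ← Complex.ofReal_mul, ← Real.exp_add]
  congr 2
  ring

include hspan hα in
lemma U_comm_op {m : Rd d → ℂ} {C : ℝ} (h : IsMul m C) {t : ℝ} (ht : 0 ≤ t) :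
    U α ν t ∘L op m = op m ∘L U α ν t := by
  obtain ⟨C', hC⟩ := isMul_ex ν hspan hα
  exact (hC t ht).op_comm h

variable {p : ℕ → Rd d → ℝ} (hp : IsDyadicPartition p)

-- With `r = t ^ (1 / α)` and `l = lam n`, on the annulus at scale `l` the multiplier equals `(r
-- l)⁻²` times `κ (z / l)` times `‖r z‖² exp (-ψ (r z))`, where `κ = ‖w‖⁻² η`. Both remaining
-- factors are dilations of fixed multipliers. The block of index `0` reaches the origin and is
-- excluded.
include hspan hα hp in
lemma norm_bl_comp_U_high : ∃ C, 0 ≤ C ∧ ∀ (t : ℝ) (n : ℕ) (u : Distr d), 0 < t → 1 ≤ n →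
    HasBlocks p u → ‖bl p n u ∘L U α ν t‖ ≤ C * (t * lam n ^ α) ^ (-(2 / α)) * ‖bl p n u‖ := by
  have hα0 : 0 < α := by linarith [hα.1]
  obtain ⟨a, ha, ha1⟩ := hp.eq_one_near
  set η : Rd d → ℂ := fun w => (p 0 ((4 : ℝ)⁻¹ • w) : ℂ) - (p 0 ((2 : ℝ) • w) : ℂ) with hη
  have hηt : η.HasTemperateGrowth :=
    (hp.hasTemperateGrowth_cut (4 : ℝ)⁻¹).sub (hp.hasTemperateGrowth_cut (2 : ℝ))
  have hη0 : ∀ w, ‖w‖ < a / 2 → η w = 0 := fun w hw => by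
    have h1 : p 0 ((4 : ℝ)⁻¹ • w) = 1 := ha1 _ (by
      rw [norm_smul]; norm_num; linarith [norm_nonneg w])
    have h2 : p 0 ((2 : ℝ) • w) = 1 := ha1 _ (by rw [norm_smul]; norm_num; linarith)
    simp [hη, h1, h2]
  have hηc : HasCompactSupport η := by
    have h1 : HasCompactSupport fun w : Rd d => (p 0 ((4 : ℝ)⁻¹ • w) : ℂ) :=
      (hp.hasCompactSupport_ofReal 0).comp_smul (by norm_num)
    have h2 : HasCompactSupport fun w : Rd d => (p 0 ((2 : ℝ) • w) : ℂ) :=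
      (hp.hasCompactSupport_ofReal 0).comp_smul (by norm_num)
    exact h1.sub h2
  set κ : Rd d → ℂ := fun w => ((‖w‖ ^ 2)⁻¹ : ℝ) * η w with hκ
  have hκc : HasCompactSupport κ := hηc.mul_left
  have hκs : ContDiff ℝ ∞ κ := by
    rw [contDiff_iff_contDiffAt]
    intro w
    rcases eq_or_ne w 0 with rfl | hw
    · have : κ =ᶠ[𝓝 0] fun _ => 0 := by
        filter_upwards [Metric.ball_mem_nhds (0 : Rd d) (half_pos ha)] with w hw
        rw [mem_ball_zero_iff] at hw
        simp [hκ, hη0 w hw]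
      exact contDiffAt_const.congr_of_eventuallyEq this
    · have h1 : ContDiffAt ℝ ∞ (fun w : Rd d => (‖w‖ ^ 2)⁻¹) w :=
        (contDiff_norm_sq ℝ).contDiffAt.inv (by simpa using hw)
      exact (Complex.ofRealCLM.contDiff.contDiffAt.comp w h1).mul hηt.1.contDiffAt
  obtain ⟨C1, hC1⟩ := isMul_of_contDiff hκc hκs
  have hsq : (fun z : Rd d => ((‖z‖ ^ 2 : ℝ) : ℂ)).HasTemperateGrowth := by fun_prop
  obtain ⟨C2, hC2⟩ := (isFI_mul_exp ν hspan hα hsq one_pos).isMul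
  obtain ⟨C3, hC3⟩ := isMul_ex ν hspan hα
  refine ⟨C1 * C2, mul_nonneg (hC1 1).nonneg (hC2 1).nonneg, fun t n u ht hn hu => ?_⟩
  obtain ⟨k, rfl⟩ := Nat.exists_eq_succ_of_ne_zero (by omega : n ≠ 0)
  rw [Nat.succ_eq_add_one]
  set l := lam (k + 1) with hl
  have hl0 : 0 < l := lam_pos _
  set r := t ^ α⁻¹ with hr
  have hr0 : 0 < r := Real.rpow_pos_of_pos ht _
  have hrl : (t * l ^ α) ^ (-(2 / α)) = ((r * l) ^ 2)⁻¹ := by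
    have h1 : r ^ α = t := by
      rw [hr, ← Real.rpow_mul ht.le, inv_mul_cancel₀ hα0.ne', Real.rpow_one]
    have h2 : t * l ^ α = (r * l) ^ α := by rw [Real.mul_rpow hr0.le hl0.le, h1]
    rw [h2, ← Real.rpow_mul (by positivity), show α * -(2 / α) = -2 by field_simp,
      Real.rpow_neg (by positivity)]
    norm_cast
  have hm1 : IsMul (fun z => η (l⁻¹ • z)) ‖op fun z => η (l⁻¹ • z)‖ := by
    obtain ⟨C, hC⟩ := isMul_of_contDiff hηc hηt.1
    exact ⟨_, (hC l⁻¹).hasSymbol, le_rfl⟩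
  have hm2 : IsMul (fun z => η (l⁻¹ • z) * ex α ν t z) (C1 * C2 * ((r * l) ^ 2)⁻¹) := by
    have := ((hC1 l⁻¹).mul (hC2 r)).const_mul ((((r * l) ^ 2)⁻¹ : ℝ) : ℂ)
    refine (this.congr fun z => ?_).mono (le_of_eq ?_)
    · rw [← ex_eq_scale ν hα ht.le]
      rcases eq_or_ne z 0 with rfl | hz
      · simp [hκ, hη0 0 (by simpa using ha)]
      · have hz' : (‖z‖ : ℂ) ≠ 0 := by simpa using hz
        have hl' : (l : ℂ) ≠ 0 := by exact_mod_cast hl0.ne'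
        have hr' : (r : ℂ) ≠ 0 := by exact_mod_cast hr0.ne'
        simp only [hκ, norm_smul, Real.norm_of_nonneg hr0.le, norm_inv,
          Real.norm_of_nonneg hl0.le]
        push_cast
        field_simp
    · rw [Complex.norm_real, Real.norm_of_nonneg (by positivity), mul_comm]
  have e1 : bl p (k + 1) u ∘L op (fun z => η (l⁻¹ • z)) = bl p (k + 1) u := by
    refine bl_comp_op hp hm1 (hηt.comp (by fun_prop)) hu _ fun z => ?_
    rw [hp.succ_eq, ← hl]
    have := hp.one_mul_annulus (l⁻¹ • z)
    simp only [hη]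
    rw [← Complex.ofReal_sub, ← Complex.ofReal_mul, mul_comm, this]
  rw [hrl]
  calc ‖bl p (k + 1) u ∘L U α ν t‖
      = ‖bl p (k + 1) u ∘L op (fun z => η (l⁻¹ • z) * ex α ν t z)‖ := by
        rw [hm1.op_mul (hC3 t ht.le), ← ContinuousLinearMap.comp_assoc, e1]; rfl
    _ ≤ ‖bl p (k + 1) u‖ * (C1 * C2 * ((r * l) ^ 2)⁻¹) :=
        (ContinuousLinearMap.opNorm_comp_le _ _).trans
          (mul_le_mul_of_nonneg_left hm2.norm_le (norm_nonneg _))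
    _ = _ := by ring

include hspan hα hp in
/-- Smoothing by the semigroup, block by block. -/
lemma norm_bl_comp_U (T : ℝ) {κ : ℝ} (h0 : 0 ≤ κ) (h1 : κ ≤ 1) : ∃ C, 0 ≤ C ∧
    ∀ (t : ℝ) (n : ℕ) (u : Distr d), 0 < t → t ≤ T → HasBlocks p u →
      ‖bl p n u ∘L U α ν t‖ ≤ C * (t ^ (-κ) * lam n ^ (-(α * κ))) * ‖bl p n u‖ := by
  have hα0 : 0 < α := by linarith [hα.1]
  obtain ⟨C1, hC1, hU⟩ := norm_U_le ν hspan hα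
  obtain ⟨C2, hC2, hH⟩ := norm_bl_comp_U_high ν hspan hα hp
  rcases le_or_gt T 0 with hT | hT
  · exact ⟨0, le_rfl, fun t n u ht htT => absurd (ht.trans_le htT) (not_lt.2 hT)⟩
  refine ⟨max (max C1 C2) (C1 * (T * lam 0 ^ α) ^ κ), by positivity, fun t n u ht htT hu => ?_⟩
  have hx0 : 0 < t * lam n ^ α := mul_pos ht (Real.rpow_pos_of_pos (lam_pos n) _)
  have hxe : t ^ (-κ) * lam n ^ (-(α * κ)) = (t * lam n ^ α) ^ (-κ) := by
    rw [Real.mul_rpow ht.le (Real.rpow_nonneg (lam_pos n).le _), ← Real.rpow_mul (lam_pos n).le]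
    congr 2
    ring
  rw [hxe]
  have hb : ‖bl p n u ∘L U α ν t‖ ≤ C1 * ‖bl p n u‖ := by
    refine (ContinuousLinearMap.opNorm_comp_le _ _).trans ?_
    rw [mul_comm]
    exact mul_le_mul_of_nonneg_right (hU t ht.le) (norm_nonneg _)
  have hxp : 0 < (t * lam n ^ α) ^ (-κ) := Real.rpow_pos_of_pos hx0 _
  -- The lowest block has no decay, but `t * lam 0 ^ α` is bounded because `t ≤ T`; this is where
  -- the constant depends on `T`.
  rcases Nat.eq_zero_or_pos n with rfl | hn
  · refine hb.trans (mul_le_mul_of_nonneg_right ?_ (norm_nonneg _))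
    have h2 : 1 ≤ (T * lam 0 ^ α) ^ κ * (t * lam 0 ^ α) ^ (-κ) := by
      rw [Real.rpow_neg hx0.le, ← div_eq_mul_inv, one_le_div (Real.rpow_pos_of_pos hx0 _)]
      refine Real.rpow_le_rpow hx0.le ?_ h0
      exact mul_le_mul_of_nonneg_right htT (Real.rpow_nonneg (lam_pos 0).le _)
    calc C1 ≤ C1 * ((T * lam 0 ^ α) ^ κ * (t * lam 0 ^ α) ^ (-κ)) :=
          le_mul_of_one_le_right (by linarith) h2
      _ = C1 * (T * lam 0 ^ α) ^ κ * (t * lam 0 ^ α) ^ (-κ) := by ring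
      _ ≤ _ := mul_le_mul_of_nonneg_right (le_max_right _ _) hxp.le
  · rcases le_or_gt (t * lam n ^ α) 1 with h | h
    · refine hb.trans (mul_le_mul_of_nonneg_right ?_ (norm_nonneg _))
      have h2 : 1 ≤ (t * lam n ^ α) ^ (-κ) :=
        Real.one_le_rpow_of_pos_of_le_one_of_nonpos hx0 h (by linarith)
      exact (le_mul_of_one_le_right (by linarith) h2).trans
        (mul_le_mul_of_nonneg_right ((le_max_left _ _).trans (le_max_left _ _)) hxp.le)
    · refine (hH t n u ht hn hu).trans (mul_le_mul_of_nonneg_right ?_ (norm_nonneg _))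
      -- Quadratic decay in frequency covers every `κ ≤ 1` because `α ≤ 2`.
      have h2 : κ ≤ 2 / α := by rw [le_div_iff₀ hα0]; nlinarith [hα.2]
      have h3 : (t * lam n ^ α) ^ (-(2 / α)) ≤ (t * lam n ^ α) ^ (-κ) :=
        Real.rpow_le_rpow_of_exponent_le h.le (by linarith)
      exact mul_le_mul ((le_max_right _ _).trans (le_max_left _ _)) h3
        (Real.rpow_nonneg hx0.le _) (by positivity)

-- If `t * lam n ^ α ≥ 1` boundedness of the semigroup suffices. Otherwise `-t ψ`, cut off at the
-- scale of the block, is a multiplier of norm of order `t * lam n ^ α`, and its exponential minus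
-- one has the same order.
include hspan hα hp in
lemma norm_bl_comp_U_sub_one : ∃ C, 0 ≤ C ∧ ∀ (t : ℝ) (n : ℕ) (u : Distr d), 0 ≤ t →
    HasBlocks p u →
      ‖bl p n u ∘L (U α ν t - 1)‖ ≤ C * min 1 (t * lam n ^ α) * ‖bl p n u‖ := by
  have hα0 : 0 < α := by linarith [hα.1]
  obtain ⟨C1, hC1, hU⟩ := norm_U_le ν hspan hα
  obtain ⟨C2, hC2⟩ := hp.isMul_cut
  obtain ⟨C3, hC3⟩ := isMul_ex ν hspan hα
  obtain ⟨C4, hC4⟩ := (isFI_symb_mul ν hα (hp.hasCompactSupport_ofReal 0)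
    (hp.contDiff_ofReal 0)).isMul
  have hC4' : 0 ≤ C4 := (hC4 1).nonneg
  have hC2' : 0 ≤ C2 := (hC2 1).nonneg
  set B := (8 : ℝ) ^ α * C4 with hB
  have hB0 : 0 ≤ B := by positivity
  refine ⟨max (C1 + 1) (C2 * (Real.exp B * B)), by positivity, fun t n u ht hu => ?_⟩
  set x := t * lam n ^ α with hx
  have hx0 : 0 ≤ x := mul_nonneg ht (Real.rpow_nonneg (lam_pos n).le _)
  rcases le_or_gt x 1 with h | h
  swap
  · rw [min_eq_left h.le, mul_one]
    refine (ContinuousLinearMap.opNorm_comp_le _ _).trans ?_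
    rw [mul_comm]
    refine mul_le_mul_of_nonneg_right ?_ (norm_nonneg _)
    refine le_trans ?_ (le_max_left _ _)
    exact (norm_sub_le _ _).trans (add_le_add (hU t ht) ContinuousLinearMap.norm_id_le)
  rw [min_eq_right h]
  -- Two nested cutoffs: `c1` is one on the block, and `c2` is one on the support of `c1`, so it may
  -- be inserted into the exponent without changing the product with `c1`. The scale of `c2` is `2 ^
  -- (n + 2) = 8 * lam n`, whence the `8 ^ α` in `B`.
  set c1 : Rd d → ℂ := fun z => (p 0 (((2 : ℝ) ^ (n + 1))⁻¹ • z) : ℂ) with hc1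
  set c2 : Rd d → ℂ := fun z => (p 0 (((2 : ℝ) ^ (n + 2))⁻¹ • z) : ℂ) with hc2
  have hcc : ∀ z, c1 z ≠ 0 → c2 z = 1 := by
    intro z hz
    have : c1 z * c2 z = c1 z := by
      simp only [hc1, hc2, ← hp.sum_range (n + 1)]
      rw [← Complex.ofReal_mul, Finset.sum_mul]
      congr 1
      refine Finset.sum_congr rfl fun m hm => hp.mul_cut ?_ z
      have := Finset.mem_range.1 hm
      omega
    exact mul_left_cancel₀ hz (by rw [this, mul_one])
  have hψ : IsMul (fun z => (-t : ℂ) * ((symb α ν z : ℂ) * c2 z)) (B * x) := by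
    have h1 := (hC4 ((2 : ℝ) ^ (n + 2))⁻¹).const_mul ((-t * (8 * lam n) ^ α : ℝ) : ℂ)
    have e8 : (8 : ℝ) * lam n = 2 ^ (n + 2) := by rw [lam_eq, pow_add]; ring
    refine (h1.congr fun z => ?_).mono (le_of_eq ?_)
    · rw [symb_smul ν α (by positivity), e8, Real.inv_rpow (by positivity)]
      have : (((2 : ℝ) ^ (n + 2)) ^ α : ℝ) ≠ 0 := (Real.rpow_pos_of_pos (by positivity) _).ne'
      have hne : ((((2 : ℝ) ^ (n + 2)) ^ α : ℝ) : ℂ) ≠ 0 := by exact_mod_cast this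
      rw [show ((p 0 (((2 : ℝ) ^ (n + 2))⁻¹ • z) : ℝ) : ℂ) = c2 z from rfl]
      push_cast at hne ⊢
      field_simp
    · rw [Complex.norm_real, norm_mul, norm_neg, Real.norm_of_nonneg ht,
        Real.norm_of_nonneg (Real.rpow_nonneg (by linarith [lam_pos n]) _),
        Real.mul_rpow (by norm_num) (lam_pos n).le, hB, hx]
      ring
  have hE := hψ.exp_sub_one
  have hprod := (hC2 ((2 : ℝ) ^ (n + 1))⁻¹).mul hE
  have e1 : bl p n u ∘L op c1 = bl p n u := by
    refine bl_comp_op hp (hC2 _) (hp.hasTemperateGrowth_cut _) hu _ fun z => ?_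
    rw [← Complex.ofReal_mul, mul_comm, hp.mul_cut le_rfl]
  have e2 : bl p n u ∘L (U α ν t - 1) = bl p n u ∘L op (fun z => c1 z *
      (Complex.exp ((-t : ℂ) * ((symb α ν z : ℂ) * c2 z)) - 1)) := by
    have h2 : (op fun z => c1 z * (Complex.exp ((-t : ℂ) * ((symb α ν z : ℂ) * c2 z)) - 1)) =
        op c1 ∘L (U α ν t - 1) := by
      refine HasSymbol.op_eq (((hC2 _).hasSymbol.comp
        ((hC3 t ht).hasSymbol.sub HasSymbol.one)).congr fun z => ?_)
      by_cases hz : c1 z = 0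
      · simp only [hc1] at hz
        rw [show c1 z = 0 from hz, hz, zero_mul, zero_mul]
      · rw [hcc z hz, ex, mul_one]
        push_cast
        rfl
    rw [h2, ← ContinuousLinearMap.comp_assoc, e1]
  rw [e2]
  refine (ContinuousLinearMap.opNorm_comp_le _ _).trans ?_
  rw [mul_comm]
  refine mul_le_mul_of_nonneg_right (hprod.norm_le.trans ?_) (norm_nonneg _)
  have hexp : Real.exp (B * x) - 1 ≤ Real.exp B * B * x := by
    have h3 : 0 ≤ B * x := mul_nonneg hB0 hx0
    have h4 : Real.exp (B * x) ≤ Real.exp B := Real.exp_le_exp.2 (by nlinarith)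
    have h5 : -(B * x) + 1 ≤ Real.exp (-(B * x)) := Real.add_one_le_exp _
    have h6 : Real.exp (B * x) * Real.exp (-(B * x)) = 1 := by
      rw [← Real.exp_add]; simp
    have h7 : 0 < Real.exp (B * x) := Real.exp_pos _
    nlinarith [mul_le_mul_of_nonneg_left h5 h7.le, mul_le_mul_of_nonneg_right h4 h3]
  calc C2 * (Real.exp (B * x) - 1) ≤ C2 * (Real.exp B * B * x) := by gcongr
    _ = C2 * (Real.exp B * B) * x := by ring
    _ ≤ _ := mul_le_mul_of_nonneg_right (le_max_right _ _) hx0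

end Semigroup

/-! ### The semigroup on Besov spaces -/

/-- The action of the semigroup on distributions with bounded blocks. -/
def Pm (p : ℕ → Rd d → ℝ) (α : ℝ) (ν : Measure (Metric.sphere (0 : Rd d) 1)) (t : ℝ)
    (u : Distr d) : XD d := ∑' n, bl p n u ∘L U α ν t

section Semigroup

variable (ν : Measure (Metric.sphere (0 : Rd d) 1)) [IsFiniteMeasure ν]
  (hspan : Submodule.span ℝ
      ((fun ξ : Metric.sphere (0 : Rd d) 1 => (ξ : Rd d)) '' ν.support) = ⊤)
  {α : ℝ} (hα : α ∈ Ioc (1 : ℝ) 2) {p : ℕ → Rd d → ℝ} (hp : IsDyadicPartition p)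

include hspan hα hp

lemma norm_bl_comp_U_besov (T : ℝ) {κ : ℝ} (h0 : 0 ≤ κ) (h1 : κ ≤ 1) (γ : ℝ) : ∃ C, 0 ≤ C ∧
    ∀ (t : ℝ) (n : ℕ) (u : Distr d), 0 < t → t ≤ T → besovNorm p γ u < ⊤ →
      ‖bl p n u ∘L U α ν t‖ ≤ lam n ^ (-(γ + α * κ)) * (C * t ^ (-κ) * bn p γ u) := by
  obtain ⟨C, hC, h⟩ := norm_bl_comp_U ν hspan hα hp T h0 h1
  refine ⟨C, hC, fun t n u ht htT hu => ?_⟩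
  refine (h t n u ht htT (hasBlocks_of_besovNorm hu)).trans ?_
  have h2 : 0 ≤ C * (t ^ (-κ) * lam n ^ (-(α * κ))) := mul_nonneg hC
    (mul_nonneg (Real.rpow_nonneg ht.le _) (Real.rpow_nonneg (lam_pos n).le _))
  refine (mul_le_mul_of_nonneg_left (norm_bl_le hu n) h2).trans (le_of_eq ?_)
  rw [show -(γ + α * κ) = -(α * κ) + -γ by ring, Real.rpow_add (lam_pos n)]
  ring

lemma norm_Pm_le (T : ℝ) {κ : ℝ} (h0 : 0 ≤ κ) (h1 : κ ≤ 1) {γ : ℝ} (hγ : 0 < γ + α * κ) :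
    ∃ C, 0 ≤ C ∧ ∀ (t : ℝ) (u : Distr d), 0 < t → t ≤ T → besovNorm p γ u < ⊤ →
      Summable (fun n => bl p n u ∘L U α ν t) ∧ ‖Pm p α ν t u‖ ≤ C * t ^ (-κ) * bn p γ u := by
  obtain ⟨C, hC, h⟩ := norm_bl_comp_U_besov ν hspan hα hp T h0 h1 γ
  have hs := summable_lam (by linarith : -(γ + α * κ) < 0)
  refine ⟨(∑' n, lam n ^ (-(γ + α * κ))) * C,
    mul_nonneg (tsum_nonneg fun n => Real.rpow_nonneg (lam_pos n).le _) hC,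
    fun t u ht htT hu => ⟨Summable.of_norm_bounded (hs.mul_right _) fun n => h t n u ht htT hu, ?_⟩⟩
  rw [mul_assoc, mul_assoc, ← mul_assoc C, ← tsum_mul_right]
  exact tsum_of_norm_bounded (hs.mul_right _).hasSum fun n => h t n u ht htT hu

lemma summable_bl_comp_U {γ : ℝ} (hγ : -α < γ) {t : ℝ} (ht : 0 < t) {u : Distr d}
    (hu : besovNorm p γ u < ⊤) : Summable fun n => bl p n u ∘L U α ν t := by
  obtain ⟨C, -, h⟩ := norm_Pm_le ν hspan hα hp t zero_le_one le_rfl (γ := γ) (by linarith)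
  exact (h t u ht le_rfl hu).1

/-- Convolution of a block with the kernel is the adjoint of `U`, and for `γ > -α` smoothing with `κ
= 1` makes the series converge in norm, hence also as distributions. -/
lemma semigroup_eq {γ : ℝ} (hγ : -α < γ) {t : ℝ} (ht : 0 < t) {u : Distr d}
    (hu : besovNorm p γ u < ⊤) : semigroup p α ν t u = emb (Pm p α ν t u) := by
  obtain ⟨K, hK, hKF, hKd⟩ := density_ae_eq ν hspan hα ht
  have havg : avg volume hK measurable_id = U α ν t := by
    refine (HasSymbol.op_eq ((hasSymbol_avg volume hK measurable_id).congr fun z => ?_)).symm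
    rw [ex, ← hKF, Real.fourier_eq]
    refine integral_congr_ae (ae_of_all _ fun y => ?_)
    simp only [chrF, Circle.smul_def, smul_eq_mul, inner_neg_right, id]
    rw [mul_comm]
  have hb := hasBlocks_of_besovNorm hu
  have hterm : ∀ n, ofBounded (fun x => ∫ y, density α ν t y *
      linftyFun (block p n u) (x - y)) = emb (bl p n u ∘L U α ν t) := by
    intro n
    rw [← hb.emb_bl n, linftyFun_emb, ← havg, ← ofBounded_convolution hK]
    congr 1
    funext x
    refine integral_congr_ae ?_
    filter_upwards [hKd] with y hy
    rw [hy]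
  rw [semigroup, if_neg ht.ne']
  simp only [hterm]
  exact ((summable_bl_comp_U ν hspan hα hp hγ ht hu).hasSum.map (emb : XD d →ₗ[ℂ] Distr d)
    emb_continuous).tsum_eq

/-- The operators commute, so the `k`-th block of the series only involves `bl p k u` cut by the `p
n` with `n ≤ k + 1`; these add up to a cutoff that is one on the block. -/
lemma Pm_comp_block {γ : ℝ} (hγ : -α < γ) {t : ℝ} (ht : 0 < t) {u : Distr d}
    (hu : besovNorm p γ u < ⊤) (k : ℕ) :
    (Pm p α ν t u ∘L op fun z => (p k z : ℂ)) = bl p k u ∘L U α ν t := by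
  obtain ⟨C, hC⟩ := hp.isMul_block
  obtain ⟨C2, hC2⟩ := hp.isMul_cut
  have hb := hasBlocks_of_besovNorm hu
  have h1 := (summable_bl_comp_U ν hspan hα hp hγ ht hu).hasSum.mapL
    ((ContinuousLinearMap.compL ℂ (L1 d) (L1 d) ℂ).flip (op fun z => (p k z : ℂ)))
  have e : ∀ n, ((ContinuousLinearMap.compL ℂ (L1 d) (L1 d) ℂ).flip (op fun z => (p k z : ℂ)))
      (bl p n u ∘L U α ν t) = (bl p k u ∘L op fun z => (p n z : ℂ)) ∘L U α ν t := by
    intro n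
    rw [ContinuousLinearMap.flip_apply, ContinuousLinearMap.compL_apply,
      ContinuousLinearMap.comp_assoc, U_comm_op ν hspan hα (hC k) ht.le,
      ← ContinuousLinearMap.comp_assoc, bl_comp_block_comm hp hb]
  simp only [e] at h1
  have h2 : HasSum (fun n => (bl p k u ∘L op fun z => (p n z : ℂ)) ∘L U α ν t)
      (∑ n ∈ Finset.range (k + 1 + 1), (bl p k u ∘L op fun z => (p n z : ℂ)) ∘L U α ν t) := by
    refine hasSum_sum_of_ne_finset_zero fun n hn => ?_
    rw [bl_comp_block_eq_zero hp hb (Or.inr (by simp at hn; omega)), ContinuousLinearMap.zero_comp]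
  have h3 : op (fun z => (p 0 (((2 : ℝ) ^ (k + 1))⁻¹ • z) : ℂ)) =
      ∑ n ∈ Finset.range (k + 1 + 1), op fun z => (p n z : ℂ) := by
    refine HasSymbol.op_eq fun f z => ?_
    rw [sum_apply, map_sum, ← hp.sum_range, Complex.ofReal_sum, Finset.sum_mul]
    exact Finset.sum_congr rfl fun n _ => (hC n).hasSymbol f z
  have h4 : ∑ n ∈ Finset.range (k + 1 + 1), (bl p k u ∘L op fun z => (p n z : ℂ)) ∘L U α ν t =
      bl p k u ∘L U α ν t := by
    rw [← ContinuousLinearMap.finsetSum_comp, ← ContinuousLinearMap.comp_finsetSum, ← h3,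
      bl_comp_op hp (hC2 _) (hp.hasTemperateGrowth_cut _) hb k fun z => ?_]
    rw [← Complex.ofReal_mul, mul_comm, hp.mul_cut le_rfl]
  exact h1.unique (h4 ▸ h2)

lemma Pm_add {γ : ℝ} (hγ : -α < γ) {s t : ℝ} (hs : 0 < s) (ht : 0 ≤ t) {u : Distr d}
    (hu : besovNorm p γ u < ⊤) : Pm p α ν (s + t) u = Pm p α ν s u ∘L U α ν t := by
  have h1 := (summable_bl_comp_U ν hspan hα hp hγ hs hu).hasSum.mapL
    ((ContinuousLinearMap.compL ℂ (L1 d) (L1 d) ℂ).flip (U α ν t))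
  rw [Pm]
  simp only [U_add ν hspan hα hs.le ht, ← ContinuousLinearMap.comp_assoc]
  exact h1.tsum_eq

lemma Pm_sub {γ : ℝ} (hγ : -α < γ) {t : ℝ} (ht : 0 < t) {u v : Distr d}
    (hu : besovNorm p γ u < ⊤) (hv : besovNorm p γ v < ⊤) :
    Pm p α ν t (u - v) = Pm p α ν t u - Pm p α ν t v := by
  rw [Pm, Pm, Pm, ← (summable_bl_comp_U ν hspan hα hp hγ ht hu).tsum_sub
    (summable_bl_comp_U ν hspan hα hp hγ ht hv)]
  congr 1
  funext n
  rw [(hasBlocks_of_besovNorm hu).bl_sub (hasBlocks_of_besovNorm hv),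
    ContinuousLinearMap.sub_comp]

lemma semigroup_eq_rep {γ : ℝ} (hγ : 0 < γ) {t : ℝ} (ht : 0 ≤ t) {u : Distr d}
    (hu : besovNorm p γ u < ⊤) : semigroup p α ν t u = emb (rep p u ∘L U α ν t) := by
  rcases ht.eq_or_lt with rfl | ht
  · rw [semigroup, if_pos rfl, U_zero]
    exact (emb_rep hp hγ hu).symm
  · rw [semigroup_eq ν hspan hα hp (by linarith [hα.1] : -α < γ) ht hu]
    congr 1
    exact ((summable_bl hγ hu).hasSum.mapL
      ((ContinuousLinearMap.compL ℂ (L1 d) (L1 d) ℂ).flip (U α ν t))).tsum_eq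

/-- Time regularity of the semigroup on `B^θ_{∞,∞}`, in the uniform norm. -/
lemma norm_comp_U_sub_one {θ : ℝ} (h0 : 0 < θ) (h1 : θ < α) : ∃ C, 0 ≤ C ∧ ∀ (t : ℝ) (x : XD d),
    0 ≤ t → besovNorm p θ (emb x) < ⊤ →
      ‖x ∘L (U α ν t - 1)‖ ≤ C * t ^ (θ / α) * bn p θ (emb x) := by
  have hα0 : 0 < α := by linarith [hα.1]
  obtain ⟨C, hC, h⟩ := norm_bl_comp_U_sub_one ν hspan hα hp
  obtain ⟨C', hC', h'⟩ := sum_min_rpow_le (a := α - θ) (b := θ) (by linarith) h0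
  refine ⟨C * C', mul_nonneg hC hC', fun t x ht hx => ?_⟩
  rcases ht.eq_or_lt with rfl | ht
  · rw [U_zero, sub_self, ContinuousLinearMap.comp_zero, norm_zero]
    exact mul_nonneg (mul_nonneg (mul_nonneg hC hC') (Real.rpow_nonneg le_rfl _)) bn_nonneg
  have hs : HasSum (fun n => bl p n (emb x)) x := by
    have h2 := (summable_bl h0 hx).hasSum
    have h3 : rep p (emb x) = x := emb_injective (emb_rep hp h0 hx)
    rw [rep] at h3
    rwa [h3] at h2
  have hs' := hs.mapL ((ContinuousLinearMap.compL ℂ (L1 d) (L1 d) ℂ).flip (U α ν t - 1))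
  have hlim := hs'.tendsto_sum_nat
  refine le_of_tendsto hlim.norm (Filter.Eventually.of_forall fun M => ?_)
  set y := t ^ α⁻¹ with hy
  have hy0 : 0 < y := Real.rpow_pos_of_pos ht _
  have hyα : y ^ α = t := by rw [hy, ← Real.rpow_mul ht.le, inv_mul_cancel₀ hα0.ne', Real.rpow_one]
  have hyθ : t ^ (θ / α) = y ^ θ := by rw [hy, ← Real.rpow_mul ht.le]; congr 1; ring
  -- In the variable `y = t ^ (1 / α)` the terms become `y ^ θ` times a function of `y * lam n`; `0
  -- < θ < α` makes their sum bounded uniformly in `y`.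
  have key : ∀ n, min 1 (t * lam n ^ α) * lam n ^ (-θ) =
      y ^ θ * min ((y * lam n) ^ (α - θ)) ((y * lam n) ^ (-θ)) := by
    intro n
    have hl := lam_pos n
    have h5 : t * lam n ^ α = (y * lam n) ^ α := by rw [Real.mul_rpow hy0.le hl.le, hyα]
    have h6 : lam n ^ (-θ) = y ^ θ * (y * lam n) ^ (-θ) := by
      rw [Real.mul_rpow hy0.le hl.le, ← mul_assoc, ← Real.rpow_add hy0]; simp
    have h7 : (y * lam n) ^ (α - θ) = (y * lam n) ^ α * (y * lam n) ^ (-θ) := by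
      rw [← Real.rpow_add (by positivity)]; rfl
    have h8 : 0 ≤ (y * lam n) ^ (-θ) := Real.rpow_nonneg (by positivity) _
    rw [h6, h5, h7, mul_left_comm]
    congr 1
    rw [min_mul_of_nonneg _ _ h8, one_mul, min_comm]
  calc ‖∑ n ∈ Finset.range M, ((ContinuousLinearMap.compL ℂ (L1 d) (L1 d) ℂ).flip
        (U α ν t - 1)) (bl p n (emb x))‖
      ≤ ∑ n ∈ Finset.range M, C * bn p θ (emb x) * (y ^ θ *
          min ((y * lam n) ^ (α - θ)) ((y * lam n) ^ (-θ))) := by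
        refine (norm_sum_le _ _).trans (Finset.sum_le_sum fun n _ => ?_)
        rw [← key]
        refine (h t n _ ht.le (hasBlocks_emb hp x)).trans ?_
        have h9 : 0 ≤ C * min 1 (t * lam n ^ α) := mul_nonneg hC (le_min zero_le_one
          (mul_nonneg ht.le (Real.rpow_nonneg (lam_pos n).le _)))
        refine (mul_le_mul_of_nonneg_left (norm_bl_le hx n) h9).trans (le_of_eq ?_)
        ring
    _ = C * bn p θ (emb x) * y ^ θ * ∑ n ∈ Finset.range M,
          min ((y * lam n) ^ (α - θ)) ((y * lam n) ^ (-θ)) := by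
        rw [Finset.mul_sum]
        exact Finset.sum_congr rfl fun n _ => by ring
    _ ≤ C * bn p θ (emb x) * y ^ θ * C' := by
        refine mul_le_mul_of_nonneg_left (h' y hy0 M) ?_
        exact mul_nonneg (mul_nonneg hC bn_nonneg) (Real.rpow_nonneg hy0.le _)
    _ = _ := by rw [hyθ]; ring

lemma besovNorm_Pm_le (T : ℝ) {κ : ℝ} (h0 : 0 ≤ κ) (h1 : κ ≤ 1) {γ : ℝ} (hγ : -α < γ) :
    ∃ C, 0 ≤ C ∧ ∀ (t : ℝ) (u : Distr d), 0 < t → t ≤ T → besovNorm p γ u < ⊤ →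
      besovNorm p (γ + α * κ) (emb (Pm p α ν t u)) ≤ ENNReal.ofReal (C * t ^ (-κ) * bn p γ u) := by
  obtain ⟨C, hC, h⟩ := norm_bl_comp_U_besov ν hspan hα hp T h0 h1 γ
  refine ⟨C, hC, fun t u ht htT hu => besovNorm_le fun n => ⟨_, ?_, h t n u ht htT hu⟩⟩
  rw [← Pm_comp_block ν hspan hα hp hγ ht hu, block_emb hp]

/-- Half of the time is spent on reaching the positive regularity `γ + α < α`; from there the
semigroup is Hölder continuous in the uniform norm with exponent `(γ + α) / α`. -/
lemma continuousOn_Pm {γ : ℝ} (hγ : -α < γ) (hγ' : γ < 0) {u : Distr d}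
    (hu : besovNorm p γ u < ⊤) : ContinuousOn (fun r => Pm p α ν r u) (Ioi 0) := by
  intro r hr
  refine ContinuousAt.continuousWithinAt ?_
  have hr : 0 < r := hr
  have hα0 : 0 < α := by linarith [hα.1]
  obtain ⟨CU, hCU, hU⟩ := norm_U_le ν hspan hα
  obtain ⟨C1, hC1, h1⟩ := besovNorm_Pm_le ν hspan hα hp r zero_le_one le_rfl hγ
  obtain ⟨C2, hC2, h2⟩ := norm_comp_U_sub_one ν hspan hα hp (θ := γ + α * 1) (by linarith)
    (by linarith)
  set e := r / 2 with he
  have he0 : 0 < e := by positivity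
  set y := Pm p α ν e u with hy
  have hyb : besovNorm p (γ + α * 1) (emb y) < ⊤ :=
    (h1 e u he0 (by linarith) hu).trans_lt ENNReal.ofReal_lt_top
  set B := CU * (C2 * bn p (γ + α * 1) (emb y)) with hB
  set σ := (γ + α * 1) / α with hσ
  have hσ0 : 0 < σ := div_pos (by linarith) hα0
  have key : ∀ a b : ℝ, 0 ≤ a → a ≤ b → ‖y ∘L U α ν b - y ∘L U α ν a‖ ≤ B * |b - a| ^ σ := by
    intro a b ha hab
    have e1 : y ∘L U α ν b - y ∘L U α ν a = (y ∘L (U α ν (b - a) - 1)) ∘L U α ν a := by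
      have : b = (b - a) + a := by ring
      conv_lhs => rw [this, U_add ν hspan hα (by linarith) ha]
      ext f
      simp
    rw [e1, abs_of_nonneg (by linarith)]
    refine (ContinuousLinearMap.opNorm_comp_le _ _).trans ?_
    have h3 := h2 (b - a) y (by linarith) hyb
    calc ‖y ∘L (U α ν (b - a) - 1)‖ * ‖U α ν a‖
        ≤ (C2 * (b - a) ^ σ * bn p (γ + α * 1) (emb y)) * CU :=
          mul_le_mul h3 (hU a ha) (norm_nonneg _) ((norm_nonneg _).trans h3)
      _ = _ := by rw [hB]; ring
  have hform : ∀ s, e < s → Pm p α ν s u = y ∘L U α ν (s - e) := fun s hs => by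
    rw [hy, ← Pm_add ν hspan hα hp hγ he0 (by linarith) hu]
    congr 1
    ring
  have hbd : ∀ᶠ s in 𝓝 r, dist (Pm p α ν s u) (Pm p α ν r u) ≤ B * |s - r| ^ σ := by
    filter_upwards [lt_mem_nhds (by linarith : e < r)] with s hs
    rw [dist_eq_norm, hform s hs, hform r (by linarith)]
    rcases le_total r s with h | h
    · have := key (r - e) (s - e) (by linarith) (by linarith)
      rwa [sub_sub_sub_cancel_right] at this
    · have := key (s - e) (r - e) (by linarith) (by linarith)
      rw [sub_sub_sub_cancel_right] at this
      rwa [norm_sub_rev, abs_sub_comm]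
  have hlim : Tendsto (fun s => B * |s - r| ^ σ) (𝓝 r) (𝓝 0) := by
    have : Tendsto (fun s => B * |s - r| ^ σ) (𝓝 r) (𝓝 (B * |r - r| ^ σ)) := by
      refine ContinuousAt.tendsto (f := fun s => B * |s - r| ^ σ) ?_
      exact continuousAt_const.mul (ContinuousAt.rpow_const (by fun_prop) (Or.inr hσ0.le))
    simpa [hσ0.ne'] using this
  exact tendsto_iff_dist_tendsto_zero.2
    (squeeze_zero' (Filter.Eventually.of_forall fun _ => dist_nonneg) hbd hlim)

end Semigroup

/-! ### Products of bounded functions and their spectra -/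

/-- Multiplication by a bounded function on `L^1`. -/
def mulOp (h : LI d) : L1 d →L[ℂ] L1 d :=
  (ContinuousLinearMap.mul ℂ ℂ).holderL volume ∞ 1 1 h

lemma coeFn_mulOp (h : LI d) (f : L1 d) : mulOp h f =ᵐ[volume] fun x => h x * f x :=
  (ContinuousLinearMap.mul ℂ ℂ).coeFn_holder h f

lemma norm_mulOp_le (h : LI d) : ‖mulOp h‖ ≤ ‖h‖ := by
  refine ContinuousLinearMap.opNorm_le_bound _ (norm_nonneg _) fun f => ?_
  refine (ContinuousLinearMap.norm_holder_apply_apply_le _ h f).trans ?_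
  have := ContinuousLinearMap.opNorm_mul_le ℂ ℂ
  gcongr
  nlinarith [norm_nonneg h]

/-- The product of two bounded functions, on the dual side. -/
def mulX (g h : XD d) : XD d := g ∘L mulOp (fn h)

lemma norm_mulX_le (g h : XD d) : ‖mulX g h‖ ≤ ‖g‖ * ‖h‖ := by
  refine (ContinuousLinearMap.opNorm_comp_le _ _).trans ?_
  refine mul_le_mul_of_nonneg_left ((norm_mulOp_le _).trans_eq (norm_fn h)) (norm_nonneg _)

lemma mulX_sub_left (g g' h : XD d) : mulX (g - g') h = mulX g h - mulX g' h :=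
  ContinuousLinearMap.sub_comp _ _ _

lemma mulX_sub_right (g h h' : XD d) : mulX g (h - h') = mulX g h - mulX g h' := by
  rw [mulX, mulX, mulX, fn, map_sub, mulOp, map_sub, ContinuousLinearMap.comp_sub]
  rfl

lemma ofBounded_mul (g h : XD d) :
    ofBounded (fun x => (fn g : Rd d → ℂ) x * (fn h : Rd d → ℂ) x) = emb (mulX g h) := by
  have hL : MemLp (fun x => (fn g : Rd d → ℂ) x * (fn h : Rd d → ℂ) x) ∞ volume :=
    MemLp.mul (Lp.memLp (fn h)) (Lp.memLp (fn g))
  rw [ofBounded_eq hL]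
  congr 1
  ext f
  rw [mulX, ContinuousLinearMap.comp_apply]
  conv_rhs => rw [← pairL_fn g]
  rw [pairL_apply, pairL_apply]
  refine integral_congr_ae ?_
  filter_upwards [hL.coeFn_toLp, coeFn_mulOp (fn h) f] with x h1 h2
  rw [h1, h2, mul_assoc]

/-- The spectrum of a product is contained in the sum of the spectra. -/
lemma mulX_comp_op_eq_zero {g h : XD d} {a b c : Rd d → ℂ} {A B C : ℝ} (ha : IsMul a A)
    (hb : IsMul b B) (hc : IsMul c C) (hg : g ∘L op a = g) (hh : h ∘L op b = h)
    (habc : ∀ ξ η, a ξ * b η * c (ξ + η) = 0) : mulX g h ∘L op c = 0 := by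
  ext f
  simp only [ContinuousLinearMap.comp_apply, mulX, zero_apply]
  set f1 := op c f with hf1
  -- It suffices that the product `h f1` carries no frequency `ξ` with `a ξ ≠ 0`. Its value at `ξ`
  -- is `h` applied to `f1` modulated by `ξ`; modulation shifts frequencies, so `b` annihilates that
  -- function by `habc`.
  have key : op a (mulOp (fn h) f1) = 0 := by
    refine L1_ext fun ξ => ?_
    rw [ha.hasSymbol, map_zero]
    by_cases haξ : a ξ = 0
    · rw [haξ, zero_mul]
    have hmod : ∀ η, fi η (mulOp (chr ξ) f1) = fi (ξ + η) f1 := fun η => by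
      rw [fi_apply, fi_apply]
      refine integral_congr_ae ?_
      filter_upwards [coeFn_mulOp (chr ξ) f1, coeFn_chr ξ] with x h1 h2
      rw [h1, h2, chrF_add_left]
      ring
    have h0 : op b (mulOp (chr ξ) f1) = 0 := by
      refine L1_ext fun η => ?_
      rw [hb.hasSymbol, hmod, hf1, hc.hasSymbol, map_zero, ← mul_assoc]
      have := habc ξ η
      rw [mul_assoc] at this
      rw [(mul_eq_zero.1 this).resolve_left haξ, zero_mul]
    have h1 : fi ξ (mulOp (fn h) f1) = h (mulOp (chr ξ) f1) := by
      conv_rhs => rw [← pairL_fn h]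
      rw [fi_apply, pairL_apply]
      refine integral_congr_ae ?_
      filter_upwards [coeFn_mulOp (chr ξ) f1, coeFn_chr ξ, coeFn_mulOp (fn h) f1] with x h1 h2 h3
      rw [h1, h2, h3]
      ring
    rw [h1, ← hh, ContinuousLinearMap.comp_apply, h0, map_zero, mul_zero]
  rw [← hg, ContinuousLinearMap.comp_apply, key, map_zero]

/-- A smooth cutoff between a compact set and a thickening of it. -/
lemma exists_cutoff {S : Set (Rd d)} (hS : IsCompact S) {δ : ℝ} (hδ : 0 < δ) :
    ∃ a : Rd d → ℂ, HasCompactSupport a ∧ ContDiff ℝ ∞ a ∧ (∀ z ∈ S, a z = 1) ∧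
      ∀ z, a z ≠ 0 → z ∈ Metric.thickening δ S := by
  have hdisj : Disjoint (Metric.thickening δ S)ᶜ S :=
    Set.disjoint_left.2 fun z hz hzS => hz (Metric.self_subset_thickening hδ S hzS)
  obtain ⟨f, hf0, hf1, -⟩ := exists_contMDiffMap_zero_one_of_isClosed (n := (⊤ : ℕ∞))
    (modelWithCornersSelf ℝ (Rd d)) Metric.isOpen_thickening.isClosed_compl hS.isClosed hdisj
  have hsupp : ∀ z, (f z : ℂ) ≠ 0 → z ∈ Metric.thickening δ S := fun z hz => by
    by_contra hn
    exact hz (by rw [hf0 hn]; simp)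
  refine ⟨fun z => (f z : ℂ), ?_, Complex.ofRealCLM.contDiff.comp f.contMDiff.contDiff,
    fun z hz => by simp only [hf1 hz, Pi.one_apply, Complex.ofReal_one], hsupp⟩
  obtain ⟨R, hR⟩ := hS.isBounded.thickening (δ := δ) |>.subset_closedBall 0
  refine HasCompactSupport.intro (isCompact_closedBall (0 : Rd d) R) fun z hz => ?_
  by_contra hn
  exact hz (hR (hsupp z hn))

section Partition

variable {p : ℕ → Rd d → ℝ} (hp : IsDyadicPartition p)
include hp

/-- The annulus `{2^{-M} ≲ |y| ≲ 2^M}`, smoothly cut off. -/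
def ann (p : ℕ → Rd d → ℝ) (M : ℕ) (y : Rd d) : ℂ :=
  (p 0 (((2 : ℝ) ^ M)⁻¹ • y) : ℂ) - (p 0 ((2 : ℝ) ^ M • y) : ℂ)

lemma hasTemperateGrowth_ann (M : ℕ) (r : ℝ) :
    (fun z => ann p M (r • z)).HasTemperateGrowth := by
  have h1 := hp.hasTemperateGrowth_cut (((2 : ℝ) ^ M)⁻¹ * r)
  have h2 := hp.hasTemperateGrowth_cut ((2 : ℝ) ^ M * r)
  simp only [ann, smul_smul]
  exact h1.sub h2

lemma isMul_ann (M : ℕ) : ∃ C, ∀ r : ℝ, IsMul (fun z => ann p M (r • z)) C := by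
  obtain ⟨C, hC⟩ := hp.isMul_cut
  refine ⟨C + C, fun r => ((hC (((2 : ℝ) ^ M)⁻¹ * r)).sub (hC ((2 : ℝ) ^ M * r))).congr
    fun z => ?_⟩
  simp only [ann, smul_smul]

lemma hasCompactSupport_ann (M : ℕ) : HasCompactSupport (ann p M) := by
  have h1 : HasCompactSupport fun w : Rd d => (p 0 (((2 : ℝ) ^ M)⁻¹ • w) : ℂ) :=
    (hp.hasCompactSupport_ofReal 0).comp_smul (by positivity)
  have h2 : HasCompactSupport fun w : Rd d => (p 0 ((2 : ℝ) ^ M • w) : ℂ) :=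
    (hp.hasCompactSupport_ofReal 0).comp_smul (by positivity)
  exact h1.sub h2

lemma contDiff_ann (M : ℕ) : ContDiff ℝ ∞ (ann p M) := by
  simpa using (hasTemperateGrowth_ann hp M 1).1

lemma ann_div_contDiff (M : ℕ) :
    ContDiff ℝ ∞ fun w => (((‖w‖ ^ 2)⁻¹ : ℝ) : ℂ) * ann p M w := by
  obtain ⟨a, ha, ha1⟩ := hp.eq_one_near
  rw [contDiff_iff_contDiffAt]
  intro w
  rcases eq_or_ne w 0 with rfl | hw
  · have : (fun w => (((‖w‖ ^ 2)⁻¹ : ℝ) : ℂ) * ann p M w) =ᶠ[𝓝 0] fun _ => 0 := by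
      have hpos : 0 < a / 2 ^ M := by positivity
      filter_upwards [Metric.ball_mem_nhds (0 : Rd d) hpos] with w hw
      rw [mem_ball_zero_iff, lt_div_iff₀ (by positivity)] at hw
      have h2M : (1 : ℝ) ≤ 2 ^ M := one_le_pow₀ (by norm_num)
      have hinv : ((2 : ℝ) ^ M)⁻¹ ≤ 2 ^ M := (inv_le_one_of_one_le₀ h2M).trans h2M
      have h1 : p 0 (((2 : ℝ) ^ M)⁻¹ • w) = 1 := ha1 _ (by
        rw [norm_smul, Real.norm_of_nonneg (by positivity)]
        nlinarith [norm_nonneg w])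
      have h2 : p 0 ((2 : ℝ) ^ M • w) = 1 := ha1 _ (by
        rw [norm_smul, Real.norm_of_nonneg (by positivity)]; linarith)
      simp [ann, h1, h2]
    exact contDiffAt_const.congr_of_eventuallyEq this
  · have h1 : ContDiffAt ℝ ∞ (fun w : Rd d => (‖w‖ ^ 2)⁻¹) w :=
      (contDiff_norm_sq ℝ).contDiffAt.inv (by simpa using hw)
    exact (Complex.ofRealCLM.contDiff.contDiffAt.comp w h1).mul (contDiff_ann hp M).contDiffAt

/-- The products in a paraproduct are localized in annuli. -/
lemma mulX_bl_localized : ∃ M : ℕ, ∀ (m n : ℕ) (u v : Distr d), m + 1 < n → HasBlocks p u →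
    HasBlocks p v →
      (mulX (bl p m u) (bl p n v) ∘L op fun z => ann p M (((2 : ℝ) ^ n)⁻¹ • z)) =
        mulX (bl p m u) (bl p n v) := by
  obtain ⟨a0, ha0, ha1⟩ := hp.eq_one_near
  obtain ⟨R, hR, hfar⟩ := hp.eq_zero_far
  have hS0 : IsCompact (tsupport (p 0)) := hp.compact_support 0
  have hS2 : IsCompact (tsupport (p 2)) := hp.compact_support 2
  -- The supports of `p 0` and `p 2` are a positive distance apart, and that of `p 0` is symmetric.
  -- A small sum `ξ + η` would put `η` close to `-ξ`, hence close to both supports. This yields the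
  -- inner radius of the annulus.
  obtain ⟨δ, hδ, hdis⟩ := (hp.disjoint 0 2 (by norm_num)).exists_thickenings hS0 hS2.isClosed
  obtain ⟨a, hac, has, haS, hat⟩ := exists_cutoff hS0 (half_pos hδ)
  obtain ⟨b, hbc, hbs, hbS, hbt⟩ := exists_cutoff hS2 (half_pos hδ)
  have hneg : ∀ z, z ∈ tsupport (p 0) → -z ∈ tsupport (p 0) := by
    have h1 : (fun z : Rd d => -z) ⁻¹' tsupport (p 0) = tsupport (p 0) := by
      have := tsupport_comp_eq_preimage (p 0) (Homeomorph.neg (Rd d))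
      have h2 : p 0 ∘ (Homeomorph.neg (Rd d)) = p 0 := funext fun z => hp.neg 0 z
      rw [h2] at this
      exact this.symm
    intro z hz
    rw [← h1] at hz
    exact hz
  obtain ⟨R1, hR1⟩ := hac.isBounded.subset_closedBall 0
  obtain ⟨R2, hR2⟩ := hbc.isBounded.subset_closedBall 0
  have hbound : ∀ ξ η, a ξ ≠ 0 → b η ≠ 0 → δ / 2 ≤ ‖ξ + η‖ ∧ ‖ξ + η‖ ≤ R1 + R2 := by
    intro ξ η hξ hη
    constructor
    · by_contra hlt
      rw [not_le] at hlt
      obtain ⟨x, hx, hxd⟩ := Metric.mem_thickening_iff.1 (hat ξ hξ)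
      have h1 : η ∈ Metric.thickening δ (tsupport (p 0)) := by
        refine Metric.mem_thickening_iff.2 ⟨-x, hneg x hx, ?_⟩
        rw [dist_eq_norm] at hxd ⊢
        calc ‖η - -x‖ = ‖(ξ + η) - (ξ - x)‖ := by congr 1; abel
          _ ≤ ‖ξ + η‖ + ‖ξ - x‖ := norm_sub_le _ _
          _ < δ := by linarith
      have h2 : η ∈ Metric.thickening δ (tsupport (p 2)) :=
        Metric.thickening_mono (by linarith) _ (hbt η hη)
      exact Set.disjoint_left.1 hdis h1 h2
    · have h1 := hR1 (subset_tsupport _ hξ)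
      have h2 := hR2 (subset_tsupport _ hη)
      rw [mem_closedBall_zero_iff] at h1 h2
      exact (norm_add_le _ _).trans (add_le_add h1 h2)
  -- `M1` makes the outer cutoff one and `M2` makes the inner one zero on the relevant sums. The
  -- factor `8` combines the ratio `4` of the scales `2 ^ n` and `2 ^ k` with the lower bound `δ /
  -- 2`.
  obtain ⟨M1, hM1⟩ := pow_unbounded_of_one_lt ((R1 + R2) / a0) one_lt_two
  obtain ⟨M2, hM2⟩ := pow_unbounded_of_one_lt (R * 8 / δ) one_lt_two
  set M := max M1 M2 with hM
  have hM1' : (R1 + R2) / a0 < 2 ^ M := hM1.trans_le (pow_le_pow_right₀ (by norm_num) (le_max_left _ _))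
  have hM2' : R * 8 / δ < 2 ^ M := hM2.trans_le (pow_le_pow_right₀ (by norm_num) (le_max_right _ _))
  refine ⟨M, fun m n u v hmn hu hv => ?_⟩
  obtain ⟨k, rfl⟩ : ∃ k, n = k + 2 := ⟨n - 2, by omega⟩
  -- At scale `2 ^ k`, with `n = k + 2` and `m ≤ k`, the piece `p n` is a rescaled `p 2`, and `p m`
  -- lives where the rescaled `p 0` is positive: every pair reduces to one model configuration.
  set r : ℝ := ((2 : ℝ) ^ k)⁻¹ with hr
  have hr0 : 0 < r := by positivity
  obtain ⟨Ca, hCa⟩ := isMul_of_contDiff hac has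
  obtain ⟨Cb, hCb⟩ := isMul_of_contDiff hbc hbs
  obtain ⟨Cm, hCm⟩ := isMul_ann hp M
  have hg : bl p m u ∘L op (fun z => a (r • z)) = bl p m u := by
    refine bl_comp_op hp (hCa r) ((hac.hasTemperateGrowth has).comp (by fun_prop)) hu m
      fun z => ?_
    by_cases hz : p m z = 0
    · simp [hz]
    · have h1 : p 0 (r • z) ≠ 0 := by
        rw [hr, ← hp.sum_range]
        refine (lt_of_lt_of_le (lt_of_le_of_ne (hp.nonneg' m z) (Ne.symm hz)) ?_).ne'
        exact Finset.single_le_sum (f := fun m => p m z) (fun i _ => hp.nonneg' i z)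
          (Finset.mem_range.2 (by omega))
      rw [haS _ (subset_tsupport _ h1), one_mul]
  have hh : bl p (k + 2) v ∘L op (fun z => b (r • z)) = bl p (k + 2) v := by
    refine bl_comp_op hp (hCb r) ((hbc.hasTemperateGrowth hbs).comp (by fun_prop)) hv _
      fun z => ?_
    by_cases hz : p (k + 2) z = 0
    · simp [hz]
    · have h1 : p 2 (r • z) ≠ 0 := by
        have : p (k + 2) z = p 2 (r • z) := by
          rw [hp.scaling (k + 1), hp.scaling 1, smul_smul, hr, ← mul_inv, pow_succ, pow_one,
            mul_comm]
        rwa [← this]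
      rw [hbS _ (subset_tsupport _ h1), one_mul]
  set s : ℝ := ((2 : ℝ) ^ (k + 2))⁻¹ with hs
  have hsr : s = r / 4 := by rw [hs, hr, pow_add, mul_inv]; norm_num; ring
  have hzero := mulX_comp_op_eq_zero (hCa r) (hCb r) (IsMul.one.sub (hCm s)) hg hh fun ξ η => by
    by_cases h1 : a (r • ξ) = 0
    · simp [h1]
    by_cases h2 : b (r • η) = 0
    · simp [h2]
    obtain ⟨h3, h4⟩ := hbound _ _ h1 h2
    rw [← smul_add, norm_smul, Real.norm_of_nonneg hr0.le] at h3 h4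
    have e1 : p 0 (((2 : ℝ) ^ M)⁻¹ • s • (ξ + η)) = 1 := by
      refine ha1 _ ?_
      rw [norm_smul, norm_smul, Real.norm_of_nonneg (by positivity),
        Real.norm_of_nonneg (by positivity), hsr, inv_mul_lt_iff₀ (by positivity)]
      rw [div_lt_iff₀ ha0] at hM1'
      have : 0 ≤ r * ‖ξ + η‖ := by positivity
      nlinarith
    have e2 : p 0 ((2 : ℝ) ^ M • s • (ξ + η)) = 0 := by
      refine (hfar _ ?_).1
      rw [norm_smul, norm_smul, Real.norm_of_nonneg (by positivity),
        Real.norm_of_nonneg (by positivity), hsr]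
      rw [div_lt_iff₀ hδ] at hM2'
      have h5 : (0 : ℝ) < 2 ^ M := by positivity
      nlinarith [mul_le_mul_of_nonneg_left h3 h5.le]
    rw [ann, e1, e2]
    simp
  have hop : op (fun z => 1 - ann p M (s • z)) = 1 - op (fun z => ann p M (s • z)) :=
    (HasSymbol.one.sub (hCm s).hasSymbol).op_eq
  rw [hop, ContinuousLinearMap.comp_sub, sub_eq_zero] at hzero
  exact hzero.symm

/-- Derivatives, block by block. -/
lemma exists_bl_deriv (e : Rd d) : ∃ C, 0 ≤ C ∧ ∀ (n : ℕ) (u : Distr d), HasBlocks p u →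
    ∃ x : XD d, emb x = block p n (∂_{e} u) ∧ ‖x‖ ≤ C * lam n * ‖bl p n u‖ := by
  have h1 : HasCompactSupport fun z => (inner ℝ z e : ℂ) * (p 0 z : ℂ) :=
    (hp.hasCompactSupport_ofReal 0).mul_left
  have hin : (fun z : Rd d => ((inner ℝ z e : ℝ) : ℂ)).HasTemperateGrowth := by fun_prop
  obtain ⟨C, hC⟩ := isMul_of_contDiff h1 (hin.1.mul (hp.contDiff_ofReal 0))
  have hC0 : 0 ≤ C := (hC 1).nonneg
  refine ⟨2 * Real.pi * (4 * C), by positivity, fun n u hu => ?_⟩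
  -- The smallest scale at which `mul_cut` lets the cutoff be inserted on block `n`; it equals `4 *
  -- lam n`.
  set s : ℝ := (2 : ℝ) ^ (n + 1) with hs
  have hs0 : 0 < s := by positivity
  have hsl : s = 4 * lam n := by rw [hs, lam_eq, pow_succ]; ring
  set m : Rd d → ℂ := fun z => (inner ℝ z e : ℂ) * (p 0 (s⁻¹ • z) : ℂ) with hm
  have hmm : IsMul m (s * C) := by
    refine (((hC s⁻¹).const_mul (s : ℂ)).congr fun z => ?_).mono (le_of_eq ?_)
    · have : (s : ℂ) ≠ 0 := by exact_mod_cast hs0.ne'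
      simp only [hm, real_inner_smul_left]
      push_cast
      rw [← mul_assoc, ← mul_assoc, mul_inv_cancel₀ this, one_mul]
    · rw [Complex.norm_real, Real.norm_of_nonneg hs0.le]
  have hmt : m.HasTemperateGrowth := hin.mul (hp.hasTemperateGrowth_cut s⁻¹)
  refine ⟨(2 * Real.pi * Complex.I : ℂ) • (bl p n u ∘L op m), ?_, ?_⟩
  · rw [map_smul, emb_bl_comp_op hp hmm hmt hu, block_eq,
      TemperedDistribution.lineDeriv_eq_fourierMultiplierCLM, map_smul,
      TemperedDistribution.fourierMultiplierCLM_fourierMultiplierCLM_apply hin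
        (hp.hasTemperateGrowth n)]
    congr 3
    funext z
    simp only [hm, Pi.mul_apply]
    rw [mul_assoc, ← Complex.ofReal_mul, mul_comm (p 0 _), hp.mul_cut le_rfl]
  · rw [norm_smul]
    have h2 : ‖(2 * Real.pi * Complex.I : ℂ)‖ = 2 * Real.pi := by
      simp [abs_of_pos Real.pi_pos]
    rw [h2]
    calc 2 * Real.pi * ‖bl p n u ∘L op m‖ ≤ 2 * Real.pi * (‖bl p n u‖ * (s * C)) := by
          refine mul_le_mul_of_nonneg_left ?_ (by positivity)
          exact (ContinuousLinearMap.opNorm_comp_le _ _).trans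
            (mul_le_mul_of_nonneg_left hmm.norm_le (norm_nonneg _))
      _ = _ := by rw [hsl]; ring

lemma besovNorm_deriv_le (γ : ℝ) (e : Rd d) : ∃ C, 0 ≤ C ∧ ∀ u : Distr d, besovNorm p γ u < ⊤ →
    besovNorm p (γ - 1) (∂_{e} u) ≤ ENNReal.ofReal (C * bn p γ u) := by
  obtain ⟨C, hC, h⟩ := exists_bl_deriv hp e
  refine ⟨C, hC, fun u hu => besovNorm_le fun n => ?_⟩
  obtain ⟨x, hx, hn⟩ := h n u (hasBlocks_of_besovNorm hu)
  refine ⟨x, hx, hn.trans ?_⟩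
  have h2 : 0 ≤ C * lam n := mul_nonneg hC (lam_pos n).le
  refine (mul_le_mul_of_nonneg_left (norm_bl_le hu n) h2).trans (le_of_eq ?_)
  rw [show -(γ - 1) = 1 + -γ by ring, Real.rpow_add (lam_pos n), Real.rpow_one]
  ring

end Partition

/-! ### Convergence of Bony's decomposition -/

section AnnulusSeries

variable {p : ℕ → Rd d → ℝ} (hp : IsDyadicPartition p)
include hp

/-- Series of functions localized in dyadic annuli converge as distributions. -/
lemma annulus_series (M : ℕ) {s : ℝ} (hs0 : 0 < s) (hs2 : s < 2) : ∃ C, 0 ≤ C ∧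
    ∀ (S : ℕ → XD d) (A : ℝ), 0 ≤ A →
      (∀ n, (S n ∘L op fun z => ann p M (((2 : ℝ) ^ n)⁻¹ • z)) = S n) →
      (∀ n, ‖S n‖ ≤ A * lam n ^ s) →
      Summable (fun n => emb (S n)) ∧
        besovNorm p (-s) (∑' n, emb (S n)) ≤ ENNReal.ofReal (C * A) := by
  set κ : Rd d → ℂ := fun w => (((‖w‖ ^ 2)⁻¹ : ℝ) : ℂ) * ann p M w with hκ
  have hκc : HasCompactSupport κ := (hasCompactSupport_ann hp M).mul_left
  have hκs : ContDiff ℝ ∞ κ := ann_div_contDiff hp M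
  obtain ⟨C1, hC1⟩ := isMul_of_contDiff hκc hκs
  obtain ⟨C2, hC2⟩ := isMul_ann hp M
  obtain ⟨C3, hC3⟩ := hp.isMul_block
  have hC3' : 0 ≤ C3 := (hC3 0).nonneg
  obtain ⟨C4, hC4, hsum⟩ := sum_lam_le hs0
  have hsq : (fun z : Rd d => ((‖z‖ ^ 2 : ℝ) : ℂ)).HasTemperateGrowth := by fun_prop
  refine ⟨C3 * C4 * ((2 : ℝ) ^ M) ^ s, by positivity, fun S A hA hloc hS => ?_⟩
  -- The terms may grow, so the series need not converge in `L^∞`. On an annulus one can divide by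
  -- `‖z‖²` and gain `4 ^ (-n)`; since `s < 2` the divided series converges absolutely, and
  -- multiplication of the transform by `‖z‖²` is continuous on distributions.
  have hemb : ∀ n, emb (S n) = TemperedDistribution.fourierMultiplierCLM ℂ
      (fun z : Rd d => ((‖z‖ ^ 2 : ℝ) : ℂ))
      (emb ((((4 : ℝ) ^ n)⁻¹ : ℂ) • (S n ∘L op fun z => κ (((2 : ℝ) ^ n)⁻¹ • z)))) := by
    intro n
    have hκt : (fun z : Rd d => κ (((2 : ℝ) ^ n)⁻¹ • z)).HasTemperateGrowth :=
      (hκc.hasTemperateGrowth hκs).comp (by fun_prop)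
    rw [map_smul, map_smul, ← fourierMultiplier_emb (hC1 _) hκt,
      TemperedDistribution.fourierMultiplierCLM_fourierMultiplierCLM_apply hκt hsq]
    conv_lhs => rw [← hloc n, ← fourierMultiplier_emb (hC2 _) (hasTemperateGrowth_ann hp M _)]
    rw [← smul_apply, ← TemperedDistribution.fourierMultiplierCLM_smul (hκt.mul hsq)]
    congr 2
    funext z
    simp only [Pi.smul_apply, Pi.mul_apply, hκ, smul_eq_mul, norm_smul, norm_inv, norm_pow,
      Real.norm_ofNat]
    rcases eq_or_ne z 0 with rfl | hz
    · simp [ann]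
    · have hz' : (‖z‖ : ℂ) ≠ 0 := by simpa using hz
      have h4 : (4 : ℂ) ^ n = ((2 : ℂ) ^ n) ^ 2 := by
        rw [← pow_mul, mul_comm, pow_mul]; norm_num
      push_cast
      rw [h4]
      field_simp
  have hsx : Summable fun n =>
      ((((4 : ℝ) ^ n)⁻¹ : ℂ) • (S n ∘L op fun z => κ (((2 : ℝ) ^ n)⁻¹ • z)) : XD d) := by
    refine Summable.of_norm_bounded (g := fun n => A * C1 * lam n ^ (s - 2))
      ((summable_lam (by linarith)).mul_left _) fun n => ?_
    rw [norm_smul]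
    have h4 : ‖(((4 : ℝ) ^ n)⁻¹ : ℂ)‖ ≤ lam n ^ (-2 : ℝ) := by
      have : lam n ^ (-2 : ℝ) = 4 * ((4 : ℝ) ^ n)⁻¹ := by
        rw [Real.rpow_neg (lam_pos n).le]
        have e2 : lam n ^ (2 : ℝ) = lam n ^ 2 := by norm_cast
        rw [e2, lam_eq, div_pow, ← pow_mul, mul_comm n 2, pow_mul]
        norm_num
        ring
      rw [this]
      simp only [norm_inv, norm_pow, Complex.norm_real, Real.norm_ofNat]
      have : 0 < ((4 : ℝ) ^ n)⁻¹ := by positivity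
      linarith
    have h5 : ‖S n ∘L op fun z => κ (((2 : ℝ) ^ n)⁻¹ • z)‖ ≤ (A * lam n ^ s) * C1 :=
      (ContinuousLinearMap.opNorm_comp_le _ _).trans (mul_le_mul (hS n) (hC1 _).norm_le
        (norm_nonneg _) (mul_nonneg hA (Real.rpow_nonneg (lam_pos n).le _)))
    refine (mul_le_mul h4 h5 (norm_nonneg _) (Real.rpow_nonneg (lam_pos n).le _)).trans
      (le_of_eq ?_)
    rw [show s - 2 = s + -2 by ring, Real.rpow_add (lam_pos n)]
    ring
  have hS1 : Summable fun n => emb (S n) := by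
    simp only [hemb]
    exact ((hsx.hasSum.map (emb : XD d →ₗ[ℂ] Distr d) emb_continuous).mapL _).summable
  refine ⟨hS1, besovNorm_le fun k => ?_⟩
  have hblk := hS1.hasSum.mapL (TemperedDistribution.fourierMultiplierCLM ℂ
    fun z : Rd d => (p k z : ℂ))
  -- For such `n` both cutoffs forming the annulus are one on the support of `p k`, so their
  -- difference vanishes there.
  have hz : ∀ n, k + M + 1 ≤ n → (S n ∘L op fun z => (p k z : ℂ)) = 0 := by
    intro n hn
    have : op (fun z => ann p M (((2 : ℝ) ^ n)⁻¹ • z) * (p k z : ℂ)) = 0 := by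
      refine HasSymbol.op_eq fun f z => ?_
      obtain ⟨j, rfl⟩ : ∃ j, n = j + M := ⟨n - M, by omega⟩
      have e1 := hp.mul_cut (n := k) (N := j + M + M) (by omega) z
      have e2 := hp.mul_cut (n := k) (N := j) (by omega) z
      have e3 : ((2 : ℝ) ^ M)⁻¹ • ((2 : ℝ) ^ (j + M))⁻¹ • z = ((2 : ℝ) ^ (j + M + M))⁻¹ • z := by
        rw [smul_smul, ← mul_inv, ← pow_add]; congr 3; ring
      have e4 : (2 : ℝ) ^ M • ((2 : ℝ) ^ (j + M))⁻¹ • z = ((2 : ℝ) ^ j)⁻¹ • z := by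
        rw [smul_smul, pow_add]; congr 1; field_simp
      have e5 : ann p M (((2 : ℝ) ^ (j + M))⁻¹ • z) * (p k z : ℂ) = 0 := by
        rw [ann, e3, e4, ← Complex.ofReal_sub, ← Complex.ofReal_mul, mul_comm, mul_sub, e1, e2,
          sub_self, Complex.ofReal_zero]
      rw [e5, zero_apply, map_zero, zero_mul]
    rw [← hloc n, ContinuousLinearMap.comp_assoc, ← (hC2 _).op_mul (hC3 k), this,
      ContinuousLinearMap.comp_zero]
  refine ⟨∑ n ∈ Finset.range (k + M + 1), S n ∘L op fun z => (p k z : ℂ), ?_, ?_⟩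
  · rw [map_sum]
    refine HasSum.unique (hasSum_sum_of_ne_finset_zero fun n hn => ?_) (hblk.congr_fun fun n => ?_)
    · rw [hz n (by simpa using hn), map_zero]
    · rw [fourierMultiplier_emb (hC3 k) (hp.hasTemperateGrowth k)]
  · calc ‖∑ n ∈ Finset.range (k + M + 1), S n ∘L op fun z => (p k z : ℂ)‖
        ≤ ∑ n ∈ Finset.range (k + M + 1), C3 * A * lam n ^ s := by
          refine (norm_sum_le _ _).trans (Finset.sum_le_sum fun n _ => ?_)
          refine (ContinuousLinearMap.opNorm_comp_le _ _).trans ((mul_le_mul (hS n)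
            (hC3 k).norm_le (norm_nonneg _)
              (mul_nonneg hA (Real.rpow_nonneg (lam_pos n).le _))).trans (le_of_eq (by ring)))
      _ = C3 * A * ∑ n ∈ Finset.range (k + M + 1), lam n ^ s := by rw [Finset.mul_sum]
      _ ≤ C3 * A * (C4 * lam (k + M) ^ s) := by
          exact mul_le_mul_of_nonneg_left (hsum _) (by positivity)
      _ = _ := by
          have : lam (k + M) = lam k * 2 ^ M := by rw [lam_eq, lam_eq, pow_add]; ring
          rw [this, Real.mul_rpow (lam_pos k).le (by positivity), neg_neg]
          ring

/-- Absolutely convergent series of bounded functions, in spaces of negative regularity. -/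
lemma bounded_series {β δ : ℝ} (hβ : β < 0) (hδ : 0 < δ) : ∃ C, 0 ≤ C ∧
    ∀ (S : ℕ → XD d) (A : ℝ), 0 ≤ A → (∀ n, ‖S n‖ ≤ A * lam n ^ (-δ)) →
      Summable (fun n => emb (S n)) ∧
        besovNorm p β (∑' n, emb (S n)) ≤ ENNReal.ofReal (C * A) := by
  obtain ⟨C3, hC3⟩ := hp.isMul_block
  have hC3' : 0 ≤ C3 := (hC3 0).nonneg
  have hL := summable_lam (by linarith : -δ < 0)
  have hL0 : 0 ≤ ∑' n, lam n ^ (-δ) := tsum_nonneg fun n => Real.rpow_nonneg (lam_pos n).le _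
  refine ⟨2 ^ (-β) * (C3 * ∑' n, lam n ^ (-δ)), by positivity, fun S A hA hS => ?_⟩
  have h1 : Summable S := Summable.of_norm_bounded (hL.mul_left A) hS
  have h2 := h1.hasSum.map (emb : XD d →ₗ[ℂ] Distr d) emb_continuous
  have hn : ‖∑' n, S n‖ ≤ A * ∑' n, lam n ^ (-δ) := by
    rw [← tsum_mul_left]
    exact tsum_of_norm_bounded (hL.mul_left A).hasSum hS
  refine ⟨h2.summable, ?_⟩
  have h3 : ∑' n, emb (S n) = emb (∑' n, S n) := h2.tsum_eq
  rw [h3]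
  refine besovNorm_le fun k => ⟨_, (block_emb hp k _).symm, ?_⟩
  -- As `β < 0`, the weight is smallest at `k = 0`, where `lam 0 = 1/2`; a bounded function
  -- therefore has regularity `β`.
  have h4 : 1 ≤ lam k ^ (-β) * 2 ^ (-β) := by
    rw [← Real.mul_rpow (lam_pos k).le two_pos.le, mul_comm]
    exact Real.one_le_rpow (one_le_lam_mul k) (by linarith)
  calc ‖(∑' n, S n) ∘L op fun z => (p k z : ℂ)‖ ≤ (A * ∑' n, lam n ^ (-δ)) * C3 :=
        (ContinuousLinearMap.opNorm_comp_le _ _).trans (mul_le_mul hn (hC3 k).norm_le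
          (norm_nonneg _) (by positivity))
    _ ≤ (lam k ^ (-β) * 2 ^ (-β)) * ((A * ∑' n, lam n ^ (-δ)) * C3) :=
        le_mul_of_one_le_left (by positivity) h4
    _ = _ := by ring

end AnnulusSeries

/-- The terms of the paraproduct. -/
def paraT (p : ℕ → Rd d → ℝ) (u v : Distr d) (n : ℕ) : XD d :=
  ∑ m ∈ Finset.range (n - 1), mulX (bl p m u) (bl p n v)

/-- The terms of the resonant product. -/
def resoT (p : ℕ → Rd d → ℝ) (u v : Distr d) (n : ℕ) : XD d :=
  ∑ m ∈ Finset.Icc (n - 1) (n + 1), mulX (bl p m u) (bl p n v)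

section Product

variable {p : ℕ → Rd d → ℝ} {u u' v v' : Distr d}

lemma ofBounded_blocks (hu : HasBlocks p u) (hv : HasBlocks p v) (m n : ℕ) :
    ofBounded (fun x => linftyFun (block p m u) x * linftyFun (block p n v) x) =
      emb (mulX (bl p m u) (bl p n v)) := by
  rw [← hu.emb_bl, ← hv.emb_bl, linftyFun_emb, linftyFun_emb, ofBounded_mul]

lemma para_eq (hu : HasBlocks p u) (hv : HasBlocks p v) :
    para p u v = ∑' n, emb (paraT p u v n) := by
  simp only [para, paraT, map_sum, ofBounded_blocks hu hv]

lemma reso_eq (hu : HasBlocks p u) (hv : HasBlocks p v) :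
    reso p u v = ∑' n, emb (resoT p u v n) := by
  simp only [reso, resoT, map_sum, ofBounded_blocks hu hv]

lemma paraT_sub_left (hu : HasBlocks p u) (hu' : HasBlocks p u') (n : ℕ) :
    paraT p (u - u') v n = paraT p u v n - paraT p u' v n := by
  simp only [paraT, hu.bl_sub hu', mulX_sub_left, Finset.sum_sub_distrib]

lemma paraT_sub_right (hv : HasBlocks p v) (hv' : HasBlocks p v') (n : ℕ) :
    paraT p u (v - v') n = paraT p u v n - paraT p u v' n := by
  simp only [paraT, hv.bl_sub hv', mulX_sub_right, Finset.sum_sub_distrib]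

lemma resoT_sub_left (hu : HasBlocks p u) (hu' : HasBlocks p u') (n : ℕ) :
    resoT p (u - u') v n = resoT p u v n - resoT p u' v n := by
  simp only [resoT, hu.bl_sub hu', mulX_sub_left, Finset.sum_sub_distrib]

lemma resoT_sub_right (hv : HasBlocks p v) (hv' : HasBlocks p v') (n : ℕ) :
    resoT p u (v - v') n = resoT p u v n - resoT p u v' n := by
  simp only [resoT, hv.bl_sub hv', mulX_sub_right, Finset.sum_sub_distrib]

lemma norm_mulX_bl_le {β γ : ℝ} (hu : besovNorm p β u < ⊤) (hv : besovNorm p γ v < ⊤) (m n : ℕ) :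
    ‖mulX (bl p m u) (bl p n v)‖ ≤ bn p β u * bn p γ v * (lam m ^ (-β) * lam n ^ (-γ)) := by
  refine (norm_mulX_le _ _).trans ((mul_le_mul (norm_bl_le hu m) (norm_bl_le hv n)
    (norm_nonneg _) (mul_nonneg (Real.rpow_nonneg (lam_pos m).le _) bn_nonneg)).trans
      (le_of_eq (by ring)))

variable (hp : IsDyadicPartition p)
include hp

/-- The low frequencies of the rough factor add up to order `lam n ^ (-β)`, so the `n`-th term is of
order `lam n ^ (-(β + γ))`. The series converges absolutely in `L^∞`, which embeds in regularity
`β`. -/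
lemma exists_para_low {β γ : ℝ} (hβ : β < 0) (hβγ : 0 < β + γ) : ∃ C, 0 ≤ C ∧ ∀ u v : Distr d,
    besovNorm p β u < ⊤ → besovNorm p γ v < ⊤ → Summable (fun n => emb (paraT p u v n)) ∧
      besovNorm p β (para p u v) ≤ ENNReal.ofReal (C * (bn p β u * bn p γ v)) := by
  obtain ⟨C1, hC1, h1⟩ := bounded_series hp hβ hβγ
  obtain ⟨C2, hC2, h2⟩ := sum_lam_le (by linarith : 0 < -β)
  refine ⟨C1 * C2, mul_nonneg hC1 hC2, fun u v hu hv => ?_⟩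
  have := h1 (paraT p u v) (C2 * (bn p β u * bn p γ v))
    (mul_nonneg hC2 (mul_nonneg bn_nonneg bn_nonneg)) fun n => ?_
  · rw [para_eq (hasBlocks_of_besovNorm hu) (hasBlocks_of_besovNorm hv), mul_assoc]
    exact this
  · have hb : 0 ≤ bn p β u * bn p γ v := mul_nonneg bn_nonneg bn_nonneg
    have hl : 0 ≤ lam n ^ (-γ) := Real.rpow_nonneg (lam_pos n).le _
    calc ‖paraT p u v n‖ ≤ ∑ m ∈ Finset.range (n - 1), bn p β u * bn p γ v *
          (lam m ^ (-β) * lam n ^ (-γ)) :=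
          (norm_sum_le _ _).trans (Finset.sum_le_sum fun m _ => norm_mulX_bl_le hu hv m n)
      _ ≤ ∑ m ∈ Finset.range (n + 1), bn p β u * bn p γ v * (lam m ^ (-β) * lam n ^ (-γ)) := by
          refine Finset.sum_le_sum_of_subset_of_nonneg (Finset.range_mono (by omega))
            fun m _ _ => mul_nonneg hb (mul_nonneg (Real.rpow_nonneg (lam_pos m).le _) hl)
      _ = bn p β u * bn p γ v * (lam n ^ (-γ) * ∑ m ∈ Finset.range (n + 1), lam m ^ (-β)) := by
          rw [Finset.mul_sum, Finset.mul_sum]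
          exact Finset.sum_congr rfl fun m _ => by ring
      _ ≤ bn p β u * bn p γ v * (lam n ^ (-γ) * (C2 * lam n ^ (-β))) := by
          exact mul_le_mul_of_nonneg_left (mul_le_mul_of_nonneg_left (h2 n) hl) hb
      _ = _ := by
          rw [show -(β + γ) = -γ + -β by ring, Real.rpow_add (lam_pos n)]
          ring

lemma exists_reso {β γ : ℝ} (hβ : β < 0) (hβγ : 0 < β + γ) : ∃ C, 0 ≤ C ∧ ∀ u v : Distr d,
    besovNorm p β u < ⊤ → besovNorm p γ v < ⊤ → Summable (fun n => emb (resoT p u v n)) ∧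
      besovNorm p β (reso p u v) ≤ ENNReal.ofReal (C * (bn p β u * bn p γ v)) := by
  obtain ⟨C1, hC1, h1⟩ := bounded_series hp hβ hβγ
  refine ⟨C1 * (3 * 2 ^ (-β)), by positivity, fun u v hu hv => ?_⟩
  have := h1 (resoT p u v) (3 * 2 ^ (-β) * (bn p β u * bn p γ v))
    (mul_nonneg (by positivity) (mul_nonneg bn_nonneg bn_nonneg)) fun n => ?_
  · rw [reso_eq (hasBlocks_of_besovNorm hu) (hasBlocks_of_besovNorm hv), mul_assoc]
    exact this
  · have hb : 0 ≤ bn p β u * bn p γ v := mul_nonneg bn_nonneg bn_nonneg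
    have hl : 0 ≤ lam n ^ (-γ) := Real.rpow_nonneg (lam_pos n).le _
    calc ‖resoT p u v n‖ ≤ ∑ m ∈ Finset.Icc (n - 1) (n + 1), bn p β u * bn p γ v *
          (lam (n + 1) ^ (-β) * lam n ^ (-γ)) := by
          refine (norm_sum_le _ _).trans (Finset.sum_le_sum fun m hm => ?_)
          refine (norm_mulX_bl_le hu hv m n).trans ?_
          have : lam m ^ (-β) ≤ lam (n + 1) ^ (-β) :=
            Real.rpow_le_rpow (lam_pos m).le (lam_mono (Finset.mem_Icc.1 hm).2) (by linarith)
          exact mul_le_mul_of_nonneg_left (mul_le_mul_of_nonneg_right this hl) hb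
      _ ≤ 3 * (bn p β u * bn p γ v * (lam (n + 1) ^ (-β) * lam n ^ (-γ))) := by
          rw [Finset.sum_const, nsmul_eq_mul]
          refine mul_le_mul_of_nonneg_right ?_
            (mul_nonneg hb (mul_nonneg (Real.rpow_nonneg (lam_pos _).le _) hl))
          rw [Nat.card_Icc]
          -- For `n = 0` truncated subtraction leaves only two indices.
          have : n + 1 + 1 - (n - 1) ≤ 3 := by omega
          exact_mod_cast this
      _ = _ := by
          rw [show -(β + γ) = -γ + -β by ring, Real.rpow_add (lam_pos n), lam_succ,
            Real.mul_rpow two_pos.le (lam_pos n).le]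
          ring

/-- The low frequencies of the regular factor are uniformly bounded, but the terms grow like `lam n
^ (-β)`. Convergence comes from localization in annuli, through `annulus_series` with `s = -β < 2`.
-/
lemma exists_para_high {β γ : ℝ} (hβ : β < 0) (hβ2 : -2 < β) (hγ : 0 < γ) : ∃ C, 0 ≤ C ∧
    ∀ u v : Distr d, besovNorm p β u < ⊤ → besovNorm p γ v < ⊤ →
      Summable (fun n => emb (paraT p v u n)) ∧
        besovNorm p β (para p v u) ≤ ENNReal.ofReal (C * (bn p β u * bn p γ v)) := by
  obtain ⟨M, hM⟩ := mulX_bl_localized hp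
  obtain ⟨C1, hC1, h1⟩ := annulus_series hp M (s := -β) (by linarith) (by linarith)
  have hL := summable_lam (by linarith : -γ < 0)
  have hL0 : 0 ≤ ∑' n, lam n ^ (-γ) := tsum_nonneg fun n => Real.rpow_nonneg (lam_pos n).le _
  refine ⟨C1 * ∑' n, lam n ^ (-γ), mul_nonneg hC1 hL0, fun u v hu hv => ?_⟩
  have hub := hasBlocks_of_besovNorm hu
  have hvb := hasBlocks_of_besovNorm hv
  have hb : 0 ≤ bn p β u * bn p γ v := mul_nonneg bn_nonneg bn_nonneg
  have := h1 (paraT p v u) ((∑' n, lam n ^ (-γ)) * (bn p β u * bn p γ v))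
    (mul_nonneg hL0 hb) (fun n => ?_) fun n => ?_
  · rw [para_eq hvb hub, mul_assoc]
    rw [neg_neg] at this
    exact this
  · rw [paraT, ContinuousLinearMap.finsetSum_comp]
    refine Finset.sum_congr rfl fun m hm => ?_
    exact hM m n v u (by have := Finset.mem_range.1 hm; omega) hvb hub
  · have hl : 0 ≤ lam n ^ (-β) := Real.rpow_nonneg (lam_pos n).le _
    calc ‖paraT p v u n‖ ≤ ∑ m ∈ Finset.range (n - 1), bn p γ v * bn p β u *
          (lam m ^ (-γ) * lam n ^ (-β)) :=
          (norm_sum_le _ _).trans (Finset.sum_le_sum fun m _ => norm_mulX_bl_le hv hu m n)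
      _ = bn p β u * bn p γ v * lam n ^ (-β) * ∑ m ∈ Finset.range (n - 1), lam m ^ (-γ) := by
          rw [Finset.mul_sum]
          exact Finset.sum_congr rfl fun m _ => by ring
      _ ≤ bn p β u * bn p γ v * lam n ^ (-β) * ∑' m, lam m ^ (-γ) :=
          mul_le_mul_of_nonneg_left (hL.sum_le_tsum _ fun m _ =>
            Real.rpow_nonneg (lam_pos m).le _) (mul_nonneg hb hl)
      _ = _ := by ring

/-- The product of `B^β` and `B^γ` is bounded with values in `B^β`, if `β < 0 < β + γ`. -/
lemma besovNorm_prod_le {β γ : ℝ} (hβ : β < 0) (hβ2 : -2 < β) (hβγ : 0 < β + γ) :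
    ∃ C, 0 ≤ C ∧ ∀ u v : Distr d, besovNorm p β u < ⊤ → besovNorm p γ v < ⊤ →
      besovNorm p β (prod p u v) ≤ ENNReal.ofReal (C * (bn p β u * bn p γ v)) := by
  obtain ⟨C1, hC1, h1⟩ := exists_para_low hp hβ hβγ
  obtain ⟨C2, hC2, h2⟩ := exists_para_high hp hβ hβ2 (by linarith : 0 < γ)
  obtain ⟨C3, hC3, h3⟩ := exists_reso hp hβ hβγ
  refine ⟨C1 + C2 + C3, by positivity, fun u v hu hv => ?_⟩
  have hb : 0 ≤ bn p β u * bn p γ v := mul_nonneg bn_nonneg bn_nonneg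
  rw [add_mul, add_mul, ENNReal.ofReal_add (by positivity) (by positivity),
    ENNReal.ofReal_add (by positivity) (by positivity)]
  exact (besovNorm_add_le _ _).trans (add_le_add ((besovNorm_add_le _ _).trans
    (add_le_add (h1 u v hu hv).2 (h2 u v hu hv).2)) (h3 u v hu hv).2)

/-- Linearity of the product is not formal: the three series must converge before their sums can be
subtracted. -/
lemma prod_sub_left {β γ : ℝ} (hβ : β < 0) (hβ2 : -2 < β) (hβγ : 0 < β + γ)
    (hu : besovNorm p β u < ⊤) (hu' : besovNorm p β u' < ⊤) (hv : besovNorm p γ v < ⊤) :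
    prod p (u - u') v = prod p u v - prod p u' v := by
  obtain ⟨C1, -, h1⟩ := exists_para_low hp hβ hβγ
  obtain ⟨C2, -, h2⟩ := exists_para_high hp hβ hβ2 (by linarith : 0 < γ)
  obtain ⟨C3, -, h3⟩ := exists_reso hp hβ hβγ
  have ub := hasBlocks_of_besovNorm hu
  have ub' := hasBlocks_of_besovNorm hu'
  have vb := hasBlocks_of_besovNorm hv
  have sb := ub.sub ub'
  rw [prod, prod, prod, para_eq sb vb, para_eq ub vb, para_eq ub' vb, para_eq vb sb,
    para_eq vb ub, para_eq vb ub', reso_eq sb vb, reso_eq ub vb, reso_eq ub' vb]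
  simp only [paraT_sub_left ub ub', paraT_sub_right ub ub', resoT_sub_left ub ub', map_sub]
  rw [(h1 u v hu hv).1.tsum_sub (h1 u' v hu' hv).1, (h2 u v hu hv).1.tsum_sub (h2 u' v hu' hv).1,
    (h3 u v hu hv).1.tsum_sub (h3 u' v hu' hv).1]
  abel

lemma prod_sub_right {β γ : ℝ} (hβ : β < 0) (hβ2 : -2 < β) (hβγ : 0 < β + γ)
    (hu : besovNorm p β u < ⊤) (hv : besovNorm p γ v < ⊤) (hv' : besovNorm p γ v' < ⊤) :
    prod p u (v - v') = prod p u v - prod p u v' := by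
  obtain ⟨C1, -, h1⟩ := exists_para_low hp hβ hβγ
  obtain ⟨C2, -, h2⟩ := exists_para_high hp hβ hβ2 (by linarith : 0 < γ)
  obtain ⟨C3, -, h3⟩ := exists_reso hp hβ hβγ
  have ub := hasBlocks_of_besovNorm hu
  have vb := hasBlocks_of_besovNorm hv
  have vb' := hasBlocks_of_besovNorm hv'
  have sb := vb.sub vb'
  rw [prod, prod, prod, para_eq ub sb, para_eq ub vb, para_eq ub vb', para_eq sb ub,
    para_eq vb ub, para_eq vb' ub, reso_eq ub sb, reso_eq ub vb, reso_eq ub vb']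
  simp only [paraT_sub_left vb vb', paraT_sub_right vb vb', resoT_sub_right vb vb', map_sub]
  rw [(h1 u v hu hv).1.tsum_sub (h1 u v' hu hv').1, (h2 u v hu hv).1.tsum_sub (h2 u v' hu hv').1,
    (h3 u v hu hv).1.tsum_sub (h3 u v' hu hv').1]
  abel

lemma besovNorm_dotGrad_le {β θ : ℝ} (hβ : β < 0) (hβ2 : -2 < β) (hθ : 1 - β < θ) :
    ∃ C, 0 ≤ C ∧ ∀ (V : Fin d → Distr d) (u : Distr d) (A : ℝ),
      (∀ i, besovNorm p β (V i) ≤ ENNReal.ofReal A) → 0 ≤ A → besovNorm p θ u < ⊤ →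
        besovNorm p β (dotGrad p V u) ≤ ENNReal.ofReal (C * A * bn p θ u) := by
  -- The gradient has regularity `θ - 1`, and `θ > 1 - β` is the condition for multiplying it with
  -- regularity `β`.
  obtain ⟨C1, hC1, h1⟩ := besovNorm_prod_le hp (γ := θ - 1) hβ hβ2 (by linarith)
  choose C2 hC2 h2 using fun i : Fin d =>
    besovNorm_deriv_le hp θ (EuclideanSpace.single i (1 : ℝ) : Rd d)
  refine ⟨∑ i, C1 * C2 i, Finset.sum_nonneg fun i _ => mul_nonneg hC1 (hC2 i),
    fun V u A hV hA hu => ?_⟩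
  have hterm : ∀ i, besovNorm p β (prod p (V i) (∂_{(EuclideanSpace.single i (1 : ℝ) : Rd d)} u)) ≤
      ENNReal.ofReal (C1 * C2 i * A * bn p θ u) := by
    intro i
    have hVi : besovNorm p β (V i) < ⊤ := (hV i).trans_lt ENNReal.ofReal_lt_top
    have hdi := h2 i u hu
    have hdi' := hdi.trans_lt ENNReal.ofReal_lt_top
    refine (h1 _ _ hVi hdi').trans (ENNReal.ofReal_le_ofReal ?_)
    have e1 : bn p β (V i) ≤ A := ENNReal.toReal_le_of_le_ofReal hA (hV i)
    have e2 := ENNReal.toReal_le_of_le_ofReal (mul_nonneg (hC2 i) bn_nonneg) hdi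
    calc C1 * (bn p β (V i) * bn p (θ - 1) (∂_{(EuclideanSpace.single i (1 : ℝ) : Rd d)} u))
        ≤ C1 * (A * (C2 i * bn p θ u)) :=
          mul_le_mul_of_nonneg_left (mul_le_mul e1 e2 bn_nonneg hA) hC1
      _ = _ := by ring
  have hsum : ∀ s : Finset (Fin d), besovNorm p β
      (∑ i ∈ s, prod p (V i) (∂_{(EuclideanSpace.single i (1 : ℝ) : Rd d)} u)) ≤
      ENNReal.ofReal ((∑ i ∈ s, C1 * C2 i) * A * bn p θ u) := by
    intro s
    induction s using Finset.cons_induction with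
    | empty =>
      rw [Finset.sum_empty]
      refine (besovNorm_le (C := 0) fun n => ⟨0, ?_, by simp⟩).trans (by simp)
      rw [block_eq, map_zero, map_zero]
    | cons i s hi ih =>
      rw [Finset.sum_cons, Finset.sum_cons, add_mul, add_mul, ENNReal.ofReal_add]
      · exact (besovNorm_add_le _ _).trans (add_le_add (hterm i) ih)
      · exact mul_nonneg (mul_nonneg (mul_nonneg hC1 (hC2 i)) hA) bn_nonneg
      · exact mul_nonneg (mul_nonneg (Finset.sum_nonneg fun i _ => mul_nonneg hC1 (hC2 i)) hA)
          bn_nonneg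
  exact hsum Finset.univ

lemma dotGrad_sub_right {β θ : ℝ} (hβ : β < 0) (hβ2 : -2 < β) (hθ : 1 - β < θ)
    {V : Fin d → Distr d} (hV : ∀ i, besovNorm p β (V i) < ⊤) (hu : besovNorm p θ u < ⊤)
    (hu' : besovNorm p θ u' < ⊤) : dotGrad p V (u - u') = dotGrad p V u - dotGrad p V u' := by
  rw [dotGrad, dotGrad, dotGrad, ← Finset.sum_sub_distrib]
  refine Finset.sum_congr rfl fun i _ => ?_
  obtain ⟨C, -, h⟩ := besovNorm_deriv_le hp θ (EuclideanSpace.single i (1 : ℝ) : Rd d)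
  rw [← prod_sub_right hp (γ := θ - 1) hβ hβ2 (by linarith) (hV i)
    ((h u hu).trans_lt ENNReal.ofReal_lt_top) ((h u' hu').trans_lt ENNReal.ofReal_lt_top)]
  congr 1

lemma dotGrad_sub_left {β θ : ℝ} (hβ : β < 0) (hβ2 : -2 < β) (hθ : 1 - β < θ)
    {V V' : Fin d → Distr d} (hV : ∀ i, besovNorm p β (V i) < ⊤)
    (hV' : ∀ i, besovNorm p β (V' i) < ⊤) (hu : besovNorm p θ u < ⊤) :
    dotGrad p (fun i => V i - V' i) u = dotGrad p V u - dotGrad p V' u := by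
  rw [dotGrad, dotGrad, dotGrad, ← Finset.sum_sub_distrib]
  refine Finset.sum_congr rfl fun i _ => ?_
  obtain ⟨C, -, h⟩ := besovNorm_deriv_le hp θ (EuclideanSpace.single i (1 : ℝ) : Rd d)
  rw [← prod_sub_left hp (γ := θ - 1) hβ hβ2 (by linarith) (hV i) (hV' i)
    ((h u hu).trans_lt ENNReal.ofReal_lt_top)]

end Product

/-! ### Continuous curves in Besov spaces -/

/-- Continuity of a curve on `[0,T]` with values in `B^γ_{∞,∞}`. -/
def ContB (p : ℕ → Rd d → ℝ) (T γ : ℝ) (G : ℝ → Distr d) : Prop :=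
  (∀ t ∈ Icc 0 T, besovNorm p γ (G t) < ⊤) ∧
    ∀ t ∈ Icc 0 T, Tendsto (fun s => bn p γ (G s - G t)) (𝓝[Icc 0 T] t) (𝓝 0)

section Curves

variable {p : ℕ → Rd d → ℝ} {T γ : ℝ} {G H : ℝ → Distr d}

lemma besovNorm_sub_lt {u v : Distr d} (hu : besovNorm p γ u < ⊤) (hv : besovNorm p γ v < ⊤) :
    besovNorm p γ (u - v) < ⊤ :=
  (besovNorm_sub_le u v).trans_lt (ENNReal.add_lt_top.2 ⟨hu, hv⟩)

lemma besovNorm_add_lt {u v : Distr d} (hu : besovNorm p γ u < ⊤) (hv : besovNorm p γ v < ⊤) :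
    besovNorm p γ (u + v) < ⊤ :=
  (besovNorm_add_le u v).trans_lt (ENNReal.add_lt_top.2 ⟨hu, hv⟩)

lemma bn_add_le {u v : Distr d} (hu : besovNorm p γ u < ⊤) (hv : besovNorm p γ v < ⊤) :
    bn p γ (u + v) ≤ bn p γ u + bn p γ v := by
  rw [bn, bn, bn, ← ENNReal.toReal_add hu.ne hv.ne]
  exact ENNReal.toReal_mono (ENNReal.add_lt_top.2 ⟨hu, hv⟩).ne (besovNorm_add_le u v)

lemma bn_sub_le {u v : Distr d} (hu : besovNorm p γ u < ⊤) (hv : besovNorm p γ v < ⊤) :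
    bn p γ (u - v) ≤ bn p γ u + bn p γ v := by
  rw [bn, bn, bn, ← ENNReal.toReal_add hu.ne hv.ne]
  exact ENNReal.toReal_mono (ENNReal.add_lt_top.2 ⟨hu, hv⟩).ne (besovNorm_sub_le u v)

lemma bn_neg (u : Distr d) : bn p γ (-u) = bn p γ u := by rw [bn, bn, besovNorm_neg]

lemma bn_le_of_besovNorm_le {u : Distr d} {C : ℝ} (hC : 0 ≤ C)
    (h : besovNorm p γ u ≤ ENNReal.ofReal C) : bn p γ u ≤ C :=
  ENNReal.toReal_le_of_le_ofReal hC h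

lemma MemCT.contB (h : MemCT p T γ G) : ContB p T γ G := by
  refine ⟨fun t ht => (h.1 t ht).1, fun t ht => ?_⟩
  have := (ENNReal.tendsto_toReal ENNReal.zero_ne_top).comp (h.2 t ht)
  rw [ENNReal.toReal_zero] at this
  exact this

lemma ContB.memCT (h : ContB p T γ G) (h' : ∀ t ∈ Icc 0 T, MemC p γ (G t)) : MemCT p T γ G := by
  refine ⟨h', fun t ht => ?_⟩
  have h1 := ENNReal.tendsto_ofReal (h.2 t ht)
  rw [ENNReal.ofReal_zero] at h1
  refine h1.congr' ?_
  filter_upwards [self_mem_nhdsWithin] with s hs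
  exact ofReal_bn (besovNorm_sub_lt (h.1 s hs) (h.1 t ht))

lemma ContB.sub (hG : ContB p T γ G) (hH : ContB p T γ H) : ContB p T γ fun t => G t - H t := by
  refine ⟨fun t ht => besovNorm_sub_lt (hG.1 t ht) (hH.1 t ht), fun t ht => ?_⟩
  have h1 := (hG.2 t ht).add (hH.2 t ht)
  rw [add_zero] at h1
  refine squeeze_zero' (Filter.Eventually.of_forall fun _ => bn_nonneg) ?_ h1
  filter_upwards [self_mem_nhdsWithin] with s hs
  rw [sub_sub_sub_comm]
  exact bn_sub_le (besovNorm_sub_lt (hG.1 s hs) (hG.1 t ht))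
    (besovNorm_sub_lt (hH.1 s hs) (hH.1 t ht))

lemma ContB.neg (hH : ContB p T γ H) : ContB p T γ fun t => -H t := by
  refine ⟨fun t ht => by rw [besovNorm_neg]; exact hH.1 t ht, fun t ht => ?_⟩
  refine (hH.2 t ht).congr fun s => ?_
  rw [← bn_neg, neg_sub, neg_sub_neg]

lemma ContB.add (hG : ContB p T γ G) (hH : ContB p T γ H) : ContB p T γ fun t => G t + H t := by
  have := hG.sub hH.neg
  simpa only [sub_neg_eq_add] using this

lemma ContB.continuousOn (hG : ContB p T γ G) : ContinuousOn (fun t => bn p γ (G t)) (Icc 0 T) := by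
  intro t ht
  refine tendsto_iff_dist_tendsto_zero.2 (squeeze_zero' (Filter.Eventually.of_forall
    fun _ => dist_nonneg) ?_ (hG.2 t ht))
  filter_upwards [self_mem_nhdsWithin] with s hs
  have hd := besovNorm_sub_lt (hG.1 s hs) (hG.1 t ht)
  rw [Real.dist_eq, abs_le]
  constructor
  · have := bn_add_le (u := -(G s - G t)) (v := G s) (by rwa [besovNorm_neg]) (hG.1 s hs)
    rw [bn_neg, show -(G s - G t) + G s = G t by abel] at this
    linarith
  · have := bn_add_le hd (hG.1 t ht)
    rw [sub_add_cancel] at this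
    linarith

lemma ContB.bounded (hG : ContB p T γ G) : ∃ K, 0 ≤ K ∧ ∀ t ∈ Icc 0 T, bn p γ (G t) ≤ K := by
  obtain ⟨K, hK⟩ := isCompact_Icc.exists_bound_of_continuousOn hG.continuousOn
  refine ⟨max K 0, le_max_right _ _, fun t ht => ?_⟩
  exact ((le_abs_self _).trans (hK t ht)).trans (le_max_left _ _)

lemma MemC.add {u v : Distr d} (hu : MemC p γ u) (hv : MemC p γ v) : MemC p γ (u + v) := by
  refine ⟨besovNorm_add_lt hu.1 hv.1, ?_⟩
  have h1 := hu.2.add hv.2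
  rw [add_zero] at h1
  refine tendsto_of_tendsto_of_tendsto_of_le_of_le tendsto_const_nhds h1 (fun n => zero_le)
    fun n => ?_
  rw [blockSize, blockSize, blockSize, ← mul_add, block_add]
  gcongr
  exact linftyNorm_add_le _ _

/-- Uniform limits of continuous curves. -/
lemma memCT_of_uniform {F : ℕ → ℝ → Distr d} (hF : ∀ k, MemCT p T γ (F k)) {ε : ℕ → ℝ}
    (hε : Tendsto ε atTop (𝓝 0))
    (h : ∀ k, ∀ t ∈ Icc 0 T, besovNorm p γ (G t - F k t) ≤ ENNReal.ofReal (ε k)) :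
    MemCT p T γ G := by
  have hfin : ∀ k, ∀ t ∈ Icc 0 T, besovNorm p γ (G t - F k t) < ⊤ := fun k t ht =>
    (h k t ht).trans_lt ENNReal.ofReal_lt_top
  have hε' : Tendsto (fun k => ENNReal.ofReal (ε k)) atTop (𝓝 0) := by
    simpa using ENNReal.tendsto_ofReal hε
  have hG1 : ∀ t ∈ Icc 0 T, besovNorm p γ (G t) < ⊤ := fun t ht => by
    have := besovNorm_add_lt (hfin 0 t ht) ((hF 0).1 t ht).1
    rwa [sub_add_cancel] at this
  refine ⟨fun t ht => ⟨hG1 t ht, ?_⟩, fun t ht => ?_⟩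
  · rw [ENNReal.tendsto_nhds_zero]
    intro e he
    have he2 : (0 : ℝ≥0∞) < e / 2 := ENNReal.half_pos he.ne'
    obtain ⟨k, hk⟩ := ((ENNReal.tendsto_nhds_zero.1 hε') _ he2).exists
    filter_upwards [(ENNReal.tendsto_nhds_zero.1 ((hF k).1 t ht).2) _ he2] with n hn
    calc blockSize p γ (G t) n ≤ blockSize p γ (G t - F k t) n + blockSize p γ (F k t) n := by
          rw [blockSize, blockSize, blockSize, ← mul_add]
          gcongr
          conv_lhs => rw [← sub_add_cancel (G t) (F k t), block_add]
          exact linftyNorm_add_le _ _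
      _ ≤ e / 2 + e / 2 := add_le_add ((le_iSup (blockSize p γ (G t - F k t)) n).trans
          ((h k t ht).trans hk)) hn
      _ = e := ENNReal.add_halves e
  · rw [ENNReal.tendsto_nhds_zero]
    intro e he
    have he3 : (0 : ℝ≥0∞) < e / 3 := ENNReal.div_pos he.ne' (by simp)
    obtain ⟨k, hk⟩ := ((ENNReal.tendsto_nhds_zero.1 hε') _ he3).exists
    filter_upwards [(ENNReal.tendsto_nhds_zero.1 ((hF k).2 t ht)) _ he3,
      self_mem_nhdsWithin] with s hs hsI
    have e1 : G s - G t = (G s - F k s) + ((F k s - F k t) - (G t - F k t)) := by abel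
    rw [e1]
    calc _ ≤ besovNorm p γ (G s - F k s) + (besovNorm p γ (F k s - F k t) +
          besovNorm p γ (G t - F k t)) :=
          (besovNorm_add_le _ _).trans (add_le_add le_rfl (besovNorm_sub_le _ _))
      _ ≤ e / 3 + (e / 3 + e / 3) :=
          add_le_add ((h k s hsI).trans hk) (add_le_add hs ((h k t ht).trans hk))
      _ = e := by rw [← add_assoc, ENNReal.add_thirds]

end Curves

/-! ### The singular kernel and its exponential weight -/

section Kernel

lemma intervalIntegrable_sub_rpow {κ : ℝ} (hκ : κ < 1) (t a b : ℝ) :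
    IntervalIntegrable (fun s => (s - t) ^ (-κ)) volume a b := by
  have h := intervalIntegral.intervalIntegrable_rpow' (a := a - t) (b := b - t) (r := -κ)
    (by linarith)
  have := h.comp_sub_right t
  simpa using this

lemma integral_sub_rpow {κ : ℝ} (hκ : κ < 1) {t t' : ℝ} :
    ∫ s in t..t', (s - t) ^ (-κ) = (t' - t) ^ (1 - κ) / (1 - κ) := by
  rw [intervalIntegral.integral_comp_sub_right (fun s => s ^ (-κ)) t, sub_self,
    integral_rpow (Or.inl (by linarith)), Real.zero_rpow (by linarith)]
  rw [sub_zero, show -κ + 1 = 1 - κ by ring]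

lemma intervalIntegrable_sub_rpow_mul {κ : ℝ} (hκ : κ < 1) (t : ℝ) {a b : ℝ} {g : ℝ → ℝ}
    (hg : Continuous g) : IntervalIntegrable (fun s => (s - t) ^ (-κ) * g s) volume a b :=
  (intervalIntegrable_sub_rpow hκ t a b).mul_continuousOn hg.continuousOn

lemma exp_neg_le_rpow {x a : ℝ} (hx : 0 < x) (ha : 0 ≤ a) (ha1 : a ≤ 1) :
    Real.exp (-x) ≤ x ^ (-a) := by
  rw [Real.exp_neg, Real.rpow_neg hx.le]
  refine inv_anti₀ (Real.rpow_pos_of_pos hx _) ?_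
  rcases le_total x 1 with h | h
  · exact (Real.rpow_le_one hx.le h ha).trans (Real.one_le_exp hx.le)
  · calc x ^ a ≤ x ^ (1 : ℝ) := Real.rpow_le_rpow_of_exponent_le h ha1
      _ = x := Real.rpow_one x
      _ ≤ Real.exp x := by linarith [Real.add_one_le_exp x]

/-- A weight for which the singular kernel is a contraction. -/
lemma exists_weight {κ : ℝ} (h0 : 0 ≤ κ) (h1 : κ < 1) {T : ℝ} (hT : 0 < T) (C : ℝ) (hC : 0 ≤ C) :
    ∃ l : ℝ, 0 < l ∧ ∀ t ∈ Icc 0 T,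
      C * (∫ s in t..T, (s - t) ^ (-κ) * Real.exp (l * (T - s))) ≤ 2⁻¹ * Real.exp (l * (T - t)) := by
  -- Half of the spare integrability: `exp (-l (s - t)) ≤ (l (s - t)) ^ (-a)` yields the small
  -- factor `l ^ (-a)`, while the worsened singularity `κ + a < 1` stays integrable.
  set a := (1 - κ) / 2 with ha
  have ha0 : 0 < a := by rw [ha]; linarith
  have ha1 : a ≤ 1 := by rw [ha]; linarith
  have hka : κ + a < 1 := by rw [ha]; linarith
  set B := C * (T ^ (1 - (κ + a)) / (1 - (κ + a))) with hB
  have hB0 : 0 ≤ B := mul_nonneg hC (div_nonneg (Real.rpow_nonneg hT.le _) (by linarith))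
  obtain ⟨l, hl0, hl⟩ : ∃ l : ℝ, 0 < l ∧ B * l ^ (-a) ≤ 2⁻¹ := by
    have h2 : Tendsto (fun l : ℝ => B * l ^ (-a)) atTop (𝓝 (B * 0)) :=
      (tendsto_rpow_neg_atTop ha0).const_mul B
    rw [mul_zero] at h2
    have h3 := (h2.eventually (gt_mem_nhds (by norm_num : (0 : ℝ) < 2⁻¹))).and
      (eventually_gt_atTop (0 : ℝ))
    obtain ⟨l, hl⟩ := h3.exists
    exact ⟨l, hl.2, hl.1.le⟩
  refine ⟨l, hl0, fun t ht => ?_⟩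
  have hexp : Continuous fun s => Real.exp (l * (T - s)) := by fun_prop
  have hle : ∫ s in t..T, (s - t) ^ (-κ) * Real.exp (l * (T - s)) ≤
      ∫ s in t..T, l ^ (-a) * Real.exp (l * (T - t)) * (s - t) ^ (-(κ + a)) := by
    refine intervalIntegral.integral_mono_on_of_le_Ioo ht.2
      (intervalIntegrable_sub_rpow_mul h1 t hexp)
      ((intervalIntegrable_sub_rpow hka t t T).const_mul _) fun s hs => ?_
    have hst : 0 < s - t := sub_pos.2 hs.1
    have e1 : Real.exp (l * (T - s)) = Real.exp (l * (T - t)) * Real.exp (-(l * (s - t))) := by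
      rw [← Real.exp_add]; congr 1; ring
    have e2 := exp_neg_le_rpow (mul_pos hl0 hst) ha0.le ha1
    rw [Real.mul_rpow hl0.le hst.le] at e2
    have e3 : (s - t) ^ (-(κ + a)) = (s - t) ^ (-κ) * (s - t) ^ (-a) := by
      rw [← Real.rpow_add hst]; congr 1; ring
    rw [e1, e3]
    have e4 : 0 ≤ (s - t) ^ (-κ) * Real.exp (l * (T - t)) :=
      mul_nonneg (Real.rpow_nonneg hst.le _) (Real.exp_pos _).le
    calc (s - t) ^ (-κ) * (Real.exp (l * (T - t)) * Real.exp (-(l * (s - t))))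
        = (s - t) ^ (-κ) * Real.exp (l * (T - t)) * Real.exp (-(l * (s - t))) := by ring
      _ ≤ (s - t) ^ (-κ) * Real.exp (l * (T - t)) * (l ^ (-a) * (s - t) ^ (-a)) :=
          mul_le_mul_of_nonneg_left e2 e4
      _ = _ := by ring
  rw [intervalIntegral.integral_const_mul, integral_sub_rpow hka] at hle
  have hTt : (T - t) ^ (1 - (κ + a)) ≤ T ^ (1 - (κ + a)) :=
    Real.rpow_le_rpow (by linarith [ht.2]) (by linarith [ht.1]) (by linarith)
  have hd : 0 < 1 - (κ + a) := by linarith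
  have hE := Real.exp_pos (l * (T - t))
  calc C * _ ≤ C * (l ^ (-a) * Real.exp (l * (T - t)) *
        ((T - t) ^ (1 - (κ + a)) / (1 - (κ + a)))) := mul_le_mul_of_nonneg_left hle hC
    _ ≤ C * (l ^ (-a) * Real.exp (l * (T - t)) * (T ^ (1 - (κ + a)) / (1 - (κ + a)))) := by
        refine mul_le_mul_of_nonneg_left (mul_le_mul_of_nonneg_left ?_
          (mul_nonneg (Real.rpow_nonneg hl0.le _) hE.le)) hC
        exact div_le_div_of_nonneg_right hTt hd.le
    _ = (B * l ^ (-a)) * Real.exp (l * (T - t)) := by rw [hB]; ring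
    _ ≤ _ := mul_le_mul_of_nonneg_right hl hE.le

end Kernel

/-! ### The source term of the mild formula -/

/-- The contribution `∫_t^{t'} P_{s-t} G_s ds` of a source. -/
def src (p : ℕ → Rd d → ℝ) (α : ℝ) (ν : Measure (Metric.sphere (0 : Rd d) 1)) (G : ℝ → Distr d)
    (t t' : ℝ) : XD d := ∫ s in t..t', Pm p α ν (s - t) (G s)

section Source

variable (ν : Measure (Metric.sphere (0 : Rd d) 1)) [IsFiniteMeasure ν]
  (hspan : Submodule.span ℝ
      ((fun ξ : Metric.sphere (0 : Rd d) 1 => (ξ : Rd d)) '' ν.support) = ⊤)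
  {α : ℝ} (hα : α ∈ Ioc (1 : ℝ) 2) {p : ℕ → Rd d → ℝ} (hp : IsDyadicPartition p)
  {T β : ℝ} {G H : ℝ → Distr d}

include hspan hα hp

/-- Near `s0`, freezing the source at `s0` leaves continuity of the semigroup in time, and the error
is controlled by smoothing since `s0 - t > 0`. This supplies the measurability needed for the
integral in `XD`. -/
lemma continuousOn_Pm_curve (hβ : -α < β) (hβ' : β < 0) (hG : ContB p T β G) {t : ℝ}
    (ht : 0 ≤ t) : ContinuousOn (fun s => Pm p α ν (s - t) (G s)) (Ioc t T) := by
  intro s0 hs0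
  have hs0I : s0 ∈ Icc 0 T := ⟨ht.trans hs0.1.le, hs0.2⟩
  have hst0 : 0 < s0 - t := sub_pos.2 hs0.1
  have hsub : Ioc t T ⊆ Icc 0 T := fun s hs => ⟨ht.trans hs.1.le, hs.2⟩
  obtain ⟨C, hC, hb⟩ := norm_Pm_le ν hspan hα hp T zero_le_one le_rfl
    (γ := β) (by linarith)
  have h1 : Tendsto (fun s => Pm p α ν (s - t) (G s0)) (𝓝[Ioc t T] s0)
      (𝓝 (Pm p α ν (s0 - t) (G s0))) := by
    have h2 := (continuousOn_Pm ν hspan hα hp hβ hβ' (hG.1 s0 hs0I)).continuousAt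
      (Ioi_mem_nhds hst0)
    have h3 : Tendsto (fun s => s - t) (𝓝[Ioc t T] s0) (𝓝 (s0 - t)) :=
      ((continuous_id.sub continuous_const).tendsto s0).mono_left nhdsWithin_le_nhds
    exact h2.tendsto.comp h3
  have h4 : Tendsto (fun s => Pm p α ν (s - t) (G s - G s0)) (𝓝[Ioc t T] s0) (𝓝 0) := by
    have h5 : Tendsto (fun s => C * (s - t) ^ (-1 : ℝ) * bn p β (G s - G s0)) (𝓝[Ioc t T] s0)
        (𝓝 (C * (s0 - t) ^ (-1 : ℝ) * 0)) := by
      refine Tendsto.mul ?_ ((hG.2 s0 hs0I).mono_left (nhdsWithin_mono _ hsub))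
      refine Tendsto.mono_left ?_ nhdsWithin_le_nhds
      refine ContinuousAt.tendsto (f := fun s => C * (s - t) ^ (-1 : ℝ)) ?_
      exact continuousAt_const.mul (ContinuousAt.rpow_const (by fun_prop) (Or.inl hst0.ne'))
    rw [mul_zero] at h5
    refine squeeze_zero_norm' ?_ h5
    filter_upwards [self_mem_nhdsWithin] with s hs
    exact (hb (s - t) _ (sub_pos.2 hs.1) (by linarith [hs.2])
      (besovNorm_sub_lt (hG.1 s (hsub hs)) (hG.1 s0 hs0I))).2
  have h6 := h1.add h4
  rw [add_zero] at h6
  refine h6.congr' ?_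
  filter_upwards [self_mem_nhdsWithin] with s hs
  rw [Pm_sub ν hspan hα hp hβ (sub_pos.2 hs.1) (hG.1 s (hsub hs)) (hG.1 s0 hs0I)]
  abel

lemma intervalIntegrable_Pm (hβ : -α < β) (hβ' : β < 0) (hG : ContB p T β G) {t a b : ℝ}
    (ht : 0 ≤ t) (hta : t ≤ a) (hab : a ≤ b) (hbT : b ≤ T) :
    IntervalIntegrable (fun s => Pm p α ν (s - t) (G s)) volume a b := by
  have hα0 : 0 < α := by linarith [hα.1]
  -- The midpoint of `-β / α` and `1`: enough smoothing to reach bounded functions, with an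
  -- integrable singularity.
  obtain ⟨κ, hκ0, hκ1, hκ⟩ : ∃ κ : ℝ, 0 ≤ κ ∧ κ < 1 ∧ 0 < β + α * κ := by
    refine ⟨(1 + -β / α) / 2, ?_, ?_, ?_⟩
    · have : 0 < -β / α := div_pos (by linarith) hα0
      linarith
    · have : -β / α < 1 := (div_lt_one hα0).2 (by linarith)
      linarith
    · have : α * ((1 + -β / α) / 2) = (α + -β) / 2 := by field_simp
      rw [this]; linarith
  obtain ⟨C, hC, hb⟩ := norm_Pm_le ν hspan hα hp T hκ0 hκ1.le hκ
  obtain ⟨K, hK, hGK⟩ := hG.bounded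
  have hsub : Ioc a b ⊆ Ioc t T := fun s hs => ⟨hta.trans_lt hs.1, hs.2.trans hbT⟩
  have hmeas : AEStronglyMeasurable (fun s => Pm p α ν (s - t) (G s))
      (volume.restrict (Ioc a b)) :=
    ((continuousOn_Pm_curve ν hspan hα hp hβ hβ' hG ht).mono hsub).aestronglyMeasurable
      measurableSet_Ioc
  refine IntervalIntegrable.mono_fun'
    (((intervalIntegrable_sub_rpow hκ1 t a b).const_mul C).mul_const K) ?_ ?_
  · rwa [uIoc_of_le hab]
  · rw [uIoc_of_le hab]
    filter_upwards [ae_restrict_mem measurableSet_Ioc] with s hs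
    have hs' := hsub hs
    have hsI : s ∈ Icc 0 T := ⟨ht.trans hs'.1.le, hs'.2⟩
    have hst : 0 < s - t := sub_pos.2 hs'.1
    refine (hb (s - t) _ hst (by linarith [hs'.2]) (hG.1 s hsI)).2.trans ?_
    exact mul_le_mul_of_nonneg_left (hGK s hsI)
      (mul_nonneg hC (Real.rpow_nonneg hst.le _))

/-- The source term in the uniform norm. -/
lemma norm_src_le {κ : ℝ} (hκ0 : 0 ≤ κ) (hκ1 : κ < 1)
    (hκ : 0 < β + α * κ) : ∃ C, 0 ≤ C ∧ ∀ (G : ℝ → Distr d) (K t t' : ℝ), ContB p T β G →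
      (∀ s ∈ Icc 0 T, bn p β (G s) ≤ K) → 0 ≤ t → t ≤ t' → t' ≤ T →
        ‖src p α ν G t t'‖ ≤ C * K * (t' - t) ^ (1 - κ) := by
  obtain ⟨C, hC, hb⟩ := norm_Pm_le ν hspan hα hp T hκ0 hκ1.le hκ
  refine ⟨C / (1 - κ), div_nonneg hC (by linarith), fun G K t t' hG hGK ht htt' ht'T => ?_⟩
  have h1 : ‖src p α ν G t t'‖ ≤ ∫ s in t..t', C * (s - t) ^ (-κ) * K := by
    refine intervalIntegral.norm_integral_le_of_norm_le htt' (ae_of_all _ fun s hs => ?_)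
      (((intervalIntegrable_sub_rpow hκ1 t t t').const_mul C).mul_const K)
    have hsI : s ∈ Icc 0 T := ⟨ht.trans hs.1.le, hs.2.trans ht'T⟩
    have hst : 0 < s - t := sub_pos.2 hs.1
    refine (hb (s - t) _ hst (by linarith [hs.2]) (hG.1 s hsI)).2.trans ?_
    exact mul_le_mul_of_nonneg_left (hGK s hsI) (mul_nonneg hC (Real.rpow_nonneg hst.le _))
  rw [intervalIntegral.integral_mul_const, intervalIntegral.integral_const_mul,
    integral_sub_rpow hκ1] at h1
  refine h1.trans (le_of_eq ?_)
  ring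

lemma src_comp (hβ : -α < β) (hβ' : β < 0) (hG : ContB p T β G) {t a b : ℝ} (ht : 0 ≤ t)
    (hta : t ≤ a) (hab : a ≤ b) (hbT : b ≤ T) (A : L1 d →L[ℂ] L1 d) :
    (∫ s in a..b, Pm p α ν (s - t) (G s)) ∘L A = ∫ s in a..b, Pm p α ν (s - t) (G s) ∘L A :=
  (ContinuousLinearMap.intervalIntegral_comp_comm
    ((ContinuousLinearMap.compL ℂ (L1 d) (L1 d) ℂ).flip A)
    (intervalIntegrable_Pm ν hspan hα hp hβ hβ' hG ht hta hab hbT)).symm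

/-- The source term in spaces of higher regularity. -/
lemma besovNorm_src_le (hβ : -α < β) (hβ' : β < 0) {κ : ℝ} (hκ0 : 0 ≤ κ) (hκ1 : κ < 1) :
    ∃ C, 0 ≤ C ∧ ∀ (G : ℝ → Distr d) (g : ℝ → ℝ) (t t' : ℝ), ContB p T β G → Continuous g →
      (∀ s ∈ Icc 0 T, bn p β (G s) ≤ g s) → 0 ≤ t → t ≤ t' → t' ≤ T →
        besovNorm p (β + α * κ) (emb (src p α ν G t t')) ≤
          ENNReal.ofReal (C * ∫ s in t..t', (s - t) ^ (-κ) * g s) := by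
  obtain ⟨C, hC, hb⟩ := norm_bl_comp_U_besov ν hspan hα hp T hκ0 hκ1.le β
  refine ⟨C, hC, fun G g t t' hG hg hGg ht htt' ht'T => besovNorm_le fun k =>
    ⟨_, (block_emb hp k _).symm, ?_⟩⟩
  rw [src, src_comp ν hspan hα hp hβ hβ' hG ht le_rfl htt' ht'T]
  have h1 : ‖∫ s in t..t', Pm p α ν (s - t) (G s) ∘L op fun z => (p k z : ℂ)‖ ≤
      ∫ s in t..t', lam k ^ (-(β + α * κ)) * C * ((s - t) ^ (-κ) * g s) := by
    refine intervalIntegral.norm_integral_le_of_norm_le htt' (ae_of_all _ fun s hs => ?_)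
      ((intervalIntegrable_sub_rpow_mul hκ1 t hg).const_mul _)
    have hsI : s ∈ Icc 0 T := ⟨ht.trans hs.1.le, hs.2.trans ht'T⟩
    have hst : 0 < s - t := sub_pos.2 hs.1
    rw [Pm_comp_block ν hspan hα hp hβ hst (hG.1 s hsI)]
    refine (hb (s - t) k _ hst (by linarith [hs.2]) (hG.1 s hsI)).trans ?_
    have h2 : 0 ≤ lam k ^ (-(β + α * κ)) := Real.rpow_nonneg (lam_pos k).le _
    have h3 : 0 ≤ (s - t) ^ (-κ) := Real.rpow_nonneg hst.le _
    calc lam k ^ (-(β + α * κ)) * (C * (s - t) ^ (-κ) * bn p β (G s))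
        ≤ lam k ^ (-(β + α * κ)) * (C * (s - t) ^ (-κ) * g s) :=
          mul_le_mul_of_nonneg_left (mul_le_mul_of_nonneg_left (hGg s hsI)
            (mul_nonneg hC h3)) h2
      _ = _ := by ring
  rw [intervalIntegral.integral_const_mul, mul_assoc] at h1
  exact h1

lemma src_sub (hβ : -α < β) (hβ' : β < 0) (hG : ContB p T β G) (hH : ContB p T β H) {t t' : ℝ}
    (ht : 0 ≤ t) (htt' : t ≤ t') (ht'T : t' ≤ T) :
    src p α ν (fun s => G s - H s) t t' = src p α ν G t t' - src p α ν H t t' := by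
  rw [src, src, src, ← intervalIntegral.integral_sub
    (intervalIntegrable_Pm ν hspan hα hp hβ hβ' hG ht le_rfl htt' ht'T)
    (intervalIntegrable_Pm ν hspan hα hp hβ hβ' hH ht le_rfl htt' ht'T)]
  refine intervalIntegral.integral_congr_ae (ae_of_all _ fun s hs => ?_)
  rw [uIoc_of_le htt'] at hs
  have hsI : s ∈ Icc 0 T := ⟨ht.trans hs.1.le, hs.2.trans ht'T⟩
  exact Pm_sub ν hspan hα hp hβ (sub_pos.2 hs.1) (hG.1 s hsI) (hH.1 s hsI)

/-- The flow property of the source term. -/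
lemma src_split (hβ : -α < β) (hβ' : β < 0) (hG : ContB p T β G) {t t' : ℝ}
    (ht : 0 ≤ t) (htt' : t ≤ t') (ht'T : t' ≤ T) :
    src p α ν G t T = src p α ν G t' T ∘L U α ν (t' - t) + src p α ν G t t' := by
  have hI1 := intervalIntegrable_Pm ν hspan hα hp hβ hβ' hG ht le_rfl htt' ht'T
  have hI2 := intervalIntegrable_Pm ν hspan hα hp hβ hβ' hG ht htt' ht'T le_rfl
  rw [src, ← intervalIntegral.integral_add_adjacent_intervals hI1 hI2, add_comm]
  congr 1
  rw [src, src_comp ν hspan hα hp hβ hβ' hG (ht.trans htt') le_rfl ht'T le_rfl]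
  refine intervalIntegral.integral_congr_ae (ae_of_all _ fun s hs => ?_)
  rw [uIoc_of_le ht'T] at hs
  have hsI : s ∈ Icc 0 T := ⟨(ht.trans htt').trans hs.1.le, hs.2⟩
  rw [← Pm_add ν hspan hα hp hβ (sub_pos.2 hs.1) (sub_nonneg.2 htt') (hG.1 s hsI)]
  congr 1
  ring

/-- Time regularity of the semigroup, with loss of regularity in space. -/
lemma besovNorm_comp_U_sub_one {θ σ : ℝ} (hσ0 : 0 ≤ σ) (hσ1 : σ ≤ 1) : ∃ C, 0 ≤ C ∧
    ∀ (h : ℝ) (x : XD d), 0 ≤ h → besovNorm p (θ + α * σ) (emb x) < ⊤ →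
      besovNorm p θ (emb (x ∘L (U α ν h - 1))) ≤
        ENNReal.ofReal (C * h ^ σ * bn p (θ + α * σ) (emb x)) := by
  obtain ⟨C, hC, hb⟩ := norm_bl_comp_U_sub_one ν hspan hα hp
  obtain ⟨C', hC'⟩ := hp.isMul_block
  refine ⟨C, hC, fun h x hh hx => besovNorm_le fun n => ⟨_, (block_emb hp n _).symm, ?_⟩⟩
  have e : (x ∘L (U α ν h - 1)) ∘L op (fun z => (p n z : ℂ)) = bl p n (emb x) ∘L (U α ν h - 1) := by
    rw [bl_emb hp, ContinuousLinearMap.comp_assoc, ContinuousLinearMap.comp_assoc]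
    congr 1
    rw [ContinuousLinearMap.sub_comp, ContinuousLinearMap.comp_sub,
      U_comm_op ν hspan hα (hC' n) hh]
    rfl
  rw [e]
  have hl := lam_pos n
  refine (hb h n _ hh (hasBlocks_emb hp x)).trans ?_
  have h1 : 0 ≤ h * lam n ^ α := mul_nonneg hh (Real.rpow_nonneg hl.le _)
  have h2 := min_one_le_rpow h1 hσ0 hσ1
  calc C * min 1 (h * lam n ^ α) * ‖bl p n (emb x)‖
      ≤ C * (h * lam n ^ α) ^ σ * (lam n ^ (-(θ + α * σ)) * bn p (θ + α * σ) (emb x)) :=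
        mul_le_mul (mul_le_mul_of_nonneg_left h2 hC) (norm_bl_le hx n) (norm_nonneg _)
          (mul_nonneg hC (Real.rpow_nonneg h1 _))
    _ = _ := by
        rw [Real.mul_rpow hh (Real.rpow_nonneg hl.le _), ← Real.rpow_mul hl.le,
          show -θ = α * σ + -(θ + α * σ) by ring, Real.rpow_add hl]
        ring

omit hspan hα in
lemma bl_comp_of_comm {x : XD d} {A : L1 d →L[ℂ] L1 d} {n : ℕ}
    (h : A ∘L (op fun z => (p n z : ℂ)) = (op fun z => (p n z : ℂ)) ∘L A) :
    bl p n (emb (x ∘L A)) = bl p n (emb x) ∘L A := by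
  rw [bl_emb hp, bl_emb hp, ContinuousLinearMap.comp_assoc, h, ContinuousLinearMap.comp_assoc]

lemma bl_comp_U {x : XD d} {h : ℝ} (hh : 0 ≤ h) (n : ℕ) :
    bl p n (emb (x ∘L U α ν h)) = bl p n (emb x) ∘L U α ν h := by
  obtain ⟨C', hC'⟩ := hp.isMul_block
  exact bl_comp_of_comm hp (U_comm_op ν hspan hα (hC' n) hh)

lemma besovNorm_comp_U (θ : ℝ) : ∃ C, 1 ≤ C ∧ ∀ (h : ℝ) (x : XD d), 0 ≤ h →
    besovNorm p θ (emb x) < ⊤ →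
      besovNorm p θ (emb (x ∘L U α ν h)) ≤ ENNReal.ofReal (C * bn p θ (emb x)) := by
  obtain ⟨C, hC, hU⟩ := norm_U_le ν hspan hα
  refine ⟨C, hC, fun h x hh hx => besovNorm_le fun n =>
    ⟨_, (hasBlocks_emb hp _).emb_bl n, ?_⟩⟩
  rw [bl_comp_U ν hspan hα hp hh]
  calc ‖bl p n (emb x) ∘L U α ν h‖ ≤ (lam n ^ (-θ) * bn p θ (emb x)) * C :=
        (ContinuousLinearMap.opNorm_comp_le _ _).trans (mul_le_mul (norm_bl_le hx n) (hU h hh)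
          (norm_nonneg _) (mul_nonneg (Real.rpow_nonneg (lam_pos n).le _) bn_nonneg))
    _ = _ := by ring

/-- The semigroup is strongly continuous on `𝒞^θ`. -/
lemma memCT_terminal {θ : ℝ} {x : XD d} (hx : MemC p θ (emb x)) :
    MemCT p T θ fun t => emb (x ∘L U α ν (T - t)) := by
  have hα0 : 0 < α := by linarith [hα.1]
  obtain ⟨CU, hCU, hU⟩ := norm_U_le ν hspan hα
  obtain ⟨C, hC, hb⟩ := norm_bl_comp_U_sub_one ν hspan hα hp
  have hbl := hx.tendsto_bl
  have hfin := hx.1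
  have hmem : ∀ t ∈ Icc 0 T, MemC p θ (emb (x ∘L U α ν (T - t))) := by
    intro t ht
    have hTt : 0 ≤ T - t := sub_nonneg.2 ht.2
    refine memC_of_little (C := CU * bn p θ (emb x))
      (ε := fun n => CU * (lam n ^ θ * ‖bl p n (emb x)‖)) (by simpa using hbl.const_mul CU)
      (fun n => ?_) fun n => ⟨_, (hasBlocks_emb hp _).emb_bl n, ?_⟩
    · refine mul_le_mul_of_nonneg_left ?_ (by linarith)
      have := mul_le_mul_of_nonneg_left (norm_bl_le hfin n) (Real.rpow_nonneg (lam_pos n).le θ)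
      rw [← mul_assoc, ← Real.rpow_add (lam_pos n), add_neg_cancel, Real.rpow_zero, one_mul] at this
      exact this
    · rw [bl_comp_U ν hspan hα hp hTt, mul_left_comm, ← mul_assoc (lam n ^ (-θ)),
        ← Real.rpow_add (lam_pos n), neg_add_cancel, Real.rpow_zero, one_mul, mul_comm]
      exact (ContinuousLinearMap.opNorm_comp_le _ _).trans
        (mul_le_mul_of_nonneg_left (hU _ hTt) (norm_nonneg _))
  refine ContB.memCT ⟨fun t ht => (hmem t ht).1, fun t ht => ?_⟩ hmem
  -- High blocks are uniformly small by the vanishing condition in `𝒞^θ`; the finitely many low ones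
  -- are handled by `h * lam N ^ α`. Finiteness of the Besov norm alone would not give strong
  -- continuity.
  have key : ∀ ε > 0, ∃ δ > 0, ∀ h, 0 ≤ h → h < δ → ∀ n,
      C * min 1 (h * lam n ^ α) * ‖bl p n (emb x)‖ ≤ lam n ^ (-θ) * ε := by
    intro ε hε
    have h1 := (hbl.const_mul C).eventually (gt_mem_nhds (by simpa using hε : C * 0 < ε))
    obtain ⟨N, hN⟩ := eventually_atTop.1 h1
    have hb0 : 0 ≤ bn p θ (emb x) := bn_nonneg
    have hlN : 0 < lam N ^ α := Real.rpow_pos_of_pos (lam_pos N) _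
    refine ⟨ε / (lam N ^ α * (C * bn p θ (emb x) + 1)), by positivity, fun h hh hδ n => ?_⟩
    have hl := lam_pos n
    have hln : 0 ≤ h * lam n ^ α := mul_nonneg hh (Real.rpow_nonneg hl.le _)
    rcases le_or_gt N n with hn | hn
    · have h2 := (hN n hn).le
      have h3 : min 1 (h * lam n ^ α) ≤ 1 := min_le_left _ _
      calc C * min 1 (h * lam n ^ α) * ‖bl p n (emb x)‖ ≤ C * 1 * ‖bl p n (emb x)‖ := by gcongr
        _ = lam n ^ (-θ) * (C * (lam n ^ θ * ‖bl p n (emb x)‖)) := by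
            rw [mul_left_comm, ← mul_assoc (lam n ^ (-θ)), ← Real.rpow_add hl, neg_add_cancel,
              Real.rpow_zero]
            ring
        _ ≤ _ := mul_le_mul_of_nonneg_left h2 (Real.rpow_nonneg hl.le _)
    · have h3 : min 1 (h * lam n ^ α) ≤ h * lam N ^ α := (min_le_right _ _).trans
        (mul_le_mul_of_nonneg_left (Real.rpow_le_rpow hl.le (lam_mono hn.le) hα0.le) hh)
      have h4 : h * lam N ^ α * (C * bn p θ (emb x) + 1) ≤ ε := by
        rw [lt_div_iff₀ (by positivity)] at hδ
        linarith
      calc C * min 1 (h * lam n ^ α) * ‖bl p n (emb x)‖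
          ≤ C * (h * lam N ^ α) * (lam n ^ (-θ) * bn p θ (emb x)) :=
            mul_le_mul (mul_le_mul_of_nonneg_left h3 hC) (norm_bl_le hfin n) (norm_nonneg _)
              (by positivity)
        _ = lam n ^ (-θ) * (h * lam N ^ α * (C * bn p θ (emb x))) := by ring
        _ ≤ _ := by
            refine mul_le_mul_of_nonneg_left (le_trans ?_ h4) (Real.rpow_nonneg hl.le _)
            exact mul_le_mul_of_nonneg_left (by linarith) (by positivity)
  have main : ∀ ε > 0, ∃ δ > 0, ∀ a b, 0 ≤ a → a ≤ b → b - a < δ →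
      bn p θ (emb (x ∘L U α ν b) - emb (x ∘L U α ν a)) ≤ CU * ε := by
    intro ε hε
    obtain ⟨δ, hδ, hk⟩ := key ε hε
    refine ⟨δ, hδ, fun a b ha hab hlt => bn_le (by positivity) fun n => ?_⟩
    refine ⟨(bl p n (emb x) ∘L (U α ν (b - a) - 1)) ∘L U α ν a, ?_, ?_⟩
    · rw [block_sub, ← (hasBlocks_emb hp _).emb_bl, ← (hasBlocks_emb hp _).emb_bl, ← map_sub,
        bl_comp_U ν hspan hα hp ha, bl_comp_U ν hspan hα hp (ha.trans hab)]
      congr 1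
      have : b = (b - a) + a := by ring
      conv_rhs => rw [this, U_add ν hspan hα (by linarith) ha]
      ext f
      simp
    · calc _ ≤ (lam n ^ (-θ) * ε) * CU :=
            (ContinuousLinearMap.opNorm_comp_le _ _).trans (mul_le_mul
              ((hb _ n _ (by linarith) (hasBlocks_emb hp x)).trans (hk _ (by linarith) hlt n))
              (hU a ha) (norm_nonneg _)
              (mul_nonneg (Real.rpow_nonneg (lam_pos n).le _) hε.le))
        _ = _ := by ring
  rw [Metric.tendsto_nhdsWithin_nhds]
  intro ε hε
  obtain ⟨δ, hδ, hm⟩ := main (ε / (2 * CU)) (by positivity)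
  refine ⟨δ, hδ, fun s hs hd => ?_⟩
  rw [Real.dist_eq] at hd
  rw [Real.dist_eq, sub_zero, abs_of_nonneg bn_nonneg]
  have hlt : CU * (ε / (2 * CU)) < ε := by
    have : CU * (ε / (2 * CU)) = ε / 2 := by field_simp
    rw [this]; linarith
  refine lt_of_le_of_lt ?_ hlt
  rcases le_total s t with h | h
  · refine hm (T - t) (T - s) (by linarith [ht.2]) (by linarith) ?_
    rw [abs_of_nonpos (by linarith)] at hd
    linarith
  · rw [← bn_neg, neg_sub]
    refine hm (T - s) (T - t) (by linarith [hs.2]) (by linarith) ?_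
    rw [abs_of_nonneg (by linarith)] at hd
    linarith

/-- The source term is a continuous curve in `𝒞^θ`. -/
lemma memCT_src (hβ : -α < β) (hβ' : β < 0) {θ : ℝ} (h0 : 0 ≤ θ) (hθ : θ < β + α)
    (hG : ContB p T β G) : MemCT p T θ fun t => emb (src p α ν G t T) := by
  have hα0 : 0 < α := by linarith [hα.1]
  set κ := (θ - β) / α with hκ
  have hκ0 : 0 ≤ κ := div_nonneg (by linarith) hα0.le
  have hκ1 : κ < 1 := (div_lt_one hα0).2 (by linarith)
  have hθκ : β + α * κ = θ := by rw [hκ]; field_simp; ring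
  -- Because `θ < β + α`, the source term is bounded even in regularity `θ + α σ`. The surplus gives
  -- both the vanishing of high blocks and a rate of continuity in time.
  set σ := (1 - κ) / 2 with hσ
  have hσ0 : 0 < σ := by rw [hσ]; linarith
  have hσ1 : σ ≤ 1 := by rw [hσ]; linarith
  have hκσ : κ + σ < 1 := by rw [hσ]; linarith
  have hθσ : β + α * (κ + σ) = θ + α * σ := by rw [mul_add, ← add_assoc, hθκ]
  obtain ⟨K, hK, hGK⟩ := hG.bounded
  obtain ⟨C1, hC1, h1⟩ := besovNorm_src_le ν hspan hα hp (T := T) hβ hβ' hκ0 hκ1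
  obtain ⟨C2, hC2, h2⟩ := besovNorm_src_le ν hspan hα hp (T := T) hβ hβ' (by linarith : 0 ≤ κ + σ) hκσ
  obtain ⟨C3, hC3, h3⟩ := besovNorm_comp_U_sub_one ν hspan hα hp (θ := θ) hσ0.le hσ1
  rw [hθκ] at h1
  rw [hθσ] at h2
  set B := C2 * (T ^ (1 - (κ + σ)) / (1 - (κ + σ)) * K) with hB
  have hT0 : ∀ t ∈ Icc 0 T, 0 ≤ T := fun t ht => ht.1.trans ht.2
  have hreg : ∀ t ∈ Icc 0 T, besovNorm p (θ + α * σ) (emb (src p α ν G t T)) ≤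
      ENNReal.ofReal B := by
    intro t ht
    refine (h2 G (fun _ => K) t T hG continuous_const hGK ht.1 ht.2 le_rfl).trans
      (ENNReal.ofReal_le_ofReal ?_)
    rw [intervalIntegral.integral_mul_const, integral_sub_rpow hκσ]
    refine mul_le_mul_of_nonneg_left (mul_le_mul_of_nonneg_right ?_ hK) hC2
    exact div_le_div_of_nonneg_right (Real.rpow_le_rpow (by linarith [ht.2]) (by linarith [ht.1])
      (by linarith)) (by linarith)
  have hB0 : ∀ t ∈ Icc 0 T, 0 ≤ B := fun t ht => mul_nonneg hC2 (mul_nonneg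
    (div_nonneg (Real.rpow_nonneg (hT0 t ht) _) (by linarith)) hK)
  have hbn : ∀ t ∈ Icc 0 T, bn p (θ + α * σ) (emb (src p α ν G t T)) ≤ B := fun t ht =>
    bn_le_of_besovNorm_le (hB0 t ht) (hreg t ht)
  have hασ : 0 < α * σ := mul_pos hα0 hσ0
  have hmem : ∀ t ∈ Icc 0 T, MemC p θ (emb (src p α ν G t T)) := by
    intro t ht
    have hlt : -(α * σ) < 0 := by linarith
    refine memC_of_little (C := 2 ^ (α * σ) * B) (ε := fun n => lam n ^ (-(α * σ)) * B)
      (by simpa using (lam_rpow_tendsto hlt).mul_const B) (fun n => ?_)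
      fun n => ⟨_, (hasBlocks_emb hp _).emb_bl n, ?_⟩
    · refine mul_le_mul_of_nonneg_right ?_ (hB0 t ht)
      rw [Real.rpow_neg (lam_pos n).le, inv_le_iff_one_le_mul₀ (Real.rpow_pos_of_pos (lam_pos n) _),
        ← Real.mul_rpow two_pos.le (lam_pos n).le]
      exact Real.one_le_rpow (one_le_lam_mul n) hασ.le
    · refine (norm_bl_le ((hreg t ht).trans_lt ENNReal.ofReal_lt_top) n).trans ?_
      rw [neg_add, Real.rpow_add (lam_pos n), mul_assoc]
      refine mul_le_mul_of_nonneg_left (mul_le_mul_of_nonneg_left (hbn t ht) ?_) ?_ <;>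
        exact Real.rpow_nonneg (lam_pos n).le _
  refine ContB.memCT ⟨fun t ht => (hmem t ht).1, fun t ht => ?_⟩ hmem
  -- A modulus of continuity: the first term is `P_h - 1` acting on the later value, the second is
  -- the source accumulated over the time step.
  set w : ℝ → ℝ := fun h => C3 * h ^ σ * B + C1 * (h ^ (1 - κ) / (1 - κ) * K) with hω
  have main : ∀ a ∈ Icc 0 T, ∀ b ∈ Icc 0 T, a ≤ b →
      bn p θ (emb (src p α ν G a T) - emb (src p α ν G b T)) ≤ w (b - a) := by
    intro a ha b hb hab
    have e1 : emb (src p α ν G a T) - emb (src p α ν G b T) =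
        emb (src p α ν G b T ∘L (U α ν (b - a) - 1)) + emb (src p α ν G a b) := by
      rw [src_split ν hspan hα hp hβ hβ' hG ha.1 hab hb.2, ← map_sub, ← map_add]
      congr 1
      rw [ContinuousLinearMap.comp_sub]
      have : src p α ν G b T ∘L (1 : L1 d →L[ℂ] L1 d) = src p α ν G b T := by ext; rfl
      rw [this]
      abel
    rw [e1]
    have i1 := h3 (b - a) (src p α ν G b T) (by linarith)
      ((hreg b hb).trans_lt ENNReal.ofReal_lt_top)
    have i2 := h1 G (fun _ => K) a b hG continuous_const hGK ha.1 hab hb.2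
    have hba : 0 ≤ b - a := by linarith
    rw [intervalIntegral.integral_mul_const, integral_sub_rpow hκ1] at i2
    refine (bn_add_le (i1.trans_lt ENNReal.ofReal_lt_top)
      (i2.trans_lt ENNReal.ofReal_lt_top)).trans (add_le_add ?_ ?_)
    · refine (bn_le_of_besovNorm_le ?_ i1).trans ?_
      · exact mul_nonneg (mul_nonneg hC3 (Real.rpow_nonneg hba _)) bn_nonneg
      · exact mul_le_mul_of_nonneg_left (hbn b hb) (mul_nonneg hC3 (Real.rpow_nonneg hba _))
    · exact bn_le_of_besovNorm_le (mul_nonneg hC1 (mul_nonneg (div_nonneg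
        (Real.rpow_nonneg hba _) (by linarith)) hK)) i2
  have hlim : Tendsto (fun s => w |s - t|) (𝓝[Icc 0 T] t) (𝓝 0) := by
    have hc : Continuous w := by
      refine Continuous.add ?_ ?_
      · exact (continuous_const.mul (Real.continuous_rpow_const hσ0.le)).mul continuous_const
      · exact continuous_const.mul (((Real.continuous_rpow_const (by linarith)).div_const _).mul
          continuous_const)
    have h4 : Tendsto (fun s => w |s - t|) (𝓝 t) (𝓝 (w |t - t|)) :=
      (hc.comp (by fun_prop : Continuous fun s : ℝ => |s - t|)).tendsto t
    have h5 : w |t - t| = 0 := by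
      simp only [hω, sub_self, abs_zero]
      rw [Real.zero_rpow hσ0.ne', Real.zero_rpow (by linarith : 1 - κ ≠ 0)]
      simp
    rw [h5] at h4
    exact h4.mono_left nhdsWithin_le_nhds
  refine squeeze_zero' (Filter.Eventually.of_forall fun _ => bn_nonneg) ?_ hlim
  filter_upwards [self_mem_nhdsWithin] with s hs
  rcases le_total s t with h | h
  · rw [abs_of_nonpos (by linarith), neg_sub]
    exact main s hs t ht h
  · rw [abs_of_nonneg (by linarith), ← bn_neg, neg_sub]
    exact main t ht s hs h

end Source

/-! ### The transport term along curves, and limits of curves -/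

section Product

variable {p : ℕ → Rd d → ℝ} (hp : IsDyadicPartition p) {T β θ : ℝ} {V : ℝ → Fin d → Distr d}

lemma ContB.exists_common_bound (hV : ∀ i, ContB p T β fun t => V t i) :
    ∃ A, 0 ≤ A ∧ ∀ t ∈ Icc 0 T, ∀ i, bn p β (V t i) ≤ A := by
  choose K hK hb using fun i => (hV i).bounded
  refine ⟨∑ i, K i, Finset.sum_nonneg fun i _ => hK i, fun t ht i => (hb i t ht).trans ?_⟩
  exact Finset.single_le_sum (f := K) (fun i _ => hK i) (Finset.mem_univ i)

lemma besovNorm_le_ofReal {u : Distr d} {A : ℝ} (hu : besovNorm p β u < ⊤) (h : bn p β u ≤ A) :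
    besovNorm p β u ≤ ENNReal.ofReal A := by
  rw [← ofReal_bn hu]
  exact ENNReal.ofReal_le_ofReal h

include hp

/-- The transport term is a continuous curve. -/
lemma contB_dotGrad (hβ : β < 0) (hβ2 : -2 < β) (hθ : 1 - β < θ) {u : ℝ → Distr d}
    (hV : ∀ i, ContB p T β fun t => V t i) (hu : ContB p T θ u) :
    ContB p T β fun t => dotGrad p (V t) (u t) := by
  obtain ⟨C, hC, hb⟩ := besovNorm_dotGrad_le hp hβ hβ2 hθ
  obtain ⟨A, hA, hVA⟩ := ContB.exists_common_bound hV
  have hVA' : ∀ t ∈ Icc 0 T, ∀ i, besovNorm p β (V t i) ≤ ENNReal.ofReal A := fun t ht i =>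
    besovNorm_le_ofReal ((hV i).1 t ht) (hVA t ht i)
  refine ⟨fun t ht => (hb _ _ A (hVA' t ht) hA (hu.1 t ht)).trans_lt ENNReal.ofReal_lt_top,
    fun t ht => ?_⟩
  have hlim : Tendsto (fun s => C * A * bn p θ (u s - u t) +
      C * (∑ i, bn p β (V s i - V t i)) * bn p θ (u t)) (𝓝[Icc 0 T] t) (𝓝 0) := by
    have h1 := ((hu.2 t ht).const_mul (C * A)).add
      (((tendsto_finsetSum Finset.univ fun i _ => (hV i).2 t ht).const_mul C).mul_const
        (bn p θ (u t)))
    simpa using h1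
  refine squeeze_zero' (Filter.Eventually.of_forall fun _ => bn_nonneg) ?_ hlim
  filter_upwards [self_mem_nhdsWithin] with s hs
  have e : dotGrad p (V s) (u s) - dotGrad p (V t) (u t) =
      dotGrad p (V s) (u s - u t) + dotGrad p (fun i => V s i - V t i) (u t) := by
    rw [dotGrad_sub_right hp hβ hβ2 hθ (fun i => (hV i).1 s hs) (hu.1 s hs) (hu.1 t ht),
      dotGrad_sub_left hp hβ hβ2 hθ (fun i => (hV i).1 s hs) (fun i => (hV i).1 t ht) (hu.1 t ht)]
    abel
  have hnn : ∀ i ∈ (Finset.univ : Finset (Fin d)), 0 ≤ bn p β (V s i - V t i) :=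
    fun i _ => bn_nonneg
  have hus := besovNorm_sub_lt (hu.1 s hs) (hu.1 t ht)
  have i1 := hb (V s) (u s - u t) A (hVA' s hs) hA hus
  have i2 := hb (fun i => V s i - V t i) (u t) (∑ i, bn p β (V s i - V t i))
    (fun i => besovNorm_le_ofReal (besovNorm_sub_lt ((hV i).1 s hs) ((hV i).1 t ht))
      (Finset.single_le_sum (f := fun i => bn p β (V s i - V t i)) hnn (Finset.mem_univ i)))
    (Finset.sum_nonneg hnn) (hu.1 t ht)
  rw [e]
  refine (bn_add_le (i1.trans_lt ENNReal.ofReal_lt_top)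
    (i2.trans_lt ENNReal.ofReal_lt_top)).trans (add_le_add ?_ ?_)
  · exact bn_le_of_besovNorm_le (mul_nonneg (mul_nonneg hC hA) bn_nonneg) i1
  · exact bn_le_of_besovNorm_le
      (mul_nonneg (mul_nonneg hC (Finset.sum_nonneg hnn)) bn_nonneg) i2

/-- Closed balls of `B^θ_{∞,∞}` are closed under uniform convergence. -/
lemma besovNorm_le_of_tendsto {y : ℕ → XD d} {x : XD d} {B : ℝ} (hB : 0 ≤ B)
    (hy : Tendsto y atTop (𝓝 x))
    (h : ∀ᶠ n in atTop, besovNorm p θ (emb (y n)) ≤ ENNReal.ofReal B) :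
    besovNorm p θ (emb x) ≤ ENNReal.ofReal B := by
  refine besovNorm_le fun n => ⟨_, (hasBlocks_emb hp x).emb_bl n, ?_⟩
  have h1 : Tendsto (fun k => ‖bl p n (emb (y k))‖) atTop (𝓝 ‖bl p n (emb x)‖) := by
    simp only [bl_emb hp]
    exact ((((ContinuousLinearMap.compL ℂ (L1 d) (L1 d) ℂ).flip
      (op fun z => (p n z : ℂ))).continuous.tendsto x).comp hy).norm
  refine le_of_tendsto h1 ?_
  filter_upwards [h] with k hk
  refine (norm_bl_le (hk.trans_lt ENNReal.ofReal_lt_top) n).trans ?_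
  exact mul_le_mul_of_nonneg_left (bn_le_of_besovNorm_le hB hk)
    (Real.rpow_nonneg (lam_pos n).le _)

lemma rep_emb (hθ : 0 < θ) {x : XD d} (hx : besovNorm p θ (emb x) < ⊤) : rep p (emb x) = x :=
  emb_injective (emb_rep hp hθ hx)

end Product

/-- Hölder norms of curves of bounded functions. -/
lemma holderNorm_emb_le {T ρ H B : ℝ} {x : ℝ → XD d} {u : ℝ → Distr d} (hH : 0 ≤ H) (hB : 0 ≤ B)
    (hu : ∀ t ∈ Icc 0 T, u t = emb (x t))
    (h : ∀ s ∈ Icc 0 T, ∀ t ∈ Icc 0 T, s < t → ‖x t - x s‖ ≤ H * (t - s) ^ ρ)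
    (h' : ∀ t ∈ Icc 0 T, ‖x t‖ ≤ B) : holderNorm T ρ u ≤ ENNReal.ofReal (H + B) := by
  rw [holderNorm, ENNReal.ofReal_add hH hB]
  refine add_le_add ?_ ?_
  · refine iSup₂_le fun s hs => iSup₂_le fun t ht => iSup_le fun hst => ?_
    have hpos : 0 < (t - s) ^ ρ := Real.rpow_pos_of_pos (sub_pos.2 hst) _
    refine ENNReal.div_le_of_le_mul ?_
    rw [hu s hs, hu t ht, ← map_sub, linftyNorm_emb, ← ENNReal.ofReal_mul hH,
      ← ofReal_norm]
    exact ENNReal.ofReal_le_ofReal (h s hs t ht hst)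
  · refine iSup₂_le fun t ht => ?_
    rw [hu t ht, linftyNorm_emb, ← ofReal_norm]
    exact ENNReal.ofReal_le_ofReal (h' t ht)

/-! ### The mild formula and its regularity in time and space -/

/-- The mild formula `P_{T-t} x + ∫_t^T P_{s-t} G_s ds`. -/
def mild (p : ℕ → Rd d → ℝ) (α : ℝ) (ν : Measure (Metric.sphere (0 : Rd d) 1)) (T : ℝ) (x : XD d)
    (G : ℝ → Distr d) (t : ℝ) : XD d := x ∘L U α ν (T - t) + src p α ν G t T

section Mild

variable (ν : Measure (Metric.sphere (0 : Rd d) 1)) [IsFiniteMeasure ν]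
  (hspan : Submodule.span ℝ
      ((fun ξ : Metric.sphere (0 : Rd d) 1 => (ξ : Rd d)) '' ν.support) = ⊤)
  {α : ℝ} (hα : α ∈ Ioc (1 : ℝ) 2) {p : ℕ → Rd d → ℝ} (hp : IsDyadicPartition p)
  {T β θ : ℝ} (hβ : -α < β) (hβ' : β < 0) (h0 : 0 < θ) (hθ : θ < β + α)
  {G H : ℝ → Distr d}

include hspan hα hp hβ hβ'

/-- Restarting at the later time `t'` expresses an increment through the known regularity of the
value at `t'` and a source over the short interval only. -/
lemma mild_flow (x : XD d) (hG : ContB p T β G) {t t' : ℝ} (ht : 0 ≤ t) (htt' : t ≤ t')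
    (ht'T : t' ≤ T) : mild p α ν T x G t =
      mild p α ν T x G t' ∘L U α ν (t' - t) + src p α ν G t t' := by
  rw [mild, mild, src_split ν hspan hα hp hβ hβ' hG ht htt' ht'T,
    show T - t = (T - t') + (t' - t) by ring,
    U_add ν hspan hα (sub_nonneg.2 ht'T) (sub_nonneg.2 htt'), ContinuousLinearMap.add_comp,
    ContinuousLinearMap.comp_assoc, add_assoc]

lemma mild_sub (x y : XD d) (hG : ContB p T β G) (hH : ContB p T β H) {t : ℝ} (ht : t ∈ Icc 0 T) :
    mild p α ν T (x - y) (fun s => G s - H s) t = mild p α ν T x G t - mild p α ν T y H t := by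
  rw [mild, mild, mild, src_sub ν hspan hα hp hβ hβ' hG hH ht.1 ht.2 le_rfl,
    ContinuousLinearMap.sub_comp]
  abel

include h0 hθ

lemma memCT_mild {x : XD d} (hx : MemC p θ (emb x)) (hG : ContB p T β G) :
    MemCT p T θ fun t => emb (mild p α ν T x G t) := by
  have h1 := memCT_terminal ν hspan hα hp (T := T) hx
  have h2 := memCT_src ν hspan hα hp hβ hβ' h0.le hθ hG
  simp only [mild, map_add]
  exact (h1.contB.add h2.contB).memCT fun t ht => (h1.1 t ht).add (h2.1 t ht)

/-- Time regularity in the uniform norm. -/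
lemma norm_mild_sub_le : ∃ C, 0 ≤ C ∧ ∀ (x : XD d) (G : ℝ → Distr d) (N K t t' : ℝ),
    ContB p T β G → (∀ s ∈ Icc 0 T, bn p β (G s) ≤ K) →
    (∀ s ∈ Icc 0 T, besovNorm p θ (emb (mild p α ν T x G s)) ≤ ENNReal.ofReal N) →
    0 ≤ N → 0 ≤ t → t ≤ t' → t' ≤ T →
      ‖mild p α ν T x G t' - mild p α ν T x G t‖ ≤ C * (N + K) * (t' - t) ^ (θ / α) := by
  have hα0 : 0 < α := by linarith [hα.1]
  obtain ⟨C1, hC1, h1⟩ := norm_comp_U_sub_one ν hspan hα hp h0 (by linarith)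
  -- With `κ = 1 - θ / α` the source over `[t, t']` is of order `(t' - t) ^ (θ / α)`, the same as
  -- the semigroup increment; `θ < β + α` is what lets this `κ` reach bounded functions.
  have hκ0 : 0 ≤ 1 - θ / α := sub_nonneg.2 ((div_le_one hα0).2 (by linarith))
  have hκ1 : 1 - θ / α < 1 := by have := div_pos h0 hα0; linarith
  have hκ : 0 < β + α * (1 - θ / α) := by
    have : α * (1 - θ / α) = α - θ := by field_simp
    rw [this]; linarith
  obtain ⟨C2, hC2, h2⟩ := norm_src_le ν hspan hα hp (T := T) hκ0 hκ1 hκ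
  refine ⟨C1 + C2, add_nonneg hC1 hC2, fun x G N K t t' hG hGK hN hN0 ht htt' ht'T => ?_⟩
  have ht' : t' ∈ Icc 0 T := ⟨ht.trans htt', ht'T⟩
  have hK : 0 ≤ K := bn_nonneg.trans (hGK t' ht')
  have hpw : 0 ≤ (t' - t) ^ (θ / α) := Real.rpow_nonneg (sub_nonneg.2 htt') _
  have i1 := h1 (t' - t) (mild p α ν T x G t') (sub_nonneg.2 htt')
    ((hN t' ht').trans_lt ENNReal.ofReal_lt_top)
  have i2 := h2 G K t t' hG hGK ht htt' ht'T
  rw [sub_sub_cancel] at i2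
  have e : mild p α ν T x G t - mild p α ν T x G t' =
      mild p α ν T x G t' ∘L (U α ν (t' - t) - 1) + src p α ν G t t' := by
    rw [mild_flow ν hspan hα hp hβ hβ' x hG ht htt' ht'T, ContinuousLinearMap.comp_sub]
    have : mild p α ν T x G t' ∘L (1 : L1 d →L[ℂ] L1 d) = mild p α ν T x G t' := by ext; rfl
    rw [this]
    abel
  rw [norm_sub_rev, e]
  have i3 := bn_le_of_besovNorm_le hN0 (hN t' ht')
  calc _ ≤ C1 * (t' - t) ^ (θ / α) * N + C2 * K * (t' - t) ^ (θ / α) :=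
        (norm_add_le _ _).trans (add_le_add (i1.trans
          (mul_le_mul_of_nonneg_left i3 (mul_nonneg hC1 hpw))) i2)
    _ ≤ C1 * (t' - t) ^ (θ / α) * (N + K) + C2 * (N + K) * (t' - t) ^ (θ / α) := by
        gcongr <;> linarith
    _ = _ := by ring

/-- The Hölder norm of a mild curve. -/
lemma holderNorm_mild_le : ∃ C, 0 ≤ C ∧ ∀ (x : XD d) (G u : ℝ → Distr d) (N K : ℝ),
    ContB p T β G → (∀ s ∈ Icc 0 T, bn p β (G s) ≤ K) → 0 ≤ K →
    (∀ s ∈ Icc 0 T, u s = emb (mild p α ν T x G s)) →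
    (∀ s ∈ Icc 0 T, besovNorm p θ (u s) ≤ ENNReal.ofReal N) →
    0 ≤ N → holderNorm T (θ / α) u ≤ ENNReal.ofReal (C * (N + K)) := by
  obtain ⟨C1, hC1, h1⟩ := norm_mild_sub_le ν hspan hα hp (T := T) hβ hβ' h0 hθ
  obtain ⟨C2, hC2, h2⟩ := norm_rep_le (p := p) h0
  refine ⟨C1 + C2, add_nonneg hC1 hC2, fun x G u N K hG hGK hK hu hN hN0 => ?_⟩
  have hN' : ∀ s ∈ Icc 0 T, besovNorm p θ (emb (mild p α ν T x G s)) ≤ ENNReal.ofReal N :=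
    fun s hs => by rw [← hu s hs]; exact hN s hs
  refine (holderNorm_emb_le (mul_nonneg hC1 (add_nonneg hN0 hK)) (mul_nonneg hC2 hN0) hu
    (fun s hs t ht hst => h1 x G N K s t hG hGK hN' hN0 hs.1 hst.le ht.2) fun t ht => ?_).trans ?_
  · have hlt := (hN' t ht).trans_lt ENNReal.ofReal_lt_top
    have := h2 _ hlt
    rw [rep_emb hp h0 hlt] at this
    exact this.trans (mul_le_mul_of_nonneg_left (bn_le_of_besovNorm_le hN0 (hN' t ht)) hC2)
  · refine ENNReal.ofReal_le_ofReal ?_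
    nlinarith [mul_nonneg hC2 hK]

/-- Regularity in space. -/
lemma besovNorm_mild_le : ∃ C, 1 ≤ C ∧ ∀ (x : XD d) (G : ℝ → Distr d) (g : ℝ → ℝ) (t : ℝ),
    besovNorm p θ (emb x) < ⊤ → ContB p T β G → Continuous g →
    (∀ s ∈ Icc 0 T, bn p β (G s) ≤ g s) → t ∈ Icc 0 T →
      besovNorm p θ (emb (mild p α ν T x G t)) ≤ ENNReal.ofReal (C * (bn p θ (emb x) +
        ∫ s in t..T, (s - t) ^ (-((θ - β) / α)) * g s)) := by
  have hα0 : 0 < α := by linarith [hα.1]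
  have hκ0 : 0 ≤ (θ - β) / α := div_nonneg (by linarith) hα0.le
  have hκ1 : (θ - β) / α < 1 := (div_lt_one hα0).2 (by linarith)
  have hθκ : β + α * ((θ - β) / α) = θ := by field_simp; ring
  obtain ⟨C1, hC1, h1⟩ := besovNorm_src_le ν hspan hα hp (T := T) hβ hβ' hκ0 hκ1
  obtain ⟨C2, hC2, h2⟩ := besovNorm_comp_U ν hspan hα hp θ
  rw [hθκ] at h1
  refine ⟨C1 + C2, by linarith, fun x G g t hx hG hg hGg ht => ?_⟩
  have hI : 0 ≤ ∫ s in t..T, (s - t) ^ (-((θ - β) / α)) * g s := by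
    refine intervalIntegral.integral_nonneg ht.2 fun s hs => mul_nonneg
      (Real.rpow_nonneg (sub_nonneg.2 hs.1) _) (bn_nonneg.trans (hGg s ⟨ht.1.trans hs.1, hs.2⟩))
  have hx0 : 0 ≤ bn p θ (emb x) := bn_nonneg
  rw [mild, map_add]
  refine (besovNorm_add_le _ _).trans ((add_le_add (h2 _ x (sub_nonneg.2 ht.2) hx)
    (h1 G g t T hG hg hGg ht.1 ht.2 le_rfl)).trans ?_)
  rw [← ENNReal.ofReal_add (mul_nonneg (by linarith) hx0) (mul_nonneg hC1 hI)]
  refine ENNReal.ofReal_le_ofReal ?_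
  nlinarith [mul_nonneg hC1 hx0, mul_nonneg (by linarith : (0 : ℝ) ≤ C2) hI]

end Mild

/-! ### Weighted and a priori estimates -/

section Estimates

variable (ν : Measure (Metric.sphere (0 : Rd d) 1)) [IsFiniteMeasure ν]
  (hspan : Submodule.span ℝ
      ((fun ξ : Metric.sphere (0 : Rd d) 1 => (ξ : Rd d)) '' ν.support) = ⊤)
  {α : ℝ} (hα : α ∈ Ioc (1 : ℝ) 2) {p : ℕ → Rd d → ℝ} (hp : IsDyadicPartition p)
  {T β θ : ℝ} (hβ : -α < β) (hβ' : β < 0) (h0 : 0 < θ) (hθ : θ < β + α)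

include hspan hα hp hβ hβ' h0

/-- The mild formula in terms of the semigroup on distributions. -/
lemma emb_mild_apply {uT : Distr d} (huT : besovNorm p θ uT < ⊤) {G : ℝ → Distr d}
    (hG : ContB p T β G) {t : ℝ} (ht : t ∈ Icc 0 T) (φ : 𝓢(Rd d, ℂ)) :
    IntervalIntegrable (fun s => semigroup p α ν (s - t) (G s) φ) volume t T ∧
      emb (mild p α ν T (rep p uT) G t) φ = semigroup p α ν (T - t) uT φ +
        ∫ s in t..T, semigroup p α ν (s - t) (G s) φ := by
  have hI := intervalIntegrable_Pm ν hspan hα hp hβ hβ' hG ht.1 le_rfl ht.2 le_rfl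
  have hcongr : ∀ s ∈ uIoc t T, Pm p α ν (s - t) (G s) (toL1 φ) =
      semigroup p α ν (s - t) (G s) φ := by
    intro s hs
    rw [uIoc_of_le ht.2] at hs
    rw [semigroup_eq ν hspan hα hp hβ (sub_pos.2 hs.1) (hG.1 s ⟨ht.1.trans hs.1.le, hs.2⟩),
      emb_apply]
  have hI' : IntervalIntegrable (fun s => Pm p α ν (s - t) (G s) (toL1 φ)) volume t T :=
    (intervalIntegrable_iff_integrableOn_Ioc_of_le ht.2).2
      ((ContinuousLinearMap.apply ℂ ℂ (toL1 φ)).integrable_comp hI.1)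
  refine ⟨hI'.congr hcongr, ?_⟩
  rw [mild, map_add, semigroup_eq_rep ν hspan hα hp h0 (sub_nonneg.2 ht.2) huT]
  change _ + emb (src p α ν G t T) φ = _
  congr 1
  rw [emb_apply, src, ← intervalIntegral.integral_congr_ae (ae_of_all _ hcongr)]
  exact (ContinuousLinearMap.intervalIntegral_comp_comm
    (ContinuousLinearMap.apply ℂ ℂ (toL1 φ)) hI).symm

/-- Turns the formulation by test functions into a fixed-point equation with an integral in `XD`,
where norm estimates are available. -/
lemma isMildSolution_iff {uT : Distr d} (huT : besovNorm p θ uT < ⊤) {f u : ℝ → Distr d}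
    {V : ℝ → Fin d → Distr d} (hG : ContB p T β fun s => dotGrad p (V s) (u s) - f s) :
    IsMildSolution p α ν T uT f V u ↔ ∀ t ∈ Icc 0 T,
      u t = emb (mild p α ν T (rep p uT) (fun s => dotGrad p (V s) (u s) - f s) t) := by
  refine forall₂_congr fun t ht => ?_
  have key := fun φ => emb_mild_apply ν hspan hα hp hβ hβ' h0 huT hG ht φ
  constructor
  · intro h
    ext φ
    rw [(key φ).2, (h φ).2]
  · intro h φ
    refine ⟨(key φ).1, ?_⟩
    rw [← (key φ).2, ← h]

include hθ

/-- In the norm with weight `exp (-l (T - t))` the part of the source that depends on the unknown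
contributes a factor `1/2` only. This is the contraction for the Picard iterates and the absorbable
term in the a priori estimate. -/
lemma exists_weighted_bound (hT : 0 < T) {A : ℝ} (hA : 0 ≤ A) : ∃ l C, 0 < l ∧ 0 ≤ C ∧
    ∀ (x : XD d) (G : ℝ → Distr d) (K M : ℝ), besovNorm p θ (emb x) < ⊤ → ContB p T β G →
    (∀ s ∈ Icc 0 T, bn p β (G s) ≤ A * (M * Real.exp (l * (T - s))) + K) → 0 ≤ K → 0 ≤ M →
    ∀ t ∈ Icc 0 T, besovNorm p θ (emb (mild p α ν T x G t)) ≤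
      ENNReal.ofReal (C * (bn p θ (emb x) + K) + 2⁻¹ * (M * Real.exp (l * (T - t)))) := by
  have hα0 : 0 < α := by linarith [hα.1]
  obtain ⟨C, hC, h⟩ := besovNorm_mild_le ν hspan hα hp (T := T) hβ hβ' h0 hθ
  set κ := (θ - β) / α with hκ
  have hκ0 : 0 ≤ κ := div_nonneg (by linarith) hα0.le
  have hκ1 : κ < 1 := (div_lt_one hα0).2 (by linarith)
  have hC0 : 0 ≤ C := by linarith
  obtain ⟨l, hl, hw⟩ := exists_weight hκ0 hκ1 hT (C * A) (mul_nonneg hC0 hA)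
  set J := T ^ (1 - κ) / (1 - κ) with hJ
  have hJ0 : 0 ≤ J := div_nonneg (Real.rpow_nonneg hT.le _) (by linarith)
  refine ⟨l, C * (1 + J), hl, by positivity, fun x G K M hx hG hGb hK hM t ht => ?_⟩
  have hg : Continuous fun s => A * (M * Real.exp (l * (T - s))) + K := by fun_prop
  refine (h x G _ t hx hG hg hGb ht).trans (ENNReal.ofReal_le_ofReal ?_)
  have hx0 : 0 ≤ bn p θ (emb x) := bn_nonneg
  have e : ∫ s in t..T, (s - t) ^ (-κ) * (A * (M * Real.exp (l * (T - s))) + K) =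
      A * M * (∫ s in t..T, (s - t) ^ (-κ) * Real.exp (l * (T - s))) +
        (T - t) ^ (1 - κ) / (1 - κ) * K := by
    rw [← integral_sub_rpow hκ1, ← intervalIntegral.integral_mul_const,
      ← intervalIntegral.integral_const_mul, ← intervalIntegral.integral_add]
    · refine intervalIntegral.integral_congr fun s _ => ?_
      ring
    · exact (intervalIntegrable_sub_rpow_mul hκ1 t (by fun_prop)).const_mul _
    · exact (intervalIntegrable_sub_rpow hκ1 t t T).mul_const _
  have hJt : (T - t) ^ (1 - κ) / (1 - κ) ≤ J :=
    div_le_div_of_nonneg_right (Real.rpow_le_rpow (by linarith [ht.2]) (by linarith [ht.1])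
      (by linarith)) (by linarith)
  have h1 := mul_le_mul_of_nonneg_left (hw t ht) hM
  have h2 := mul_le_mul_of_nonneg_left (mul_le_mul_of_nonneg_right hJt hK) hC0
  have h3 := mul_nonneg hC0 (mul_nonneg hJ0 hx0)
  have h4 := mul_nonneg hC0 hK
  rw [e]
  linarith

/-- The a priori estimate for mild solutions of linear equations. -/
lemma exists_apriori_bound (hT : 0 < T) {A : ℝ} (hA : 0 ≤ A) : ∃ C, 0 ≤ C ∧
    ∀ (x : XD d) (G w : ℝ → Distr d) (K : ℝ), besovNorm p θ (emb x) < ⊤ → ContB p T β G →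
    ContB p T θ w → (∀ t ∈ Icc 0 T, w t = emb (mild p α ν T x G t)) →
    (∀ s ∈ Icc 0 T, bn p β (G s) ≤ A * bn p θ (w s) + K) → 0 ≤ K →
    ∀ t ∈ Icc 0 T, bn p θ (w t) ≤ C * (bn p θ (emb x) + K) := by
  obtain ⟨l, C, hl, hC, h⟩ := exists_weighted_bound ν hspan hα hp hβ hβ' h0 hθ hT hA
  refine ⟨2 * C * Real.exp (l * T), by positivity, fun x G w K hx hG hw hwG hGb hK => ?_⟩
  have hcont : ContinuousOn (fun t => bn p θ (w t) * Real.exp (-(l * (T - t)))) (Icc 0 T) :=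
    hw.continuousOn.mul (by fun_prop)
  obtain ⟨t0, ht0, hmax⟩ := isCompact_Icc.exists_isMaxOn (nonempty_Icc.2 hT.le) hcont
  -- `M` is the weighted norm of `w`, attained at `t0`. There the weighted bound has half of the
  -- left-hand side on the right, which is absorbed.
  set M := bn p θ (w t0) * Real.exp (-(l * (T - t0))) with hM
  have hM0 : 0 ≤ M := mul_nonneg bn_nonneg (Real.exp_nonneg _)
  have hle : ∀ s ∈ Icc 0 T, bn p θ (w s) ≤ M * Real.exp (l * (T - s)) := by
    intro s hs
    have h1 : bn p θ (w s) * Real.exp (-(l * (T - s))) ≤ M := hmax hs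
    have h2 := mul_le_mul_of_nonneg_right h1 (Real.exp_nonneg (l * (T - s)))
    rwa [mul_assoc, ← Real.exp_add, neg_add_cancel, Real.exp_zero, mul_one] at h2
  have hS0 : 0 ≤ C * (bn p θ (emb x) + K) := mul_nonneg hC (add_nonneg bn_nonneg hK)
  have hb := h x G K M hx hG (fun s hs => (hGb s hs).trans
    (add_le_add (mul_le_mul_of_nonneg_left (hle s hs) hA) le_rfl)) hK hM0 t0 ht0
  rw [← hwG t0 ht0] at hb
  have hb' := bn_le_of_besovNorm_le (add_nonneg hS0 (by positivity)) hb
  have hMe : M * Real.exp (l * (T - t0)) = bn p θ (w t0) := by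
    rw [hM, mul_assoc, ← Real.exp_add, neg_add_cancel, Real.exp_zero, mul_one]
  rw [hMe] at hb'
  have hM2 : M ≤ 2 * (C * (bn p θ (emb x) + K)) := by
    have h1 : M ≤ bn p θ (w t0) := by
      rw [← hMe]
      exact le_mul_of_one_le_right hM0 (Real.one_le_exp (mul_nonneg hl.le (sub_nonneg.2 ht0.2)))
    linarith
  intro t ht
  have hexp : Real.exp (l * (T - t)) ≤ Real.exp (l * T) :=
    Real.exp_le_exp.2 (mul_le_mul_of_nonneg_left (by linarith [ht.1]) hl.le)
  calc bn p θ (w t) ≤ M * Real.exp (l * (T - t)) := hle t ht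
    _ ≤ 2 * (C * (bn p θ (emb x) + K)) * Real.exp (l * T) :=
        mul_le_mul hM2 hexp (Real.exp_nonneg _) (by linarith)
    _ = _ := by ring

end Estimates

/-! ### Existence by Picard iteration -/

/-- The Picard iterates of the mild formula. -/
def picard (p : ℕ → Rd d → ℝ) (α : ℝ) (ν : Measure (Metric.sphere (0 : Rd d) 1)) (T : ℝ)
    (x : XD d) (f : ℝ → Distr d) (V : ℝ → Fin d → Distr d) : ℕ → ℝ → XD d
  | 0 => fun t => x ∘L U α ν (T - t)
  | n + 1 => mild p α ν T x fun s => dotGrad p (V s) (emb (picard p α ν T x f V n s)) - f s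

section Solve

variable (ν : Measure (Metric.sphere (0 : Rd d) 1)) [IsFiniteMeasure ν]
  (hspan : Submodule.span ℝ
      ((fun ξ : Metric.sphere (0 : Rd d) 1 => (ξ : Rd d)) '' ν.support) = ⊤)
  {α : ℝ} (hα : α ∈ Ioc (1 : ℝ) 2) {p : ℕ → Rd d → ℝ} (hp : IsDyadicPartition p)
  {T β θ : ℝ} (hβ : -α < β) (hβ2 : -2 < β) (hβ' : β < 0) (hθ1 : 1 - β < θ) (hθ : θ < β + α)

include hspan hα hp hβ hβ2 hβ' hθ1 hθ

lemma memCT_picard {x : XD d} (hx : MemC p θ (emb x)) {f : ℝ → Distr d}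
    (hf : ContB p T β f) {V : ℝ → Fin d → Distr d} (hV : ∀ i, ContB p T β fun t => V t i) (n : ℕ) :
    MemCT p T θ fun t => emb (picard p α ν T x f V n t) := by
  induction n with
  | zero => exact memCT_terminal ν hspan hα hp hx
  | succ n ih =>
    exact memCT_mild ν hspan hα hp hβ hβ' (by linarith) hθ hx
      ((contB_dotGrad hp hβ' hβ2 hθ1 hV ih.contB).sub hf)

/-- The Picard iterates converge to a solution of the mild equation. -/
lemma exists_picard_limit (hT : 0 < T) {x : XD d} (hx : MemC p θ (emb x)) {f : ℝ → Distr d}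
    (hf : ContB p T β f) {V : ℝ → Fin d → Distr d} (hV : ∀ i, ContB p T β fun t => V t i) :
    ∃ z : ℝ → XD d, MemCT p T θ (fun t => emb (z t)) ∧
      (∀ t ∈ Icc 0 T, Tendsto (fun n => picard p α ν T x f V n t) atTop (𝓝 (z t))) ∧
      ∀ t ∈ Icc 0 T, z t = mild p α ν T x (fun s => dotGrad p (V s) (emb (z s)) - f s) t := by
  have h0 : 0 < θ := by linarith
  set y := picard p α ν T x f V with hy
  have hmem := memCT_picard ν hspan hα hp hβ hβ2 hβ' hθ1 hθ hx hf hV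
  obtain ⟨A, hA, hVA⟩ := ContB.exists_common_bound hV
  obtain ⟨CD, hCD, hD⟩ := besovNorm_dotGrad_le hp hβ' hβ2 hθ1
  obtain ⟨l, C, hl, hC, hw⟩ := exists_weighted_bound ν hspan hα hp hβ hβ' h0 hθ hT
    (mul_nonneg hCD hA)
  obtain ⟨CR, hCR, hR⟩ := norm_rep_le (p := p) h0
  have hzero : emb (0 : XD d) = 0 := map_zero _
  have hbz : besovNorm p θ (emb (0 : XD d)) < ⊤ := by
    have := besovNorm_sub_lt hx.1 hx.1
    rwa [sub_self, ← hzero] at this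
  have hbz0 : bn p θ (emb (0 : XD d)) = 0 := le_antisymm (bn_le le_rfl fun n => ⟨0, by
    rw [← (hasBlocks_emb hp _).emb_bl n, bl_emb hp, ContinuousLinearMap.zero_comp], by simp⟩)
    bn_nonneg
  -- contraction
  have hcontr : ∀ (u u' : ℝ → Distr d) (M : ℝ), ContB p T θ u → ContB p T θ u' → 0 ≤ M →
      (∀ s ∈ Icc 0 T, bn p θ (u s - u' s) ≤ M * Real.exp (l * (T - s))) →
      ∀ t ∈ Icc 0 T, besovNorm p θ (emb
        (mild p α ν T x (fun s => dotGrad p (V s) (u s) - f s) t -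
          mild p α ν T x (fun s => dotGrad p (V s) (u' s) - f s) t)) ≤
        ENNReal.ofReal (2⁻¹ * (M * Real.exp (l * (T - t)))) := by
    intro u u' M hu hu' hM h t ht
    have hGu := (contB_dotGrad hp hβ' hβ2 hθ1 hV hu).sub hf
    have hGu' := (contB_dotGrad hp hβ' hβ2 hθ1 hV hu').sub hf
    rw [← mild_sub ν hspan hα hp hβ hβ' x x hGu hGu' ht, sub_self]
    have h1 := hw 0 _ 0 M hbz (hGu.sub hGu') (fun s hs => ?_) le_rfl hM t ht
    · rwa [hbz0, add_zero, mul_zero, zero_add] at h1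
    · have e : dotGrad p (V s) (u s) - f s - (dotGrad p (V s) (u' s) - f s) =
          dotGrad p (V s) (u s - u' s) := by
        rw [dotGrad_sub_right hp hβ' hβ2 hθ1 (fun i => (hV i).1 s hs) (hu.1 s hs) (hu'.1 s hs)]
        abel
      rw [e, add_zero]
      have hus := besovNorm_sub_lt (hu.1 s hs) (hu'.1 s hs)
      refine (bn_le_of_besovNorm_le (mul_nonneg (mul_nonneg hCD hA) bn_nonneg) (hD (V s) _ A
        (fun i => besovNorm_le_ofReal ((hV i).1 s hs) (hVA s hs i)) hA hus)).trans ?_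
      exact mul_le_mul_of_nonneg_left (h s hs) (mul_nonneg hCD hA)
  obtain ⟨M, hM, hM1⟩ := ((hmem 1).contB.sub (hmem 0).contB).bounded
  have hexp : ∀ s ∈ Icc 0 T, 1 ≤ Real.exp (l * (T - s)) := fun s hs =>
    Real.one_le_exp (mul_nonneg hl.le (sub_nonneg.2 hs.2))
  have hstep : ∀ n, ∀ t ∈ Icc 0 T, bn p θ (emb (y (n + 1) t) - emb (y n t)) ≤
      M * 2⁻¹ ^ n * Real.exp (l * (T - t)) := by
    intro n
    induction n with
    | zero =>
      intro t ht
      rw [pow_zero, mul_one]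
      exact (hM1 t ht).trans (le_mul_of_one_le_right hM (hexp t ht))
    | succ n ih =>
      intro t ht
      have h1 := hcontr _ _ _ (hmem (n + 1)).contB (hmem n).contB (by positivity) ih t ht
      rw [← map_sub]
      refine (bn_le_of_besovNorm_le (by positivity) h1).trans (le_of_eq ?_)
      rw [pow_succ]
      ring
  set E := Real.exp (l * T) with hE
  have hexp' : ∀ s ∈ Icc 0 T, Real.exp (l * (T - s)) ≤ E := fun s hs =>
    Real.exp_le_exp.2 (mul_le_mul_of_nonneg_left (by linarith [hs.1]) hl.le)
  have hstep' : ∀ n, ∀ t ∈ Icc 0 T, bn p θ (emb (y (n + 1) t) - emb (y n t)) ≤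
      M * E * 2⁻¹ ^ n := fun n t ht =>
    (hstep n t ht).trans ((mul_le_mul_of_nonneg_left (hexp' t ht) (by positivity)).trans
      (le_of_eq (by ring)))
  have hfin : ∀ m n, ∀ t ∈ Icc 0 T, besovNorm p θ (emb (y m t) - emb (y n t)) < ⊤ :=
    fun m n t ht => besovNorm_sub_lt ((hmem m).1 t ht).1 ((hmem n).1 t ht).1
  have hcau : ∀ t ∈ Icc 0 T, CauchySeq fun n => y n t := by
    intro t ht
    refine cauchySeq_of_le_geometric 2⁻¹ (CR * (M * E)) (by norm_num) fun n => ?_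
    have hlt := hfin (n + 1) n t ht
    rw [← map_sub] at hlt
    rw [dist_comm, dist_eq_norm, ← rep_emb hp h0 hlt, mul_assoc]
    refine (hR _ hlt).trans (mul_le_mul_of_nonneg_left ?_ hCR)
    rw [map_sub]
    exact hstep' n t ht
  -- Outside `[0, T]` the limit curve takes an arbitrary value.
  have hlim : ∀ t, ∃ z : XD d, t ∈ Icc 0 T → Tendsto (fun n => y n t) atTop (𝓝 z) := by
    intro t
    by_cases ht : t ∈ Icc 0 T
    · obtain ⟨z, hz⟩ := cauchySeq_tendsto_of_complete (hcau t ht)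
      exact ⟨z, fun _ => hz⟩
    · exact ⟨0, fun h => (ht h).elim⟩
  choose z hz using hlim
  -- The partial geometric sum is kept exact so that the induction on `m` closes.
  have htail : ∀ m n, ∀ t ∈ Icc 0 T, bn p θ (emb (y (n + m) t) - emb (y n t)) ≤
      2 * (M * E) * 2⁻¹ ^ n * (1 - 2⁻¹ ^ m) := by
    intro m
    induction m with
    | zero =>
      intro n t ht
      rw [add_zero, sub_self, pow_zero, sub_self, mul_zero, ← hzero, hbz0]
    | succ m ih =>
      intro n t ht
      rw [← sub_add_sub_cancel _ (emb (y (n + m) t))]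
      refine (bn_add_le (hfin _ _ t ht) (hfin _ _ t ht)).trans
        ((add_le_add (hstep' (n + m) t ht) (ih n t ht)).trans (le_of_eq ?_))
      rw [pow_add, pow_succ]
      ring
  -- The iterates converge in the uniform norm first; since Besov balls are closed under that
  -- convergence, the tail bound passes to the limit.
  have hdist : ∀ n, ∀ t ∈ Icc 0 T, besovNorm p θ (emb (z t) - emb (y n t)) ≤
      ENNReal.ofReal (2 * (M * E) * 2⁻¹ ^ n) := by
    intro n t ht
    rw [← map_sub]
    refine besovNorm_le_of_tendsto hp (by positivity) ((hz t ht).sub_const (y n t)) ?_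
    filter_upwards [eventually_ge_atTop n] with k hk
    obtain ⟨m, rfl⟩ := Nat.exists_eq_add_of_le hk
    rw [map_sub]
    refine besovNorm_le_ofReal (hfin _ _ t ht) ((htail m n t ht).trans
      (mul_le_of_le_one_right (by positivity) ?_))
    have : (0 : ℝ) ≤ 2⁻¹ ^ m := by positivity
    linarith
  have hgeo : Tendsto (fun n : ℕ => 2 * (M * E) * (2⁻¹ : ℝ) ^ n) atTop (𝓝 0) := by
    simpa using (tendsto_pow_atTop_nhds_zero_of_lt_one (by norm_num : (0 : ℝ) ≤ 2⁻¹)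
      (by norm_num)).const_mul (2 * (M * E))
  have hzmem : MemCT p T θ fun t => emb (z t) := memCT_of_uniform hmem hgeo hdist
  refine ⟨z, hzmem, hz, fun t ht => ?_⟩
  -- The shifted iterates tend to `z t`, and by the contraction estimate also to the mild formula of
  -- `z`.
  refine tendsto_nhds_unique ((hz t ht).comp (tendsto_add_atTop_nat 1)) ?_
  rw [tendsto_iff_norm_sub_tendsto_zero]
  have hgeo' : Tendsto (fun n : ℕ => CR * (2 * (M * E) * (2⁻¹ : ℝ) ^ n * E)) atTop (𝓝 0) := by
    have := (hgeo.mul_const E).const_mul CR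
    rwa [zero_mul, mul_zero] at this
  refine squeeze_zero (fun _ => norm_nonneg _) (fun n => ?_) hgeo'
  have h1 := hcontr (fun t => emb (y n t)) _ (2 * (M * E) * 2⁻¹ ^ n) (hmem n).contB hzmem.contB
    (by positivity) (fun s hs => by
      rw [← bn_neg, neg_sub]
      exact (bn_le_of_besovNorm_le (by positivity) (hdist n s hs)).trans
        (le_mul_of_one_le_right (by positivity) (hexp s hs))) t ht
  have hlt := h1.trans_lt ENNReal.ofReal_lt_top
  change ‖mild p α ν T x (fun s => dotGrad p (V s) (emb (y n s)) - f s) t - _‖ ≤ _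
  rw [← rep_emb hp h0 hlt]
  refine (hR _ hlt).trans (mul_le_mul_of_nonneg_left ?_ hCR)
  refine (bn_le_of_besovNorm_le (by positivity) h1).trans ?_
  have h2 : 2 * (M * E) * 2⁻¹ ^ n * Real.exp (l * (T - t)) ≤ 2 * (M * E) * 2⁻¹ ^ n * E :=
    mul_le_mul_of_nonneg_left (hexp' t ht) (by positivity)
  have h3 : 0 ≤ 2 * (M * E) * 2⁻¹ ^ n * Real.exp (l * (T - t)) := by positivity
  linarith

end Solve

/-! ### Uniqueness and continuous dependence on the data -/

section Stability

variable {p : ℕ → Rd d → ℝ} {T β θ : ℝ}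

lemma eq_zero_of_bn_eq_zero (hp : IsDyadicPartition p) (h0 : 0 < θ) {u : Distr d}
    (hu : besovNorm p θ u < ⊤) (h : bn p θ u = 0) : u = 0 := by
  obtain ⟨C, hC, hR⟩ := norm_rep_le (p := p) h0
  have h1 := hR u hu
  rw [h, mul_zero] at h1
  rw [← emb_rep hp h0 hu, norm_le_zero_iff.1 h1, map_zero]

lemma besovNorm_le_ctNorm {u : ℝ → Distr d} {t : ℝ} (ht : t ∈ Icc 0 T) :
    besovNorm p θ (u t) ≤ ctNorm p T θ u :=
  le_iSup₂ (f := fun t (_ : t ∈ Icc 0 T) => besovNorm p θ (u t)) t ht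

variable (ν : Measure (Metric.sphere (0 : Rd d) 1)) [IsFiniteMeasure ν]
  (hspan : Submodule.span ℝ
      ((fun ξ : Metric.sphere (0 : Rd d) 1 => (ξ : Rd d)) '' ν.support) = ⊤)
  {α : ℝ} (hα : α ∈ Ioc (1 : ℝ) 2) (hp : IsDyadicPartition p)
  (hβ : -α < β) (hβ2 : -2 < β) (hβ' : β < 0) (hθ1 : 1 - β < θ) (hθ : θ < β + α) (hT : 0 < T)

include hspan hα hp hβ hβ2 hβ' hθ1 hθ

/-- Regular mild solutions are the fixed points of the mild formula. -/
lemma isRegularMildSolution_of_eq {uT : Distr d} {f u : ℝ → Distr d} {V : ℝ → Fin d → Distr d}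
    (hd : IsData p T β θ uT f V) (hu : MemCT p T θ u)
    (h : ∀ t ∈ Icc 0 T,
      u t = emb (mild p α ν T (rep p uT) (fun s => dotGrad p (V s) (u s) - f s) t)) :
    IsRegularMildSolution p α ν T θ uT f V u := by
  have h0 : 0 < θ := by linarith
  have hG := (contB_dotGrad hp hβ' hβ2 hθ1 (fun i => (hd.2.2 i).contB) hu.contB).sub hd.2.1.contB
  obtain ⟨C, hC, hH⟩ := holderNorm_mild_le ν hspan hα hp (T := T) hβ hβ' h0 hθ
  obtain ⟨K, hK, hGK⟩ := hG.bounded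
  obtain ⟨N, hN, huN⟩ := hu.contB.bounded
  refine ⟨hu, ?_, (isMildSolution_iff ν hspan hα hp hβ hβ' h0 hd.1.1 hG).2 h⟩
  exact (hH _ _ u N K hG hGK hK h (fun s hs => besovNorm_le_ofReal (hu.1 s hs).1 (huN s hs))
    hN).trans_lt ENNReal.ofReal_lt_top

include hT

/-- The solution depends on the data in a Lipschitz continuous way. -/
lemma exists_stability_bound {A B : ℝ} (hA : 0 ≤ A) (hB : 0 ≤ B) : ∃ C, 0 ≤ C ∧
    ∀ (uT uT' : Distr d) (f f' u u' : ℝ → Distr d) (V V' : ℝ → Fin d → Distr d) (δ : ℝ),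
      IsData p T β θ uT f V → IsData p T β θ uT' f' V' →
      IsRegularMildSolution p α ν T θ uT f V u → IsRegularMildSolution p α ν T θ uT' f' V' u' →
      (∀ t ∈ Icc 0 T, ∀ i, bn p β (V' t i) ≤ A) → (∀ t ∈ Icc 0 T, bn p θ (u t) ≤ B) → 0 ≤ δ →
      bn p θ (uT' - uT) ≤ δ → (∀ t ∈ Icc 0 T, bn p β (f' t - f t) ≤ δ) →
      (∀ t ∈ Icc 0 T, ∀ i, bn p β (V' t i - V t i) ≤ δ) →
      ctNorm p T θ (fun t => u' t - u t) + holderNorm T (θ / α) (fun t => u' t - u t) ≤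
        ENNReal.ofReal (C * δ) := by
  have h0 : 0 < θ := by linarith
  obtain ⟨CD, hCD, hD⟩ := besovNorm_dotGrad_le hp hβ' hβ2 hθ1
  obtain ⟨C1, hC1, hap⟩ := exists_apriori_bound ν hspan hα hp hβ hβ' h0 hθ hT (mul_nonneg hCD hA)
  obtain ⟨C2, hC2, hH⟩ := holderNorm_mild_le ν hspan hα hp (T := T) hβ hβ' h0 hθ
  -- The perturbation of the source: `CD * B` accounts for `(V' - V) · ∇u` and `1` for `f' - f`.
  set k := CD * B + 1 with hk
  have hk0 : 0 ≤ k := by positivity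
  set n := C1 * (1 + k) with hn
  have hn0 : 0 ≤ n := by positivity
  refine ⟨n + C2 * (n + (CD * A * n + k)), by positivity, ?_⟩
  intro uT uT' f f' u u' V V' δ hd hd' hu hu' hVA huB hδ hδT hδf hδV
  have hV := fun i => (hd.2.2 i).contB
  have hV' := fun i => (hd'.2.2 i).contB
  have huc := hu.1.contB
  have huc' := hu'.1.contB
  have hG := (contB_dotGrad hp hβ' hβ2 hθ1 hV huc).sub hd.2.1.contB
  have hG' := (contB_dotGrad hp hβ' hβ2 hθ1 hV' huc').sub hd'.2.1.contB
  have hm := (isMildSolution_iff ν hspan hα hp hβ hβ' h0 hd.1.1 hG).1 hu.2.2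
  have hm' := (isMildSolution_iff ν hspan hα hp hβ hβ' h0 hd'.1.1 hG').1 hu'.2.2
  have hw : ∀ t ∈ Icc 0 T, u' t - u t = emb (mild p α ν T (rep p uT' - rep p uT)
      (fun s => dotGrad p (V' s) (u' s) - f' s - (dotGrad p (V s) (u s) - f s)) t) := by
    intro t ht
    rw [mild_sub ν hspan hα hp hβ hβ' _ _ hG' hG ht, map_sub, ← hm t ht, ← hm' t ht]
  have hxT : emb (rep p uT' - rep p uT) = uT' - uT := by
    rw [map_sub, emb_rep hp h0 hd.1.1, emb_rep hp h0 hd'.1.1]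
  have hsrc : ∀ s ∈ Icc 0 T,
      bn p β (dotGrad p (V' s) (u' s) - f' s - (dotGrad p (V s) (u s) - f s)) ≤
        CD * A * bn p θ (u' s - u s) + k * δ := by
    intro s hs
    -- The difference of solutions is transported by `V'`, and the change of drift acts on the fixed
    -- `u`. Thus only bounds on `V'` and `u` enter, and none on `u'`.
    have e : dotGrad p (V' s) (u' s) - f' s - (dotGrad p (V s) (u s) - f s) =
        dotGrad p (V' s) (u' s - u s) +
          (dotGrad p (fun i => V' s i - V s i) (u s) - (f' s - f s)) := by
      rw [dotGrad_sub_right hp hβ' hβ2 hθ1 (fun i => (hV' i).1 s hs) (huc'.1 s hs) (huc.1 s hs),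
        dotGrad_sub_left hp hβ' hβ2 hθ1 (fun i => (hV' i).1 s hs) (fun i => (hV i).1 s hs)
          (huc.1 s hs)]
      abel
    have i1 := hD (V' s) (u' s - u s) A
      (fun i => besovNorm_le_ofReal ((hV' i).1 s hs) (hVA s hs i)) hA
      (besovNorm_sub_lt (huc'.1 s hs) (huc.1 s hs))
    have i2 := hD (fun i => V' s i - V s i) (u s) δ
      (fun i => besovNorm_le_ofReal (besovNorm_sub_lt ((hV' i).1 s hs) ((hV i).1 s hs))
        (hδV s hs i)) hδ (huc.1 s hs)
    have hf := besovNorm_sub_lt (hd'.2.1.contB.1 s hs) (hd.2.1.contB.1 s hs)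
    have j1 := bn_le_of_besovNorm_le (mul_nonneg (mul_nonneg hCD hA) bn_nonneg) i1
    have j2 := bn_le_of_besovNorm_le (mul_nonneg (mul_nonneg hCD hδ) bn_nonneg) i2
    have i2' := i2.trans_lt ENNReal.ofReal_lt_top
    rw [e]
    refine (bn_add_le (i1.trans_lt ENNReal.ofReal_lt_top) (besovNorm_sub_lt i2' hf)).trans
      (add_le_add j1 ((bn_sub_le i2' hf).trans ((add_le_add j2 (hδf s hs)).trans ?_)))
    have := mul_le_mul_of_nonneg_left (huB s hs) (mul_nonneg hCD hδ)
    rw [hk]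
    linarith
  have hxlt := besovNorm_sub_lt hd'.1.1 hd.1.1
  have hN : ∀ t ∈ Icc 0 T, bn p θ (u' t - u t) ≤ n * δ := by
    intro t ht
    have h1 := hap _ _ (fun t => u' t - u t) (k * δ) (by rw [hxT]; exact hxlt) (hG'.sub hG)
      (huc'.sub huc) hw hsrc (by positivity) t ht
    rw [hxT] at h1
    refine h1.trans ?_
    rw [hn, mul_assoc]
    exact mul_le_mul_of_nonneg_left (by linarith) hC1
  have hN' : ∀ t ∈ Icc 0 T, besovNorm p θ (u' t - u t) ≤ ENNReal.ofReal (n * δ) := fun t ht =>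
    besovNorm_le_ofReal (besovNorm_sub_lt (huc'.1 t ht) (huc.1 t ht)) (hN t ht)
  have hold := hH _ _ (fun t => u' t - u t) (n * δ) ((CD * A * n + k) * δ) (hG'.sub hG)
    (fun s hs => (hsrc s hs).trans (by
      have := mul_le_mul_of_nonneg_left (hN s hs) (mul_nonneg hCD hA)
      linarith)) (by positivity) hw hN' (by positivity)
  calc _ ≤ ENNReal.ofReal (n * δ) + ENNReal.ofReal (C2 * (n * δ + (CD * A * n + k) * δ)) :=
        add_le_add (iSup₂_le hN') hold
    _ = _ := by
        rw [← ENNReal.ofReal_add (by positivity) (by positivity)]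
        congr 1
        ring

/-- Uniqueness of regular mild solutions. -/
lemma eqOn_of_isRegularMildSolution {uT : Distr d} {f u w : ℝ → Distr d}
    {V : ℝ → Fin d → Distr d} (hd : IsData p T β θ uT f V)
    (hu : IsRegularMildSolution p α ν T θ uT f V u)
    (hw : IsRegularMildSolution p α ν T θ uT f V w) : EqOn w u (Icc 0 T) := by
  have h0 : 0 < θ := by linarith
  obtain ⟨A, hA, hVA⟩ := ContB.exists_common_bound fun i => (hd.2.2 i).contB
  obtain ⟨B, hB, huB⟩ := hu.1.contB.bounded
  obtain ⟨C, hC, h⟩ := exists_stability_bound ν hspan hα hp hβ hβ2 hβ' hθ1 hθ hT hA hB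
  have hz : ∀ γ (v : Distr d), besovNorm p γ v < ⊤ → bn p γ (v - v) ≤ 0 := fun γ v hv =>
    bn_le le_rfl fun n => ⟨0, by rw [sub_self, block_eq, map_zero, map_zero], by simp⟩
  -- Uniqueness is stability with equal data and `δ = 0`.
  have h1 := h uT uT f f u w V V 0 hd hd hu hw hVA huB le_rfl (hz _ _ hd.1.1)
    (fun t ht => hz _ _ (hd.2.1.1 t ht).1) fun t ht i => hz _ _ ((hd.2.2 i).1 t ht).1
  rw [mul_zero, ENNReal.ofReal_zero] at h1
  intro t ht
  have h2 : besovNorm p θ (w t - u t) = 0 := le_antisymm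
    ((besovNorm_le_ctNorm (u := fun t => w t - u t) ht).trans (le_self_add.trans h1)) zero_le
  refine sub_eq_zero.1 (eq_zero_of_bn_eq_zero hp h0 (by rw [h2]; exact ENNReal.zero_lt_top) ?_)
  rw [bn, h2, ENNReal.toReal_zero]

/-- Continuity of the solution map. -/
lemma solution_map_continuous {uT : Distr d} {f u : ℝ → Distr d} {V : ℝ → Fin d → Distr d}
    (hd : IsData p T β θ uT f V) (hu : IsRegularMildSolution p α ν T θ uT f V u)
    {ε : ℝ≥0∞} (hε : 0 < ε) : ∃ δ : ℝ≥0∞, 0 < δ ∧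
      ∀ (uT' : Distr d) (f' : ℝ → Distr d) (V' : ℝ → Fin d → Distr d) (u' : ℝ → Distr d),
        IsData p T β θ uT' f' V' → IsRegularMildSolution p α ν T θ uT' f' V' u' →
        besovNorm p θ (uT' - uT) < δ → ctNorm p T β (fun t => f' t - f t) < δ →
        (∀ i, ctNorm p T β (fun t => V' t i - V t i) < δ) →
        ctNorm p T θ (fun t => u' t - u t) + holderNorm T (θ / α) (fun t => u' t - u t) < ε := by
  obtain ⟨A, hA, hVA⟩ := ContB.exists_common_bound fun i => (hd.2.2 i).contB
  obtain ⟨B, hB, huB⟩ := hu.1.contB.bounded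
  obtain ⟨C, hC, h⟩ := exists_stability_bound ν hspan hα hp hβ hβ2 hβ' hθ1 hθ hT
    (by linarith : 0 ≤ A + 1) hB
  -- Passing to `min ε 1` covers `ε = ∞`.
  obtain ⟨e, he, heε⟩ : ∃ e : ℝ, 0 < e ∧ ENNReal.ofReal e ≤ ε := by
    have h1 : min ε 1 ≠ ⊤ := (min_lt_of_right_lt ENNReal.one_lt_top).ne
    refine ⟨(min ε 1).toReal, ENNReal.toReal_pos (lt_min hε one_pos).ne' h1, ?_⟩
    rw [ENNReal.ofReal_toReal h1]
    exact min_le_left _ _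
  -- The bound `1` keeps the perturbed drift below `A + 1`, the constant for which `C` was chosen;
  -- `C + 1` avoids division by zero and makes the final inequality strict.
  set δ := min 1 (e / (C + 1)) with hδ
  have hδ0 : 0 < δ := lt_min one_pos (by positivity)
  refine ⟨ENNReal.ofReal δ, ENNReal.ofReal_pos.2 hδ0, ?_⟩
  intro uT' f' V' u' hd' hu' h1 h2 h3
  have hV3 : ∀ t ∈ Icc 0 T, ∀ i, bn p β (V' t i - V t i) ≤ δ := fun t ht i =>
    bn_le_of_besovNorm_le hδ0.le
      ((besovNorm_le_ctNorm (u := fun t => V' t i - V t i) ht).trans (h3 i).le)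
  refine (h uT uT' f f' u u' V V' δ hd hd' hu hu' (fun t ht i => ?_) huB hδ0.le
    (bn_le_of_besovNorm_le hδ0.le h1.le) (fun t ht => bn_le_of_besovNorm_le hδ0.le
      ((besovNorm_le_ctNorm (u := fun t => f' t - f t) ht).trans h2.le)) hV3).trans_lt ?_
  · have hVi := ((hd.2.2 i).1 t ht).1
    have hVi' := ((hd'.2.2 i).1 t ht).1
    have h4 := bn_add_le (besovNorm_sub_lt hVi' hVi) hVi
    rw [sub_add_cancel] at h4
    linarith [hV3 t ht i, hVA t ht i, min_le_left 1 (e / (C + 1))]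
  · refine lt_of_lt_of_le ((ENNReal.ofReal_lt_ofReal_iff he).2 ?_) heε
    have h5 : δ * (C + 1) ≤ e := (le_div_iff₀ (by positivity)).1 (min_le_right _ _)
    linarith

end Stability

/-! ### Real data give real solutions -/

section Reality

open ComplexConjugate

lemma conj_fourier (g : Rd d → ℂ) (x : Rd d) :
    conj (𝓕 g x) = 𝓕 (fun z => conj (g (-z))) x := by
  rw [Real.fourier_eq', Real.fourier_eq', ← integral_conj,
    ← integral_neg_eq_self fun v : Rd d =>
      Complex.exp (↑(-2 * Real.pi * inner ℝ v x) * Complex.I) • conj (g (-v))]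
  refine integral_congr_ae (ae_of_all _ fun v => ?_)
  simp only [smul_eq_mul, map_mul, ← Complex.exp_conj, Complex.conj_ofReal, Complex.conj_I,
    inner_neg_left, neg_neg]
  congr 2
  push_cast
  ring

lemma conj_fourierInv (g : Rd d → ℂ) (x : Rd d) :
    conj (𝓕⁻ g x) = 𝓕⁻ (fun z => conj (g (-z))) x := by
  rw [Real.fourierInv_eq_fourier_neg, Real.fourierInv_eq_fourier_neg, conj_fourier]

lemma integral_im_eq_zero {X : Type*} [MeasurableSpace X] {μ : Measure X} {h : X → ℂ}
    (hh : ∀ᵐ x ∂μ, (h x).im = 0) : (∫ x, h x ∂μ).im = 0 := by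
  have : ∫ x, h x ∂μ = ∫ x, ((h x).re : ℂ) ∂μ := by
    refine integral_congr_ae (hh.mono fun x hx => ?_)
    exact Complex.ext rfl (by simpa using hx)
  rw [this, integral_complex_ofReal, Complex.ofReal_im]

variable {u v : Distr d}

lemma IsReal.zero : IsReal (0 : Distr d) := fun φ _ => by simp

lemma IsReal.add (hu : IsReal u) (hv : IsReal v) : IsReal (u + v) := fun φ hφ => by
  rw [add_apply, Complex.add_im, hu φ hφ, hv φ hφ, add_zero]

lemma IsReal.sub (hu : IsReal u) (hv : IsReal v) : IsReal (u - v) := fun φ hφ => by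
  rw [sub_apply, Complex.sub_im, hu φ hφ, hv φ hφ, sub_zero]

lemma IsReal.sum {ι : Type*} (s : Finset ι) {F : ι → Distr d} (h : ∀ i ∈ s, IsReal (F i)) :
    IsReal (∑ i ∈ s, F i) := by
  classical
  induction s using Finset.induction_on with
  | empty => exact IsReal.zero
  | insert i s hi ih =>
    rw [Finset.sum_insert hi]
    exact (h i (Finset.mem_insert_self i s)).add
      (ih fun j hj => h j (Finset.mem_insert_of_mem hj))

lemma continuous_eval (φ : 𝓢(Rd d, ℂ)) : Continuous fun u : Distr d => u φ :=
  (PointwiseConvergenceCLM.evalCLM (RingHom.id ℂ) ℂ φ).continuous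

lemma IsReal.of_tendsto {ι : Type*} {l : Filter ι} [l.NeBot] {F : ι → Distr d}
    (hF : Tendsto F l (𝓝 u)) (h : ∀ i, IsReal (F i)) : IsReal u := fun φ hφ => by
  have h1 : Tendsto (fun i => (F i φ).im) l (𝓝 (u φ).im) :=
    (Complex.continuous_im.tendsto _).comp (((continuous_eval φ).tendsto u).comp hF)
  simp only [fun i => h i φ hφ] at h1
  exact tendsto_nhds_unique h1 tendsto_const_nhds

/-- A divergent series has the value `0`, which is real too, so no convergence is required for the
products and the semigroup. -/
lemma IsReal.tsum {F : ℕ → Distr d} (h : ∀ n, IsReal (F n)) : IsReal (∑' n, F n) := by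
  by_cases hs : Summable F
  · exact IsReal.of_tendsto hs.hasSum fun s => IsReal.sum s fun n _ => h n
  · rw [tsum_eq_zero_of_not_summable hs]
    exact IsReal.zero

/-- By duality it suffices that the filtered test function is real, which holds because `p n` is
real and even. -/
lemma IsReal.block {p : ℕ → Rd d → ℝ} (hp : IsDyadicPartition p) (n : ℕ) (hu : IsReal u) :
    IsReal (Kolmogorov.block p n u) := by
  intro φ hφ
  rw [Kolmogorov.block, TemperedDistribution.fourierInv_apply,
    TemperedDistribution.smulLeftCLM_apply_apply, TemperedDistribution.fourier_apply]
  refine hu _ fun x => Complex.conj_eq_iff_im.1 ?_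
  have hφ' : ∀ z, conj (φ z) = φ z := fun z => Complex.conj_eq_iff_im.2 (hφ z)
  rw [SchwartzMap.fourier_coe, conj_fourier]
  refine congrFun (congrArg 𝓕 (funext fun z => ?_)) x
  rw [SchwartzMap.smulLeftCLM_apply_apply (hp.hasTemperateGrowth n),
    SchwartzMap.smulLeftCLM_apply_apply (hp.hasTemperateGrowth n), smul_eq_mul, smul_eq_mul,
    map_mul, Complex.conj_ofReal, hp.neg, SchwartzMap.fourierInv_coe, conj_fourierInv]
  simp only [hφ']
  rw [Real.fourierInv_eq_fourier_neg, neg_neg, ← Real.fourierInv_eq_fourier_comp_neg]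

lemma IsReal.lineDeriv (e : Rd d) (hu : IsReal u) : IsReal (∂_{e} u) := by
  intro φ hφ
  rw [TemperedDistribution.lineDerivOp_apply_apply]
  refine hu _ fun x => ?_
  rw [neg_apply, Complex.neg_im, SchwartzMap.lineDerivOp_apply_eq_fderiv, neg_eq_zero]
  have h1 : HasFDerivAt (fun y => (φ y).im) (Complex.imCLM ∘L fderiv ℝ φ x) x :=
    Complex.imCLM.hasFDerivAt.comp x (φ.differentiable x).hasFDerivAt
  simp only [hφ] at h1
  have h2 := h1.unique (hasFDerivAt_const (0 : ℝ) x)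
  exact congrArg (fun A : Rd d →L[ℝ] ℝ => A e) h2

/-- Real distributions are represented by real functions. -/
lemma IsReal.linftyFun_im (hu : IsReal u) : ∀ᵐ x, (linftyFun u x).im = 0 := by
  classical
  rw [linftyFun]
  split_ifs with h
  · have hg := h.choose_spec
    set g := h.choose
    have hint : LocallyIntegrable (fun x => (g x).im) volume := by
      intro x
      obtain ⟨s, hs, hi⟩ := ((Lp.memLp g).locallyIntegrable le_top) x
      exact ⟨s, hs, hi.im⟩
    refine ae_eq_zero_of_integral_contDiff_smul_eq_zero hint fun ψ hψ hψc => ?_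
    have hψ' : ContDiff ℝ (⊤ : ℕ∞) fun x => (ψ x : ℂ) := Complex.ofRealCLM.contDiff.comp hψ
    have hψc' : HasCompactSupport fun x => (ψ x : ℂ) :=
      hψc.comp_left (g := Complex.ofReal) (by simp)
    have h1 := hu (hψc'.toSchwartzMap hψ') fun x => by simp
    rw [← hg, Lp.toTemperedDistribution_apply] at h1
    have hgi : Integrable (fun x => (ψ x : ℂ) • g x) := by
      have h2 := ((Lp.memLp g).locallyIntegrable le_top).integrable_smul_left_of_hasCompactSupport
        hψ.continuous hψc
      exact h2
    have h3 := Complex.imCLM.integral_comp_comm hgi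
    have h4 : (∫ x, (hψc'.toSchwartzMap hψ') x • g x) = ∫ x, (ψ x : ℂ) • g x := rfl
    rw [h4] at h1
    rw [← h1]
    refine Eq.trans (integral_congr_ae (ae_of_all _ fun x => ?_)) h3
    simp
  · exact ae_of_all _ fun x => by simp

lemma isReal_ofBounded {g : Rd d → ℂ} (hg : ∀ᵐ x, (g x).im = 0) : IsReal (ofBounded g) := by
  classical
  rw [ofBounded]
  split_ifs with h
  · intro φ hφ
    rw [Lp.toTemperedDistribution_apply]
    refine integral_im_eq_zero ?_
    filter_upwards [hg, h.coeFn_toLp] with x h1 h2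
    rw [h2, smul_eq_mul, Complex.mul_im, h1, hφ]
    simp
  · exact IsReal.zero

section Operations

variable {p : ℕ → Rd d → ℝ} (hp : IsDyadicPartition p)

include hp

lemma IsReal.block_mul_block (hu : IsReal u) (hv : IsReal v) (m n : ℕ) :
    IsReal (ofBounded fun x =>
      linftyFun (Kolmogorov.block p m u) x * linftyFun (Kolmogorov.block p n v) x) := by
  refine isReal_ofBounded ?_
  filter_upwards [(hu.block hp m).linftyFun_im, (hv.block hp n).linftyFun_im] with x h1 h2
  rw [Complex.mul_im, h1, h2]
  simp

lemma IsReal.prod (hu : IsReal u) (hv : IsReal v) : IsReal (Kolmogorov.prod p u v) :=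
  ((IsReal.tsum fun n => IsReal.sum _ fun m _ => hu.block_mul_block hp hv m n).add
    (IsReal.tsum fun n => IsReal.sum _ fun m _ => hv.block_mul_block hp hu m n)).add
    (IsReal.tsum fun n => IsReal.sum _ fun m _ => hu.block_mul_block hp hv m n)

lemma IsReal.dotGrad {V : Fin d → Distr d} (hV : ∀ i, IsReal (V i)) (hu : IsReal u) :
    IsReal (Kolmogorov.dotGrad p V u) :=
  IsReal.sum _ fun i _ => (hV i).prod hp (hu.lineDeriv _)

variable (ν : Measure (Metric.sphere (0 : Rd d) 1))

omit hp in
lemma density_im (α t : ℝ) (x : Rd d) : (density α ν t x).im = 0 := by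
  refine Complex.conj_eq_iff_im.1 ?_
  rw [density, conj_fourierInv]
  simp only [Complex.conj_ofReal, symb_neg]

/-- The symbol is real and even, so the kernel is real, and real blocks have representatives that
are real almost everywhere. -/
lemma IsReal.semigroup (α t : ℝ) (hu : IsReal u) : IsReal (Kolmogorov.semigroup p α ν t u) := by
  classical
  rw [Kolmogorov.semigroup]
  split_ifs with h
  · exact hu
  · refine IsReal.tsum fun n => isReal_ofBounded (ae_of_all _ fun x => integral_im_eq_zero ?_)
    have h1 := (quasiMeasurePreserving_sub_left volume x).ae (hu.block hp n).linftyFun_im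
    filter_upwards [h1] with y hy
    rw [Complex.mul_im, density_im, hy]
    simp

variable [IsFiniteMeasure ν] (hspan : Submodule.span ℝ
      ((fun ξ : Metric.sphere (0 : Rd d) 1 => (ξ : Rd d)) '' ν.support) = ⊤)
  {α : ℝ} (hα : α ∈ Ioc (1 : ℝ) 2)
  {T β θ : ℝ} (hβ : -α < β) (hβ2 : -2 < β) (hβ' : β < 0) (hθ1 : 1 - β < θ) (hθ : θ < β + α)

include hspan hα hβ hβ' hθ1

lemma isReal_mild {uT : Distr d} (huT : besovNorm p θ uT < ⊤) (hr : IsReal uT) {G : ℝ → Distr d}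
    (hG : ContB p T β G) (hGr : ∀ s ∈ Icc 0 T, IsReal (G s)) {t : ℝ} (ht : t ∈ Icc 0 T) :
    IsReal (emb (mild p α ν T (rep p uT) G t)) := by
  intro φ hφ
  rw [(emb_mild_apply ν hspan hα hp hβ hβ' (by linarith) huT hG ht φ).2, Complex.add_im,
    hr.semigroup hp ν α (T - t) φ hφ, zero_add, intervalIntegral.integral_of_le ht.2]
  refine integral_im_eq_zero ?_
  filter_upwards [ae_restrict_mem measurableSet_Ioc] with s hs
  exact (hGr s ⟨ht.1.trans hs.1.le, hs.2⟩).semigroup hp ν α (s - t) φ hφ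

include hβ2 hθ

/-- The Picard iterates for real data are real. -/
lemma isReal_picard {uT : Distr d} {f : ℝ → Distr d} {V : ℝ → Fin d → Distr d}
    (hd : IsData p T β θ uT f V) (hr : IsReal uT) (hf : ∀ t ∈ Icc 0 T, IsReal (f t))
    (hV : ∀ t ∈ Icc 0 T, ∀ i, IsReal (V t i)) (n : ℕ) :
    ∀ t ∈ Icc 0 T, IsReal (emb (picard p α ν T (rep p uT) f V n t)) := by
  have h0 : 0 < θ := by linarith
  have hx : MemC p θ (emb (rep p uT)) := by rw [emb_rep hp h0 hd.1.1]; exact hd.1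
  induction n with
  | zero =>
    intro t ht
    rw [picard, ← semigroup_eq_rep ν hspan hα hp h0 (sub_nonneg.2 ht.2) hd.1.1]
    exact hr.semigroup hp ν α _
  | succ n ih =>
    intro t ht
    have hm := (memCT_picard ν hspan hα hp hβ hβ2 hβ' hθ1 hθ hx hd.2.1.contB
      (fun i => (hd.2.2 i).contB) n).contB
    exact isReal_mild hp ν hspan hα hβ hβ' hθ1 hd.1.1 hr
      ((contB_dotGrad hp hβ' hβ2 hθ1 (fun i => (hd.2.2 i).contB) hm).sub hd.2.1.contB)
      (fun s hs => (IsReal.dotGrad hp (hV s hs) (ih s hs)).sub (hf s hs)) ht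

/-- Existence of regular mild solutions, which are real for real data. -/
lemma exists_isRegularMildSolution (hT : 0 < T) {uT : Distr d} {f : ℝ → Distr d}
    {V : ℝ → Fin d → Distr d} (hd : IsData p T β θ uT f V) :
    ∃ u, IsRegularMildSolution p α ν T θ uT f V u ∧
      (IsReal uT → (∀ t ∈ Icc 0 T, IsReal (f t)) → (∀ t ∈ Icc 0 T, ∀ i, IsReal (V t i)) →
        ∀ t ∈ Icc 0 T, IsReal (u t)) := by
  have h0 : 0 < θ := by linarith
  have hx : MemC p θ (emb (rep p uT)) := by rw [emb_rep hp h0 hd.1.1]; exact hd.1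
  obtain ⟨z, hz, hlim, hfix⟩ := exists_picard_limit ν hspan hα hp hβ hβ2 hβ' hθ1 hθ hT hx
    hd.2.1.contB fun i => (hd.2.2 i).contB
  refine ⟨fun t => emb (z t), isRegularMildSolution_of_eq ν hspan hα hp hβ hβ2 hβ' hθ1 hθ hd hz
    fun t ht => congrArg emb (hfix t ht), fun hr hf hV t ht => ?_⟩
  exact IsReal.of_tendsto ((emb_continuous.tendsto _).comp (hlim t ht)) fun n =>
    isReal_picard hp ν hspan hα hβ hβ2 hβ' hθ1 hθ hd hr hf hV n t ht

end Operations

end Reality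

end Kolmogorov

end

/-! ### Conclusion -/

theorem mainTheorem5 {d : ℕ} (p : ℕ → Kolmogorov.Rd d → ℝ) (hp : Kolmogorov.IsDyadicPartition p)
    (ν : Measure (Metric.sphere (0 : Kolmogorov.Rd d) 1)) [IsFiniteMeasure ν] (hν : ν ≠ 0)
    (hν_symm : ν.map (fun ξ => -ξ) = ν)
    (hν_span : Submodule.span ℝ
      ((fun ξ : Metric.sphere (0 : Kolmogorov.Rd d) 1 => (ξ : Kolmogorov.Rd d)) '' ν.support) = ⊤)
    (α β θ T : ℝ) (hα : α ∈ Ioc (1 : ℝ) 2) (hβ : β ∈ Ioo ((1 - α) / 2) 0)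
    (hθ : θ ∈ Ioo (1 - β) (β + α)) (hT : 0 < T) :
    -- existence and uniqueness (and real solutions for real data)
    (∀ (uT : Kolmogorov.Distr d) (f : ℝ → Kolmogorov.Distr d)
        (V : ℝ → Fin d → Kolmogorov.Distr d), Kolmogorov.IsData p T β θ uT f V →
      ∃ u : ℝ → Kolmogorov.Distr d,
        Kolmogorov.IsRegularMildSolution p α ν T θ uT f V u ∧
        (∀ w : ℝ → Kolmogorov.Distr d,
          Kolmogorov.IsRegularMildSolution p α ν T θ uT f V w → EqOn w u (Icc 0 T)) ∧
        (Kolmogorov.IsReal uT → (∀ t ∈ Icc 0 T, Kolmogorov.IsReal (f t)) →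
          (∀ t ∈ Icc 0 T, ∀ i, Kolmogorov.IsReal (V t i)) →
          ∀ t ∈ Icc 0 T, Kolmogorov.IsReal (u t))) ∧
    -- continuity of the solution map
    (∀ (uT : Kolmogorov.Distr d) (f : ℝ → Kolmogorov.Distr d)
        (V : ℝ → Fin d → Kolmogorov.Distr d) (u : ℝ → Kolmogorov.Distr d),
      Kolmogorov.IsData p T β θ uT f V →
      Kolmogorov.IsRegularMildSolution p α ν T θ uT f V u →
      ∀ ε : ℝ≥0∞, 0 < ε → ∃ δ : ℝ≥0∞, 0 < δ ∧
        ∀ (uT' : Kolmogorov.Distr d) (f' : ℝ → Kolmogorov.Distr d)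
          (V' : ℝ → Fin d → Kolmogorov.Distr d) (u' : ℝ → Kolmogorov.Distr d),
        Kolmogorov.IsData p T β θ uT' f' V' →
        Kolmogorov.IsRegularMildSolution p α ν T θ uT' f' V' u' →
        Kolmogorov.besovNorm p θ (uT' - uT) < δ →
        Kolmogorov.ctNorm p T β (fun t => f' t - f t) < δ →
        (∀ i, Kolmogorov.ctNorm p T β (fun t => V' t i - V t i) < δ) →
        Kolmogorov.ctNorm p T θ (fun t => u' t - u t) +
          Kolmogorov.holderNorm T (θ / α) (fun t => u' t - u t) < ε) := by
  have hα1 := hα.1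
  have hα2 := hα.2
  have hβ1 := hβ.1
  -- From `1 < α ≤ 2` one gets `-α < -1 < -1/2 ≤ (1 - α) / 2 < β`, which also gives `-2 < β`.
  have hβ0 : -α < β := by linarith
  have hβ2 : -2 < β := by linarith
  refine ⟨fun uT f V hd => ?_, fun uT f V u hd hu ε hε => ?_⟩
  · obtain ⟨u, hu, hr⟩ := Kolmogorov.exists_isRegularMildSolution hp ν hν_span hα hβ0 hβ2 hβ.2
      hθ.1 hθ.2 hT hd
    exact ⟨u, hu, fun w hw => Kolmogorov.eqOn_of_isRegularMildSolution ν hν_span hα hp hβ0 hβ2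
      hβ.2 hθ.1 hθ.2 hT hd hu hw, hr⟩
  · exact Kolmogorov.solution_map_continuous ν hν_span hα hp hβ0 hβ2 hβ.2 hθ.1 hθ.2 hT hd hu hε
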